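/- Let $1<\alpha<2$, $0\le r\le 1$, and let $\beta\in[\alpha-1,1]$ be determined by $$r=\frac{\sin(\pi\beta)}{\sin(\pi(\alpha-\beta))+\sin(\pi\beta)}.$$ For real $a,b$ put $\omega^{(a,b)}(x)=(1-x)^a x^b$ on $(0,1)$, and let $L^2_{\omega^{(a,b)}}(0,1)$ be the space of (classes of) measurable functions $v$ with $\int_0^1 \omega^{(a,b)}v^2\,dx<\infty$. For $0<\sigma<1$ let $${}_0I_x^{\sigma}w(x)=\frac1{\Gamma(\sigma)}\int_0^x w(s)(x-s)^{\sigma-1}\,ds,\qquad {}_xI_1^{\sigma}w(x)=\frac1{\Gamma(\sigma)}\int_x^1 w(s)(s-x)^{\sigma-1}\,ds .$$ Let $K$ be a measurable function with $0<K_m\le K(x)\le K_M<\infty$ on $(0,1)$, and let $f\in L^2_{\omega^{(\beta,\alpha-\beta)}}(0,1)$. Then there is exactly one $u\in L^2_{\omega^{(-(\alpha-\beta),-\beta)}}(0,1)$ that solves $$-D\Big[K(x)\big(r\,{}_0I_x^{2-\alpha}+(1-r)\,{}_xI_1^{2-\alpha}\big)Du(x)\Big]=f(x),\quad x\in(0,1),\qquad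 u(0)=u(1)=0 .$$ Here $u$ is a solution if $u$ has essential limit $0$ at $0$ and at $1$, and there is a locally integrable function $q$ on $(0,1)$ (the flux $\big(r\,{}_0I_x^{2-\alpha}+(1-r)\,{}_xI_1^{2-\alpha}\big)Du$) such that for all $\varphi\in C_c^\infty(0,1)$ $$\int_0^1 q\,\varphi\,dx=-\int_0^1 u\;D\big(r\,{}_xI_1^{2-\alpha}\varphi+(1-r)\,{}_0I_x^{2-\alpha}\varphi\big)dx \quad\text{and}\quad \int_0^1 K\,q\,D\varphi\,dx=\int_0^1 f\,\varphi\,dx .$$ -/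

import Mathlib

open MeasureTheory Set Filter Topology
open scoped ContDiff

noncomputable section

namespace FracDiff

/-- The weight `ω^{(a,b)}(x) = (1 - x)^a x^b` on `(0,1)`. -/
def weight (a b x : ℝ) : ℝ := (1 - x) ^ a * x ^ b

/-- The measure `ω^{(a,b)}(x) dx` on `(0,1)`, so that `L²_{ω^{(a,b)}}(0,1)` is
`Lp ℝ 2 (weightMeasure a b)`. -/
def weightMeasure (a b : ℝ) : Measure ℝ :=
  (volume.restrict (Ioo (0 : ℝ) 1)).withDensity fun x => ENNReal.ofReal (weight a b x)

/-- The left fractional integral `₀I_x^σ w`. -/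
def leftInt (σ : ℝ) (w : ℝ → ℝ) (x : ℝ) : ℝ :=
  1 / Real.Gamma σ * ∫ s in (0 : ℝ)..x, w s * (x - s) ^ (σ - 1)

/-- The right fractional integral `ₓI_1^σ w`. -/
def rightInt (σ : ℝ) (w : ℝ → ℝ) (x : ℝ) : ℝ :=
  1 / Real.Gamma σ * ∫ s in x..(1 : ℝ), w s * (s - x) ^ (σ - 1)

/-- Test functions: smooth with compact support contained in `(0,1)`. -/
def IsTest (φ : ℝ → ℝ) : Prop :=
  ContDiff ℝ ∞ φ ∧ HasCompactSupport φ ∧ tsupport φ ⊆ Ioo 0 1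

/-- The value of the distributional derivative `Du` on a function `ψ` that need not vanish at
the endpoints: `⟨Du, ψ⟩ = -∫₀¹ u ψ'`. There are no boundary terms, because this is used for
functions `u` with `u(0) = u(1) = 0`. -/
def derivPairing (u ψ : ℝ → ℝ) : ℝ := -∫ x in Ioo (0 : ℝ) 1, u x * deriv ψ x

/-- `q = (r ₀I_x^{2-α} + (1-r) ₓI_1^{2-α}) Du` on `(0,1)` in the sense of distributions. The
fractional integrals of the distribution `Du` are defined by transposition; the transpose of
`₀I_x^σ` is `ₓI_1^σ` and conversely. -/
def IsFlux (α r : ℝ) (u q : ℝ → ℝ) : Prop :=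
  LocallyIntegrableOn q (Ioo 0 1) ∧
  ∀ φ : ℝ → ℝ, IsTest φ →
    ∫ x in Ioo (0 : ℝ) 1, q x * φ x =
      r * derivPairing u (rightInt (2 - α) φ) + (1 - r) * derivPairing u (leftInt (2 - α) φ)

/-- `-DQ = f` on `(0,1)` in the sense of distributions. -/
def NegWeakDeriv (Q f : ℝ → ℝ) : Prop :=
  ∀ φ : ℝ → ℝ, IsTest φ →
    ∫ x in Ioo (0 : ℝ) 1, Q x * deriv φ x = ∫ x in Ioo (0 : ℝ) 1, f x * φ x

/-- `u` solves `-D[K (r ₀I_x^{2-α} + (1-r) ₓI_1^{2-α}) Du] = f` on `(0,1)`, `u(0) = u(1) = 0`.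
The equation holds in the sense of distributions, the flux being a locally integrable function.
The boundary values are attained as essential limits, so that the notion depends only on the
class of `u` modulo equality almost everywhere on `(0,1)`. -/
structure IsSolution (α r : ℝ) (K f u : ℝ → ℝ) : Prop where
  equation : ∃ q : ℝ → ℝ, IsFlux α r u q ∧ NegWeakDeriv (fun x => K x * q x) f
  left_zero : Tendsto u (𝓝[>] 0 ⊓ ae volume) (𝓝 0)
  right_zero : Tendsto u (𝓝[<] 1 ⊓ ae volume) (𝓝 0)

end FracDiff

end

namespace FracDiff

/-! Put `A = 1 - β` and `B = 1 - (α - β)`, so that `A + B = 2 - α` lies in `(0,1)`. The relation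
between `r` and `β` makes the two-sided fractional integral of order `A + B` a product of one-sided
ones and power weights, `r ₓI_1^{A+B} φ + (1-r) ₀I_x^{A+B} φ = lam x^A ₀I_x^B [t^{-(A+B)} ₜI_1^A
[s^B φ]]` (`Admissible.factorization`): the product kernel is a Möbius image of Euler's Beta
integral, and the constants match by the reflection formula for `Γ`. Differentiating and transposing
this identity, the flux of `u` becomes `q = lam s^B D W` with `W = ₀I^A U` and `U = b^{1-(A+B)}
I_1^B [x^{A-1} u]` (`Admissible.pairing_eq`). The two-sided problem is thereby reduced to two
one-sided Abel equations and one integration.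

Uniqueness (`Admissible.unique`). For the difference of two solutions `K q` is a constant `C`, hence
`lam W = C ∫_0^x s^{-B}/K ds + D`. The zero limit of `u` at `0` passes to `U` and `W`, so `D = 0`.
Cancelling `₀I^A` gives `lam U = C ₀I^{1-A}[s^{-B}/K]`. The zero limit of `u` at `1` passes to `U`,
while that fractional integral stays bounded below near `1`, so `C = 0`. Then `U = 0`, and
injectivity of the Abel integral gives `u = 0`. The two boundary conditions thus remove exactly the
two constants of integration.

Existence. Let `F` be a primitive of `f`. It grows at the endpoints at most like an arbitrarily
small negative power, and `q = (c - F)/K` solves the outer equation for every `c`. Reading the flux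
formula backwards prescribes `U = lam⁻¹ ₀I^{1-A}[s^{-B} q]`. For `u` to vanish at `1`, `U` must
vanish there, which is the orthogonality `∫ (1-s)^{-A} s^{-B} q = 0`; it fixes `c`
(`Admissible.exists_flux`). Now `b^{A+B-1} ₀I^{1-A}[s^{-B} q]` is weighted Hölder of an order above
`B` and vanishes at `1`, so the right Abel equation of order `B` is solved by a Marchaud derivative
(`IsHolderVanishing.exists_abel_solution`). The resulting `u` is bounded by a positive power of `x
(1 - x)`, which yields both the boundary values and membership in the weighted space
(`Admissible.exists_of_flux`). -/

/-! ### Beta integrals on intervals and their Möbius image. -/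

theorem integrableOn_beta {p q : ℝ} (hp : 0 < p) (hq : 0 < q) :
    IntegrableOn (fun y : ℝ => y ^ (p - 1) * (1 - y) ^ (q - 1)) (Ioo 0 1) := by
  have h := Complex.betaIntegral_convergent (u := p) (v := q) (by simpa) (by simpa)
  rw [intervalIntegrable_iff_integrableOn_Ioo_of_le zero_le_one] at h
  refine IntegrableOn.congr_fun (Integrable.norm h) (fun y hy => ?_) measurableSet_Ioo
  have h1 : (0:ℝ) < 1 - y := sub_pos.2 hy.2
  have e1 : ‖(y : ℂ) ^ ((p : ℂ) - 1)‖ = y ^ (p - 1) := by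
    rw [Complex.norm_cpow_eq_rpow_re_of_pos hy.1]; simp
  have e2 : ‖(1 - (y : ℂ)) ^ ((q : ℂ) - 1)‖ = (1 - y) ^ (q - 1) := by
    have : (1 - (y : ℂ)) = ((1 - y : ℝ) : ℂ) := by push_cast; ring
    rw [this, Complex.norm_cpow_eq_rpow_re_of_pos h1]; simp
  simp only [norm_mul, e1, e2]

theorem integral_beta {p q : ℝ} (hp : 0 < p) (hq : 0 < q) :
    ∫ y in Ioo (0 : ℝ) 1, y ^ (p - 1) * (1 - y) ^ (q - 1) =
      Real.Gamma p * Real.Gamma q / Real.Gamma (p + q) := by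
  have h := ProbabilityTheory.beta_eq_betaIntegralReal p q hp hq
  rw [ProbabilityTheory.beta, Complex.betaIntegral,
    intervalIntegral.integral_of_le zero_le_one, integral_Ioc_eq_integral_Ioo] at h
  have h2 : ∫ y in Ioo (0 : ℝ) 1, (y : ℂ) ^ ((p : ℂ) - 1) * (1 - (y : ℂ)) ^ ((q : ℂ) - 1) =
      ((∫ y in Ioo (0 : ℝ) 1, y ^ (p - 1) * (1 - y) ^ (q - 1) : ℝ) : ℂ) := by
    rw [← integral_complex_ofReal]
    refine setIntegral_congr_fun measurableSet_Ioo fun y hy => ?_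
    have h1 : (0:ℝ) ≤ 1 - y := (sub_pos.2 hy.2).le
    push_cast [Complex.ofReal_cpow hy.1.le, Complex.ofReal_cpow h1]
    rfl
  rw [h2, Complex.ofReal_re] at h
  exact h.symm

/-- The affine map from `(0,1)` onto `(a,x)`. -/
theorem image_affine_Ioo {a x : ℝ} (hax : a < x) :
    (fun y : ℝ => a + (x - a) * y) '' Ioo 0 1 = Ioo a x := by
  have hd : 0 < x - a := sub_pos.2 hax
  ext t
  simp only [mem_image, mem_Ioo]
  constructor
  · rintro ⟨y, ⟨h0, h1⟩, rfl⟩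
    constructor <;> nlinarith
  · rintro ⟨h0, h1⟩
    refine ⟨(t - a) / (x - a), ⟨div_pos (by linarith) hd, (div_lt_one hd).2 (by linarith)⟩, ?_⟩
    field_simp
    ring

theorem injOn_affine {a x : ℝ} (hax : a < x) (s : Set ℝ) :
    InjOn (fun y : ℝ => a + (x - a) * y) s := by
  intro y _ z _ h
  have hd : x - a ≠ 0 := (sub_pos.2 hax).ne'
  simpa [hd] using h

theorem hasDerivAt_affine (a x y : ℝ) :
    HasDerivAt (fun y : ℝ => a + (x - a) * y) (x - a) y := by
  simpa using ((hasDerivAt_id y).const_mul (x - a)).const_add a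

theorem integral_Ioo_eq_affine {a x : ℝ} (hax : a < x) (g : ℝ → ℝ) :
    ∫ t in Ioo a x, g t = (x - a) * ∫ y in Ioo (0 : ℝ) 1, g (a + (x - a) * y) := by
  rw [← image_affine_Ioo hax, integral_image_eq_integral_abs_deriv_smul measurableSet_Ioo
    (fun y _ => (hasDerivAt_affine a x y).hasDerivWithinAt) (injOn_affine hax _)]
  simp [abs_of_pos (sub_pos.2 hax), integral_const_mul]

theorem integrableOn_Ioo_iff_affine {a x : ℝ} (hax : a < x) (g : ℝ → ℝ) :
    IntegrableOn g (Ioo a x) ↔ IntegrableOn (fun y => g (a + (x - a) * y)) (Ioo 0 1) := by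
  rw [← image_affine_Ioo hax, integrableOn_image_iff_integrableOn_abs_deriv_smul measurableSet_Ioo
    (fun y _ => (hasDerivAt_affine a x y).hasDerivWithinAt) (injOn_affine hax _)]
  have hd : x - a ≠ 0 := (sub_pos.2 hax).ne'
  simp only [smul_eq_mul]
  rw [IntegrableOn, integrable_const_mul_iff (by simpa using hd)]
  rfl

theorem beta_affine_eq {a x p q y : ℝ} (hax : a < x) (hy : y ∈ Ioo (0 : ℝ) 1) :
    (a + (x - a) * y - a) ^ (p - 1) * (x - (a + (x - a) * y)) ^ (q - 1) =
      (x - a) ^ (p + q - 2) * (y ^ (p - 1) * (1 - y) ^ (q - 1)) := by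
  have hd : 0 < x - a := sub_pos.2 hax
  have e1 : a + (x - a) * y - a = (x - a) * y := by ring
  have e2 : x - (a + (x - a) * y) = (x - a) * (1 - y) := by ring
  rw [e1, e2, Real.mul_rpow hd.le hy.1.le, Real.mul_rpow hd.le (sub_pos.2 hy.2).le,
    show p + q - 2 = (p - 1) + (q - 1) by ring, Real.rpow_add hd]
  ring

theorem integrableOn_beta_Ioo {a x p q : ℝ} (hp : 0 < p) (hq : 0 < q) :
    IntegrableOn (fun t : ℝ => (t - a) ^ (p - 1) * (x - t) ^ (q - 1)) (Ioo a x) := by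
  rcases le_or_gt x a with hax | hax
  · simp [Ioo_eq_empty_of_le hax]
  rw [integrableOn_Ioo_iff_affine hax]
  refine IntegrableOn.congr_fun ((integrableOn_beta hp hq).const_mul ((x - a) ^ (p + q - 2)))
    (fun y hy => ?_) measurableSet_Ioo
  exact (beta_affine_eq hax hy).symm

theorem integral_beta_Ioo {a x p q : ℝ} (hax : a < x) (hp : 0 < p) (hq : 0 < q) :
    ∫ t in Ioo a x, (t - a) ^ (p - 1) * (x - t) ^ (q - 1) =
      (x - a) ^ (p + q - 1) * (Real.Gamma p * Real.Gamma q / Real.Gamma (p + q)) := by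
  have hd : 0 < x - a := sub_pos.2 hax
  rw [integral_Ioo_eq_affine hax, setIntegral_congr_fun measurableSet_Ioo
    (fun y hy => beta_affine_eq hax hy), integral_const_mul, integral_beta hp hq,
    show p + q - 1 = 1 + (p + q - 2) by ring, Real.rpow_add hd, Real.rpow_one]
  ring

/-- The Möbius substitution that turns Euler's integral into the one below. -/
theorem image_moebius_Ioo {s x : ℝ} (hs : 0 < s) (hsx : s < x) :
    (fun y : ℝ => s * x * y / (x - s + s * y)) '' Ioo 0 1 = Ioo 0 s := by
  have hd : 0 < x - s := sub_pos.2 hsx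
  ext t
  simp only [mem_image, mem_Ioo]
  constructor
  · rintro ⟨y, ⟨h0, h1⟩, rfl⟩
    have hD : 0 < x - s + s * y := by positivity
    refine ⟨by have := hs.trans hsx; positivity, ?_⟩
    rw [div_lt_iff₀ hD]
    nlinarith [mul_pos hs (mul_pos hd (sub_pos.2 h1))]
  · rintro ⟨h0, h1⟩
    have hxt : 0 < x - t := by linarith
    refine ⟨t * (x - s) / (s * (x - t)), ⟨by positivity, ?_⟩, ?_⟩
    · rw [div_lt_one (by positivity)]
      nlinarith [mul_pos (hs.trans hsx) (sub_pos.2 h1)]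
    · have hx : x ≠ 0 := (hs.trans hsx).ne'
      have hne : x - s + s * (t * (x - s) / (s * (x - t))) = x * (x - s) / (x - t) := by
        field_simp
        ring
      rw [hne]
      field_simp

/-- The three exponents add up to `-2`, so the denominators produced by the Möbius map cancel
against its Jacobian and only a Beta integrand remains. -/
theorem integral_moebius_beta {s x a c : ℝ} (hs : 0 < s) (hsx : s < x) (ha : 0 < a) (hc : 0 < c) :
    ∫ t in Ioo 0 s, t ^ (c - 1) * (s - t) ^ (a - 1) * (x - t) ^ (-(a + c)) =
      Real.Gamma a * Real.Gamma c / Real.Gamma (a + c) *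
        (s ^ (a + c - 1) * x ^ (-a) * (x - s) ^ (-c)) := by
  have hd : 0 < x - s := sub_pos.2 hsx
  have hx : 0 < x := hs.trans hsx
  have hD : ∀ y ∈ Ioo (0 : ℝ) 1, 0 < x - s + s * y := fun y hy =>
    add_pos hd (mul_pos hs hy.1)
  have hder : ∀ y ∈ Ioo (0 : ℝ) 1, HasDerivWithinAt (fun y : ℝ => s * x * y / (x - s + s * y))
      (s * x * (x - s) / (x - s + s * y) ^ 2) (Ioo 0 1) y := by
    intro y hy
    have h1 : HasDerivAt (fun y : ℝ => s * x * y) (s * x) y := by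
      simpa using (hasDerivAt_id y).const_mul (s * x)
    have h2 : HasDerivAt (fun y : ℝ => x - s + s * y) s y := by
      simpa using ((hasDerivAt_id y).const_mul s).const_add (x - s)
    refine ((h1.div h2 (hD y hy).ne').congr_deriv ?_).hasDerivWithinAt
    congr 1
    ring
  have hinj : InjOn (fun y : ℝ => s * x * y / (x - s + s * y)) (Ioo 0 1) := by
    intro y hy z hz h
    have h1 := (hD y hy).ne'
    have h2 := (hD z hz).ne'
    simp only at h
    rw [div_eq_div_iff h1 h2] at h
    have : s * x * (x - s) * (y - z) = 0 := by linear_combination h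
    have h3 : s * x * (x - s) ≠ 0 := by positivity
    exact sub_eq_zero.1 ((mul_eq_zero.1 this).resolve_left h3)
  rw [← image_moebius_Ioo hs hsx, integral_image_eq_integral_abs_deriv_smul measurableSet_Ioo
    hder hinj, add_comm a c, mul_comm (Real.Gamma a), ← integral_beta hc ha, ← integral_mul_const]
  refine setIntegral_congr_fun measurableSet_Ioo fun y hy => ?_
  have hy0 := hy.1
  have hy1 : 0 < 1 - y := sub_pos.2 hy.2
  have hDy := hD y hy
  set D := x - s + s * y with hDdef
  have e1 : s - s * x * y / D = s * (x - s) * (1 - y) / D := by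
    field_simp
    rw [hDdef]; ring
  have e2 : x - s * x * y / D = x * (x - s) / D := by
    field_simp
    rw [hDdef]; ring
  simp only [smul_eq_mul]
  rw [e1, e2, abs_of_pos (by positivity)]
  -- All bases are positive, so the identity between powers is checked as a linear identity between
  -- logarithms.
  have hl : Real.log (x * (x - s) / D) = Real.log x + Real.log (x - s) - Real.log D := by
    rw [Real.log_div (by positivity) hDy.ne', Real.log_mul hx.ne' hd.ne']
  rw [show s * x * (x - s) / D ^ 2 = Real.exp (Real.log s + Real.log x + Real.log (x - s)
      - 2 * Real.log D) by
        rw [Real.exp_sub, Real.exp_add, Real.exp_add, Real.exp_log hs, Real.exp_log hx,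
          Real.exp_log hd, two_mul, Real.exp_add, Real.exp_log hDy, sq]]
  simp only [Real.rpow_def_of_pos hs, Real.rpow_def_of_pos hx, Real.rpow_def_of_pos hd,
    Real.rpow_def_of_pos hy0, Real.rpow_def_of_pos hy1,
    Real.rpow_def_of_pos (show 0 < s * x * y / D by positivity),
    Real.rpow_def_of_pos (show 0 < s * (x - s) * (1 - y) / D by positivity),
    Real.rpow_def_of_pos (show 0 < x * (x - s) / D by positivity), ← Real.exp_add]
  congr 1
  rw [hl, Real.log_div (by positivity) hDy.ne', Real.log_div (by positivity) hDy.ne',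
    Real.log_mul (by positivity) hy0.ne', Real.log_mul hs.ne' hx.ne',
    Real.log_mul (by positivity) hy1.ne', Real.log_mul hs.ne' hd.ne']
  ring

/-! ### Fractional integrals on the unit interval: kernels, reflection, bounds. -/

/-- Lebesgue measure on `(0,1)`. -/
noncomputable abbrev unitVol : Measure ℝ := volume.restrict (Ioo (0 : ℝ) 1)

/-- The Abel kernel `(x - s)_+^{a-1} / Γ(a)`. -/
noncomputable def abelKernel (a x s : ℝ) : ℝ :=
  if s < x then (x - s) ^ (a - 1) / Real.Gamma a else 0

/-- The left fractional integral of order `a ≥ 0` on `(0,1)`, the identity for `a = 0`. -/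
noncomputable def fracLeft (a : ℝ) (h : ℝ → ℝ) (x : ℝ) : ℝ :=
  if a = 0 then h x else ∫ s, abelKernel a x s * h s ∂unitVol

/-- The right fractional integral of order `a ≥ 0` on `(0,1)`, the identity for `a = 0`. -/
noncomputable def fracRight (a : ℝ) (h : ℝ → ℝ) (x : ℝ) : ℝ :=
  if a = 0 then h x else ∫ s, abelKernel a s x * h s ∂unitVol

theorem fracLeft_zero (h : ℝ → ℝ) : fracLeft 0 h = h := by
  ext x; simp [fracLeft]

theorem fracRight_zero (h : ℝ → ℝ) : fracRight 0 h = h := by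
  ext x; simp [fracRight]

theorem fracLeft_of_pos {a : ℝ} (ha : 0 < a) (h : ℝ → ℝ) (x : ℝ) :
    fracLeft a h x = ∫ s, abelKernel a x s * h s ∂unitVol := by
  simp [fracLeft, ha.ne']

theorem fracRight_of_pos {a : ℝ} (ha : 0 < a) (h : ℝ → ℝ) (x : ℝ) :
    fracRight a h x = ∫ s, abelKernel a s x * h s ∂unitVol := by
  simp [fracRight, ha.ne']

theorem fracLeft_const_mul (a c : ℝ) (h : ℝ → ℝ) (x : ℝ) :
    fracLeft a (fun s => c * h s) x = c * fracLeft a h x := by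
  by_cases ha : a = 0
  · simp [fracLeft, ha]
  · simp only [fracLeft, ha, if_false]
    rw [← integral_const_mul]
    congr 1 with s
    ring

theorem fracRight_const_mul (a c : ℝ) (h : ℝ → ℝ) (x : ℝ) :
    fracRight a (fun s => c * h s) x = c * fracRight a h x := by
  by_cases ha : a = 0
  · simp [fracRight, ha]
  · simp only [fracRight, ha, if_false]
    rw [← integral_const_mul]
    congr 1 with s
    ring

theorem abelKernel_nonneg {a : ℝ} (ha : 0 < a) (x s : ℝ) : 0 ≤ abelKernel a x s := by
  unfold abelKernel
  split_ifs with h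
  · exact div_nonneg (Real.rpow_nonneg (sub_pos.2 h).le _) (Real.Gamma_pos_of_pos ha).le
  · exact le_rfl

theorem measurable_abelKernel (a : ℝ) : Measurable fun z : ℝ × ℝ => abelKernel a z.1 z.2 := by
  unfold abelKernel
  refine Measurable.ite (measurableSet_lt measurable_snd measurable_fst) ?_ measurable_const
  fun_prop

theorem measurable_abelKernel_left (a x : ℝ) : Measurable fun s => abelKernel a x s :=
  (measurable_abelKernel a).comp measurable_prodMk_left

theorem abelKernel_one_sub (a x s : ℝ) : abelKernel a (1 - x) (1 - s) = abelKernel a s x := by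
  simp only [abelKernel]
  have : (1 - s < 1 - x) ↔ x < s := by constructor <;> intro h <;> linarith
  simp only [this]
  congr 3
  ring

theorem abelKernel_mul_eq_indicator (a x : ℝ) (h : ℝ → ℝ) :
    (fun s => abelKernel a x s * h s) =
      (Iio x).indicator fun s => (x - s) ^ (a - 1) / Real.Gamma a * h s := by
  ext s
  by_cases hs : s < x <;> simp [abelKernel, hs]

theorem abelKernel_mul_eq_indicator' (a x : ℝ) (h : ℝ → ℝ) :
    (fun s => abelKernel a s x * h s) =
      (Ioi x).indicator fun s => (s - x) ^ (a - 1) / Real.Gamma a * h s := by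
  ext s
  by_cases hs : x < s <;> simp [abelKernel, hs]

theorem Iio_inter_Ioo_of_le {x : ℝ} (hx : x ≤ 1) : Iio x ∩ Ioo (0 : ℝ) 1 = Ioo 0 x := by
  ext s
  simp only [mem_inter_iff, mem_Iio, mem_Ioo]
  constructor
  · rintro ⟨h1, h2, h3⟩; exact ⟨h2, h1⟩
  · rintro ⟨h1, h2⟩; exact ⟨h2, h1, h2.trans_le hx⟩

theorem Ioi_inter_Ioo_of_le {x : ℝ} (hx : 0 ≤ x) : Ioi x ∩ Ioo (0 : ℝ) 1 = Ioo x 1 := by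
  ext s
  simp only [mem_inter_iff, mem_Ioi, mem_Ioo]
  constructor
  · rintro ⟨h1, h2, h3⟩; exact ⟨h1, h3⟩
  · rintro ⟨h1, h2⟩; exact ⟨h1, hx.trans_lt h1, h2⟩

theorem integral_abelKernel_mul {a x : ℝ} (hx : x ≤ 1) (h : ℝ → ℝ) :
    ∫ s, abelKernel a x s * h s ∂unitVol =
      ∫ s in Ioo 0 x, (x - s) ^ (a - 1) / Real.Gamma a * h s := by
  rw [abelKernel_mul_eq_indicator, integral_indicator measurableSet_Iio,
    Measure.restrict_restrict measurableSet_Iio, Iio_inter_Ioo_of_le hx]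

theorem integral_abelKernel_mul' {a x : ℝ} (hx : 0 ≤ x) (h : ℝ → ℝ) :
    ∫ s, abelKernel a s x * h s ∂unitVol =
      ∫ s in Ioo x 1, (s - x) ^ (a - 1) / Real.Gamma a * h s := by
  rw [abelKernel_mul_eq_indicator', integral_indicator measurableSet_Ioi,
    Measure.restrict_restrict measurableSet_Ioi, Ioi_inter_Ioo_of_le hx]

theorem integrable_abelKernel_mul_iff {a x : ℝ} (hx : x ≤ 1) (h : ℝ → ℝ) :
    Integrable (fun s => abelKernel a x s * h s) unitVol ↔
      IntegrableOn (fun s => (x - s) ^ (a - 1) / Real.Gamma a * h s) (Ioo 0 x) := by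
  rw [abelKernel_mul_eq_indicator, integrable_indicator_iff measurableSet_Iio, IntegrableOn,
    Measure.restrict_restrict measurableSet_Iio, Iio_inter_Ioo_of_le hx]
  rfl

theorem leftInt_eq_fracLeft {a x : ℝ} (ha : 0 < a) (hx : x ∈ Ioo (0 : ℝ) 1) (h : ℝ → ℝ) :
    leftInt a h x = fracLeft a h x := by
  rw [fracLeft_of_pos ha, integral_abelKernel_mul hx.2.le, leftInt,
    intervalIntegral.integral_of_le hx.1.le, integral_Ioc_eq_integral_Ioo, ← integral_const_mul]
  congr 1 with s
  ring

theorem rightInt_eq_fracRight {a x : ℝ} (ha : 0 < a) (hx : x ∈ Ioo (0 : ℝ) 1) (h : ℝ → ℝ) :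
    rightInt a h x = fracRight a h x := by
  rw [fracRight_of_pos ha, integral_abelKernel_mul' hx.1.le, rightInt,
    intervalIntegral.integral_of_le hx.2.le, integral_Ioc_eq_integral_Ioo, ← integral_const_mul]
  congr 1 with s
  ring

theorem measurePreserving_one_sub : MeasurePreserving (fun s : ℝ => 1 - s) unitVol unitVol := by
  have h := (Measure.measurePreserving_sub_left volume (1 : ℝ)).restrict_preimage
    (measurableSet_Ioo (a := (0 : ℝ)) (b := 1))
  simpa using h

theorem measurableEmbedding_one_sub : MeasurableEmbedding fun s : ℝ => 1 - s :=
  (Homeomorph.subLeft (1 : ℝ)).measurableEmbedding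

theorem integral_one_sub (g : ℝ → ℝ) : ∫ s, g (1 - s) ∂unitVol = ∫ s, g s ∂unitVol :=
  measurePreserving_one_sub.integral_comp measurableEmbedding_one_sub g

theorem integrable_one_sub {g : ℝ → ℝ} (hg : Integrable g unitVol) :
    Integrable (fun s => g (1 - s)) unitVol :=
  measurePreserving_one_sub.integrable_comp_of_integrable hg

/-- The reflection `x ↦ 1 - x` exchanges the two sides and carries results on left integrals over to
right integrals. -/
theorem fracRight_eq_fracLeft (a : ℝ) (h : ℝ → ℝ) (x : ℝ) :
    fracRight a h x = fracLeft a (fun s => h (1 - s)) (1 - x) := by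
  by_cases ha : a = 0
  · simp [fracLeft, fracRight, ha]
  · simp only [fracLeft, fracRight, ha, if_false]
    rw [← integral_one_sub]
    congr 1 with s
    rw [← abelKernel_one_sub, sub_sub_cancel]

theorem one_sub_mem_Ioo {x : ℝ} (hx : x ∈ Ioo (0 : ℝ) 1) : 1 - x ∈ Ioo (0 : ℝ) 1 :=
  ⟨sub_pos.2 hx.2, by linarith [hx.1]⟩

theorem integrable_abelKernel {a x : ℝ} (ha : 0 < a) (hx : x ≤ 1) :
    Integrable (fun s => abelKernel a x s) unitVol := by
  have := (integrable_abelKernel_mul_iff (a := a) hx fun _ => 1).2 (by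
    refine IntegrableOn.congr_fun ((integrableOn_beta_Ioo (a := 0) (x := x) zero_lt_one
      ha).div_const (Real.Gamma a)) (fun s _ => ?_) measurableSet_Ioo
    simp)
  simpa using this

theorem integral_abelKernel {a x : ℝ} (ha : 0 < a) (hx : x ∈ Ioc (0 : ℝ) 1) :
    ∫ s, abelKernel a x s ∂unitVol = x ^ a / Real.Gamma (a + 1) := by
  have h1 := integral_abelKernel_mul (a := a) hx.2 fun _ => 1
  have h2 := integral_beta_Ioo hx.1 zero_lt_one ha
  simp only [sub_self, Real.rpow_zero, one_mul, sub_zero, Real.Gamma_one,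
    add_sub_cancel_left] at h2
  simp only [mul_one] at h1
  rw [h1, integral_div, h2, add_comm 1 a]
  have := (Real.Gamma_pos_of_pos ha).ne'
  field_simp

theorem integrable_abelKernel_right {a x : ℝ} (ha : 0 < a) (hx : 0 ≤ x) :
    Integrable (fun s => abelKernel a s x) unitVol := by
  have := integrable_one_sub (integrable_abelKernel ha (x := 1 - x) (by linarith))
  simpa only [abelKernel_one_sub] using this

theorem ae_unitVol_mem : ∀ᵐ x ∂unitVol, x ∈ Ioo (0 : ℝ) 1 := ae_restrict_mem measurableSet_Ioo

/-- As `c ≥ 0`, the factor `s^c` is at most `x^c` on `(0,x)`, and the kernel has total mass `x^a /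
Γ(a+1)`. The bound at the point `x` itself is there for order `0`, where the operator is the
identity. -/
theorem abs_fracLeft_le {a c M x : ℝ} (ha : 0 ≤ a) (hc : 0 ≤ c) (hM : 0 ≤ M)
    (hx : x ∈ Ioo (0 : ℝ) 1) {h : ℝ → ℝ} (hxx : |h x| ≤ M * x ^ c)
    (hh : ∀ᵐ s ∂unitVol, s < x → |h s| ≤ M * s ^ c) :
    |fracLeft a h x| ≤ M * x ^ (a + c) / Real.Gamma (a + 1) := by
  rcases ha.eq_or_lt with rfl | ha
  · simpa [fracLeft] using hxx
  rw [fracLeft_of_pos ha]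
  have hb : ∀ᵐ s ∂unitVol, ‖abelKernel a x s * h s‖ ≤ abelKernel a x s * (M * x ^ c) := by
    filter_upwards [hh, ae_unitVol_mem] with s hs hs1
    rw [norm_mul, Real.norm_of_nonneg (abelKernel_nonneg ha _ _)]
    by_cases hsx : s < x
    · refine mul_le_mul_of_nonneg_left ((hs hsx).trans ?_) (abelKernel_nonneg ha _ _)
      exact mul_le_mul_of_nonneg_left (Real.rpow_le_rpow hs1.1.le hsx.le hc) hM
    · simp [abelKernel, hsx]
  have h2 := norm_integral_le_of_norm_le ((integrable_abelKernel ha hx.2.le).mul_const _) hb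
  rw [integral_mul_const, integral_abelKernel ha ⟨hx.1, hx.2.le⟩] at h2
  rw [Real.rpow_add hx.1]
  refine h2.trans_eq ?_
  ring

theorem abs_fracRight_le {a M x : ℝ} (ha : 0 ≤ a) (hM : 0 ≤ M)
    (hx : x ∈ Ioo (0 : ℝ) 1) {h : ℝ → ℝ} (hxx : |h x| ≤ M)
    (hh : ∀ᵐ s ∂unitVol, x < s → |h s| ≤ M) :
    |fracRight a h x| ≤ M / Real.Gamma (a + 1) := by
  rw [fracRight_eq_fracLeft]
  have h1 := abs_fracLeft_le (c := 0) ha le_rfl hM (one_sub_mem_Ioo hx)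
    (h := fun s => h (1 - s)) (by simpa using hxx) (by
      filter_upwards [measurePreserving_one_sub.quasiMeasurePreserving.ae hh] with s hs hs1
      simpa using hs (by linarith))
  refine h1.trans ?_
  have := Real.Gamma_pos_of_pos (show 0 < a + 1 by linarith)
  gcongr
  refine mul_le_of_le_one_right hM (Real.rpow_le_one ?_ ?_ (by linarith))
  · linarith [hx.2]
  · linarith [hx.1]

/-! ### Fubini and the transposition of fractional integrals. -/

/-- Tonelli: `m` dominates the inner integral of absolute values, so integrability of `g m` is
enough. It justifies the interchanges of integrals with Abel kernels. -/
theorem integrable_prod_of_kernel_bound {k : ℝ → ℝ → ℝ} {g h m : ℝ → ℝ}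
    (hk : Measurable fun z : ℝ × ℝ => k z.1 z.2)
    (hg : AEStronglyMeasurable g unitVol) (hh : AEStronglyMeasurable h unitVol)
    (h1 : ∀ᵐ x ∂unitVol, Integrable (fun s => k x s * h s) unitVol)
    (h2 : ∀ᵐ x ∂unitVol, ∫ s, |k x s * h s| ∂unitVol ≤ m x)
    (hm : Integrable (fun x => g x * m x) unitVol) :
    Integrable (fun z : ℝ × ℝ => g z.1 * (k z.1 z.2 * h z.2)) (unitVol.prod unitVol) := by
  have hmeas : AEStronglyMeasurable (fun z : ℝ × ℝ => g z.1 * (k z.1 z.2 * h z.2))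
      (unitVol.prod unitVol) :=
    hg.comp_fst.mul (hk.aestronglyMeasurable.mul hh.comp_snd)
  rw [integrable_prod_iff hmeas]
  refine ⟨h1.mono fun x hx => hx.const_mul (g x), ?_⟩
  refine Integrable.mono' hm.norm hmeas.norm.integral_prod_right' ?_
  filter_upwards [h2] with x hx
  simp only [norm_mul, Real.norm_eq_abs, ← abs_mul] at hx ⊢
  have h0 : 0 ≤ ∫ s, |k x s * h s| ∂unitVol := integral_nonneg fun _ => abs_nonneg _
  rw [abs_of_nonneg (show 0 ≤ ∫ s, |g x * (k x s * h s)| ∂unitVol from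
    integral_nonneg fun _ => abs_nonneg _)]
  simp only [abs_mul (g x), integral_const_mul]
  exact mul_le_mul_of_nonneg_left (hx.trans (le_abs_self _)) (abs_nonneg _)

/-- Fubini for a triangular kernel: integrating it in the other variable gives the right integral.
For `a = 0` there is no kernel, and the product `g h` itself has to be integrable. -/
theorem fracLeft_duality {a : ℝ} (ha : 0 ≤ a) {g h : ℝ → ℝ}
    (h0 : a = 0 → Integrable (fun x => g x * h x) unitVol)
    (h1 : 0 < a → Integrable (fun z : ℝ × ℝ => g z.1 * (abelKernel a z.1 z.2 * h z.2))
      (unitVol.prod unitVol)) :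
    Integrable (fun x => g x * fracLeft a h x) unitVol ∧
    Integrable (fun s => fracRight a g s * h s) unitVol ∧
    ∫ x, g x * fracLeft a h x ∂unitVol = ∫ s, fracRight a g s * h s ∂unitVol := by
  rcases ha.eq_or_lt with rfl | ha
  · simpa [fracLeft_zero, fracRight_zero] using h0 rfl
  have hI := h1 ha
  have e1 : ∀ x, ∫ s, g x * (abelKernel a x s * h s) ∂unitVol = g x * fracLeft a h x := fun x => by
    rw [integral_const_mul, fracLeft_of_pos ha]
  have e2 : ∀ s, ∫ x, g x * (abelKernel a x s * h s) ∂unitVol = fracRight a g s * h s := fun s => by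
    rw [fracRight_of_pos ha, ← integral_mul_const]
    congr 1 with x
    ring
  refine ⟨?_, ?_, ?_⟩
  · simpa only [e1] using hI.integral_prod_left
  · simpa only [e2] using hI.integral_prod_right
  · have := integral_integral_swap (f := fun x s => g x * (abelKernel a x s * h s)) hI
    simpa only [e1, e2] using this

/-- Duality of the fractional integrals for `h` dominated by a power. -/
theorem fracLeft_duality_of_le_rpow {a c M : ℝ} (ha : 0 ≤ a) (hc : 0 ≤ c) (hM : 0 ≤ M)
    {g h : ℝ → ℝ} (hg : AEStronglyMeasurable g unitVol) (hh : AEStronglyMeasurable h unitVol)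
    (hle : ∀ s ∈ Ioo (0 : ℝ) 1, |h s| ≤ M * s ^ c)
    (hgi : Integrable (fun x => g x * x ^ (a + c)) unitVol) :
    Integrable (fun x => g x * fracLeft a h x) unitVol ∧
    Integrable (fun s => fracRight a g s * h s) unitVol ∧
    ∫ x, g x * fracLeft a h x ∂unitVol = ∫ s, fracRight a g s * h s ∂unitVol := by
  refine fracLeft_duality ha (fun h0 => ?_) fun ha => ?_
  · subst h0
    refine Integrable.mono' (hgi.norm.const_mul M) (hg.mul hh) ?_
    filter_upwards [ae_unitVol_mem] with x hx
    have := hle x hx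
    simp only [zero_add, norm_mul, Real.norm_eq_abs]
    rw [abs_of_nonneg (Real.rpow_nonneg hx.1.le c)]
    calc |g x| * |h x| ≤ |g x| * (M * x ^ c) := by gcongr
      _ = _ := by ring
  · refine integrable_prod_of_kernel_bound (m := fun x => M * x ^ (a + c) / Real.Gamma (a + 1))
      (measurable_abelKernel a) hg hh ?_ ?_ ?_
    · filter_upwards [ae_unitVol_mem] with x hx
      refine Integrable.mono' ((integrable_abelKernel ha hx.2.le).mul_const M)
        ((measurable_abelKernel_left a x).aestronglyMeasurable.mul hh) ?_
      filter_upwards [ae_unitVol_mem] with s hs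
      rw [norm_mul, Real.norm_of_nonneg (abelKernel_nonneg ha _ _)]
      refine mul_le_mul_of_nonneg_left ((hle s hs).trans ?_) (abelKernel_nonneg ha _ _)
      exact mul_le_of_le_one_right hM (Real.rpow_le_one hs.1.le hs.2.le hc)
    · filter_upwards [ae_unitVol_mem] with x hx
      have h3 := abs_fracLeft_le ha.le hc hM hx (h := fun s => |h s|)
        (by simpa using hle x hx) (by
          filter_upwards [ae_unitVol_mem] with s hs _
          simpa using hle s hs)
      rw [fracLeft_of_pos ha] at h3
      refine le_trans (le_of_eq ?_) ((le_abs_self _).trans h3)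
      congr 1 with s
      rw [abs_mul, abs_of_nonneg (abelKernel_nonneg ha _ _)]
    · refine (hgi.mul_const (M / Real.Gamma (a + 1))).congr (Eventually.of_forall fun x => ?_)
      simp only
      ring

/-- Duality of the fractional integrals for bounded `g` and integrable `h`. -/
theorem fracLeft_duality_of_bounded {a M : ℝ} (ha : 0 ≤ a) (hM : 0 ≤ M)
    {g h : ℝ → ℝ} (hg : AEStronglyMeasurable g unitVol) (hh : Integrable h unitVol)
    (hle : ∀ s ∈ Ioo (0 : ℝ) 1, |g s| ≤ M) :
    Integrable (fun x => g x * fracLeft a h x) unitVol ∧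
    Integrable (fun s => fracRight a g s * h s) unitVol ∧
    ∫ x, g x * fracLeft a h x ∂unitVol = ∫ s, fracRight a g s * h s ∂unitVol := by
  refine fracLeft_duality ha (fun _ => ?_) fun ha => ?_
  · refine hh.bdd_mul (c := M) hg ?_
    filter_upwards [ae_unitVol_mem] with x hx using hle x hx
  · have h1 : Integrable (fun z : ℝ × ℝ => h z.1 * (abelKernel a z.2 z.1 * g z.2))
        (unitVol.prod unitVol) := by
      refine integrable_prod_of_kernel_bound (k := fun x s => abelKernel a s x)
        (m := fun x => M / Real.Gamma (a + 1))
        ((measurable_abelKernel a).comp measurable_swap) hh.1 hg ?_ ?_ (hh.mul_const _)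
      · filter_upwards [ae_unitVol_mem] with x hx
        refine (integrable_abelKernel_right ha hx.1.le).mul_bdd (c := M) hg ?_
        filter_upwards [ae_unitVol_mem] with s hs using hle s hs
      · filter_upwards [ae_unitVol_mem] with x hx
        have h3 := abs_fracRight_le ha.le hM hx (h := fun s => |g s|)
          (by simpa using hle x hx) (by
            filter_upwards [ae_unitVol_mem] with s hs _
            simpa using hle s hs)
        rw [fracRight_of_pos ha] at h3
        refine le_trans (le_of_eq ?_) ((le_abs_self _).trans h3)
        congr 1 with s
        rw [abs_mul, abs_of_nonneg (abelKernel_nonneg ha _ _)]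
    refine h1.swap.congr (Eventually.of_forall fun z => ?_)
    simp only [Function.comp_apply, Prod.fst_swap, Prod.snd_swap]
    ring

theorem integrable_fracLeft {a : ℝ} (ha : 0 ≤ a) {h : ℝ → ℝ} (hh : Integrable h unitVol) :
    Integrable (fracLeft a h) unitVol := by
  simpa using (fracLeft_duality_of_bounded (g := fun _ => 1) ha zero_le_one
    aestronglyMeasurable_const hh (by simp)).1

theorem fracLeft_congr_ae {a : ℝ} {h₁ h₂ : ℝ → ℝ} (h : h₁ =ᵐ[unitVol] h₂) :
    fracLeft a h₁ =ᵐ[unitVol] fracLeft a h₂ := by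
  by_cases ha : a = 0
  · subst ha; simpa [fracLeft_zero] using h
  · refine Eventually.of_forall fun x => ?_
    simp only [fracLeft, ha, if_false]
    refine integral_congr_ae ?_
    filter_upwards [h] with s hs
    rw [hs]

/-! ### Complementary orders and injectivity of the Abel integral. -/

theorem fracLeft_one {x : ℝ} (hx : x ≤ 1) (h : ℝ → ℝ) :
    fracLeft 1 h x = ∫ s in Ioo 0 x, h s := by
  rw [fracLeft_of_pos one_pos, integral_abelKernel_mul hx]
  simp

/-- A Beta integral over `(s,x)`. For `a + b = 1` the power of `x - s` has exponent zero and the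
Gamma factors cancel. -/
theorem integral_abelKernel_mul_abelKernel {a b x s : ℝ} (ha : 0 < a) (hb : 0 < b)
    (hab : a + b = 1) (hx : x ≤ 1) (hs : 0 ≤ s) :
    Integrable (fun t => abelKernel a x t * abelKernel b t s) unitVol ∧
    ∫ t, abelKernel a x t * abelKernel b t s ∂unitVol = if s < x then 1 else 0 := by
  have e : (fun t => abelKernel a x t * abelKernel b t s) =
      (Ioo s x).indicator fun t => (t - s) ^ (b - 1) * (x - t) ^ (a - 1) /
        (Real.Gamma a * Real.Gamma b) := by
    ext t
    by_cases h1 : t < x <;> by_cases h2 : s < t <;> simp [abelKernel, h1, h2]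
    field_simp
  have hsub : Ioo s x ∩ Ioo (0 : ℝ) 1 = Ioo s x :=
    inter_eq_left.2 fun t ht => ⟨hs.trans_lt ht.1, ht.2.trans_le hx⟩
  constructor
  · rw [e, integrable_indicator_iff measurableSet_Ioo, IntegrableOn,
      Measure.restrict_restrict measurableSet_Ioo, hsub]
    exact (integrableOn_beta_Ioo hb ha).div_const _
  · rw [e, integral_indicator measurableSet_Ioo, Measure.restrict_restrict measurableSet_Ioo, hsub]
    split_ifs with hsx
    · rw [integral_div, integral_beta_Ioo hsx hb ha, add_comm b a, hab]
      have := (Real.Gamma_pos_of_pos ha).ne'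
      have := (Real.Gamma_pos_of_pos hb).ne'
      simp
      field_simp
    · simp [Ioo_eq_empty hsx]

/-- By Fubini the composite kernel is the constant `1` below `x`. This is the semigroup law in the
only case used, total order one. -/
theorem fracLeft_fracLeft {a b x : ℝ} (ha : 0 ≤ a) (hb : 0 ≤ b) (hab : a + b = 1)
    (hx : x ≤ 1) {h : ℝ → ℝ} (hh : Integrable h unitVol) :
    fracLeft a (fracLeft b h) x = ∫ s in Ioo 0 x, h s := by
  rcases ha.eq_or_lt with rfl | ha
  · rw [fracLeft_zero, show b = 1 by linarith, fracLeft_one hx]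
  rcases hb.eq_or_lt with rfl | hb
  · rw [fracLeft_zero, show a = 1 by linarith, fracLeft_one hx]
  have hI : Integrable (fun z : ℝ × ℝ => h z.1 * (abelKernel a x z.2 * abelKernel b z.2 z.1))
      (unitVol.prod unitVol) := by
    have := integrable_prod_of_kernel_bound (g := h) (h := fun _ => 1) (m := fun _ => 1)
      (k := fun s t => abelKernel a x t * abelKernel b t s)
      (((measurable_abelKernel_left a x).comp measurable_snd).mul
        ((measurable_abelKernel b).comp measurable_swap)) hh.1 aestronglyMeasurable_const
      (by
        filter_upwards [ae_unitVol_mem] with s hs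
        simpa using (integral_abelKernel_mul_abelKernel ha hb hab hx hs.1.le).1)
      (by
        filter_upwards [ae_unitVol_mem] with s hs
        have h2 := (integral_abelKernel_mul_abelKernel ha hb hab hx hs.1.le).2
        simp only [mul_one]
        rw [integral_congr_ae (Eventually.of_forall fun t => abs_of_nonneg
          (mul_nonneg (abelKernel_nonneg ha x t) (abelKernel_nonneg hb t s))), h2]
        split_ifs <;> norm_num)
      (by simpa using hh)
    simpa using this
  have hsw := integral_integral_swap
    (f := fun s t => h s * (abelKernel a x t * abelKernel b t s)) hI
  have e1 : ∀ t, ∫ s, h s * (abelKernel a x t * abelKernel b t s) ∂unitVol =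
      abelKernel a x t * fracLeft b h t := fun t => by
    rw [fracLeft_of_pos hb, ← integral_const_mul]
    congr 1 with s
    ring
  rw [fracLeft_of_pos ha]
  simp only [e1] at hsw
  rw [← hsw, ← Iio_inter_Ioo_of_le hx, ← Measure.restrict_restrict measurableSet_Iio,
    ← integral_indicator measurableSet_Iio]
  refine integral_congr_ae ?_
  filter_upwards [ae_unitVol_mem] with s hs
  rw [integral_const_mul, (integral_abelKernel_mul_abelKernel ha hb hab hx hs.1.le).2]
  by_cases hsx : s < x <;> simp [hsx]

theorem ae_eq_of_integral_Ioo_eq {h₁ h₂ : ℝ → ℝ} {c : ℝ} (hh₁ : Integrable h₁ unitVol)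
    (hh₂ : Integrable h₂ unitVol)
    (h : ∀ x ∈ Ioo (0 : ℝ) 1, x < c → ∫ s in Ioo 0 x, h₁ s = ∫ s in Ioo 0 x, h₂ s) :
    ∀ᵐ x ∂unitVol, x < c → h₁ x = h₂ x := by
  have hi : ∀ {k : ℝ → ℝ}, Integrable k unitVol → IntervalIntegrable k volume 0 1 := fun hk =>
    (intervalIntegrable_iff_integrableOn_Ioo_of_le zero_le_one).2 hk
  have hu : uIcc (0 : ℝ) 1 = Icc 0 1 := uIcc_of_le zero_le_one
  refine (ae_restrict_iff' measurableSet_Ioo).2 ?_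
  filter_upwards [(hi hh₁).ae_hasDerivAt_integral, (hi hh₂).ae_hasDerivAt_integral]
    with x h1 h2 hx hxc
  rw [hu] at h1 h2
  have d1 := h1 (Ioo_subset_Icc_self hx) 0 (left_mem_Icc.2 zero_le_one)
  have d2 := h2 (Ioo_subset_Icc_self hx) 0 (left_mem_Icc.2 zero_le_one)
  refine d1.unique (d2.congr_of_eventuallyEq ?_)
  filter_upwards [Ioo_mem_nhds hx.1 hx.2, Iio_mem_nhds hxc] with y hy hyc
  simp only [intervalIntegral.integral_of_le hy.1.le, integral_Ioc_eq_integral_Ioo]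
  exact h y hy hyc

/-- Applying the integral of complementary order `1 - a` turns both sides into primitives, and
Lebesgue differentiation recovers the functions. A left integral at `x` depends only on values up to
`x`, so the conclusion localizes to `x < c`. -/
theorem fracLeft_injective {a c : ℝ} (ha : 0 ≤ a) (ha1 : a < 1) {h₁ h₂ : ℝ → ℝ}
    (hh₁ : Integrable h₁ unitVol) (hh₂ : Integrable h₂ unitVol)
    (h : ∀ᵐ x ∂unitVol, x < c → fracLeft a h₁ x = fracLeft a h₂ x) :
    ∀ᵐ x ∂unitVol, x < c → h₁ x = h₂ x := by
  refine ae_eq_of_integral_Ioo_eq hh₁ hh₂ fun x hx hxc => ?_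
  have hb : 0 < 1 - a := by linarith
  rw [← fracLeft_fracLeft hb.le ha (by ring) hx.2.le hh₁,
    ← fracLeft_fracLeft hb.le ha (by ring) hx.2.le hh₂, fracLeft_of_pos hb, fracLeft_of_pos hb]
  refine integral_congr_ae ?_
  filter_upwards [h] with s hs
  by_cases hsx : s < x
  · rw [hs (hsx.trans hxc)]
  · simp [abelKernel, hsx]

theorem fracRight_injective {a c : ℝ} (ha : 0 ≤ a) (ha1 : a < 1) {h₁ h₂ : ℝ → ℝ}
    (hh₁ : Integrable h₁ unitVol) (hh₂ : Integrable h₂ unitVol)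
    (h : ∀ᵐ x ∂unitVol, c < x → fracRight a h₁ x = fracRight a h₂ x) :
    ∀ᵐ x ∂unitVol, c < x → h₁ x = h₂ x := by
  have hq := measurePreserving_one_sub.quasiMeasurePreserving
  have := fracLeft_injective (c := 1 - c) ha ha1 (integrable_one_sub hh₁) (integrable_one_sub hh₂)
    (by
      filter_upwards [hq.ae h] with x hx hxc
      simpa [fracRight_eq_fracLeft] using hx (by linarith))
  filter_upwards [hq.ae this] with x hx hxc
  simpa using hx (by linarith)

/-! ### Factorization of the two-sided fractional integral. -/

/-- The constants of the two-sided operator: orders `A, B ≥ 0` with `0 < A + B < 1`, and the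
coefficients that make it factorize. -/
structure Admissible (A B r lam : ℝ) : Prop where
  nonneg_left : 0 ≤ A
  nonneg_right : 0 ≤ B
  pos : 0 < A + B
  lt_one : A + B < 1
  sin_pos : 0 < Real.sin (Real.pi * A) + Real.sin (Real.pi * B)
  coeff_right : r * (Real.sin (Real.pi * A) + Real.sin (Real.pi * B)) = Real.sin (Real.pi * A)
  coeff_left : (1 - r) * (Real.sin (Real.pi * A) + Real.sin (Real.pi * B)) =
    Real.sin (Real.pi * B)
  coeff_factor : lam * (Real.sin (Real.pi * A) + Real.sin (Real.pi * B)) =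
    Real.sin (Real.pi * (A + B))

theorem Admissible.symm {A B r lam : ℝ} (h : Admissible A B r lam) :
    Admissible B A (1 - r) lam where
  nonneg_left := h.nonneg_right
  nonneg_right := h.nonneg_left
  pos := by rw [add_comm]; exact h.pos
  lt_one := by rw [add_comm]; exact h.lt_one
  sin_pos := by rw [add_comm]; exact h.sin_pos
  coeff_right := by rw [add_comm]; exact h.coeff_left
  coeff_left := by rw [add_comm, sub_sub_cancel]; exact h.coeff_right
  coeff_factor := by rw [add_comm, add_comm B]; exact h.coeff_factor

theorem sin_pi_mul_pos {a : ℝ} (h0 : 0 < a) (h1 : a < 1) : 0 < Real.sin (Real.pi * a) :=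
  Real.sin_pos_of_pos_of_lt_pi (by positivity) (by nlinarith [Real.pi_pos])

theorem Admissible.lam_pos {A B r lam : ℝ} (h : Admissible A B r lam) : 0 < lam := by
  have h1 := sin_pi_mul_pos h.pos h.lt_one
  rw [← h.coeff_factor] at h1
  exact pos_of_mul_pos_left h1 h.sin_pos.le

/-- The reflection formula for `Γ` at `A + B` and at `B` turns the Gamma quotient into sines, and
the definitions of `lam` and `r` by sines do the rest. Here the coupling of `r` with the orders
enters when both are positive. -/
theorem Admissible.gamma_eq {A B r lam : ℝ} (h : Admissible A B r lam) (hA : 0 < A) (hB : 0 < B) :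
    lam * (Real.Gamma (1 - (A + B)) / (Real.Gamma B * Real.Gamma (1 - B))) =
      (1 - r) / Real.Gamma (A + B) := by
  have g1 := Real.Gamma_mul_Gamma_one_sub (A + B)
  have g2 := Real.Gamma_mul_Gamma_one_sub B
  have hs1 := sin_pi_mul_pos h.pos h.lt_one
  have hs2 := sin_pi_mul_pos hB (by linarith [h.lt_one])
  have hG := (Real.Gamma_pos_of_pos h.pos).ne'
  have hS := h.sin_pos
  have e1 : lam = Real.sin (Real.pi * (A + B)) /
      (Real.sin (Real.pi * A) + Real.sin (Real.pi * B)) := by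
    rw [eq_div_iff hS.ne', h.coeff_factor]
  have e2 : 1 - r = Real.sin (Real.pi * B) /
      (Real.sin (Real.pi * A) + Real.sin (Real.pi * B)) := by
    rw [eq_div_iff hS.ne', h.coeff_left]
  have e3 : Real.Gamma (1 - (A + B)) = Real.pi / Real.sin (Real.pi * (A + B)) /
      Real.Gamma (A + B) := by
    rw [← g1]; field_simp
  rw [g2, e1, e2, e3]
  have := Real.pi_pos.ne'
  field_simp

/-- The kernel in `s` confines `t` to `(0,s)`, and `integral_moebius_beta` applies with `a = A`, `c
= 1 - (A + B)`: the exponent `-(A+B)` is the one that makes the sum `-2`. -/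
theorem integral_abelKernel_abelKernel_rpow {A B x s : ℝ} (hA : 0 < A) (hAB : A + B < 1)
    (hs : 0 < s) (hsx : s < x) (hx : x ≤ 1) :
    ∫ t, abelKernel B x t * t ^ (-(A + B)) * abelKernel A s t ∂unitVol =
      Real.Gamma (1 - (A + B)) / (Real.Gamma B * Real.Gamma (1 - B)) *
        (s ^ (-B) * x ^ (-A) * (x - s) ^ (A + B - 1)) := by
  have e : ∀ t, abelKernel B x t * t ^ (-(A + B)) * abelKernel A s t =
      abelKernel A s t * (abelKernel B x t * t ^ (-(A + B))) := fun t => mul_comm _ _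
  simp only [e]
  rw [integral_abelKernel_mul (hsx.le.trans hx)]
  have hm := integral_moebius_beta (a := A) (c := 1 - (A + B)) hs hsx hA (by linarith)
  rw [show A + (1 - (A + B)) = 1 - B by ring, show 1 - B - 1 = -B by ring,
    show -(1 - (A + B)) = A + B - 1 by ring] at hm
  have hg := (Real.Gamma_pos_of_pos hA).ne'
  calc _ = ∫ t in Ioo 0 s, (Real.Gamma A * Real.Gamma B)⁻¹ *
        (t ^ (1 - (A + B) - 1) * (s - t) ^ (A - 1) * (x - t) ^ (-(1 - B))) := by
        refine setIntegral_congr_fun measurableSet_Ioo fun t ht => ?_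
        have : t < x := ht.2.trans hsx
        simp only [abelKernel, this, if_true]
        rw [show 1 - (A + B) - 1 = -(A + B) by ring, show -(1 - B) = B - 1 by ring]
        field_simp
    _ = _ := by
        rw [integral_const_mul, hm]
        field_simp

/-- For `s < x` the product kernel is computed in closed form and yields the left kernel. The case
`x < s` is the same computation with `A`, `B` and `r`, `1 - r` interchanged, which is why `key`
quantifies over the parameters. -/
theorem Admissible.kernel_factor {A B r lam x s : ℝ} (h : Admissible A B r lam)
    (hA : 0 < A) (hB : 0 < B) (hx : x ∈ Ioo (0 : ℝ) 1) (hs : s ∈ Ioo (0 : ℝ) 1) (hne : s ≠ x) :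
    lam * x ^ A * s ^ B * ∫ t, abelKernel B x t * t ^ (-(A + B)) * abelKernel A s t ∂unitVol =
      r * abelKernel (A + B) s x + (1 - r) * abelKernel (A + B) x s := by
  have key : ∀ {A B r x s : ℝ}, Admissible A B r lam → 0 < A → 0 < B → 0 < s → s < x → x ≤ 1 →
      lam * x ^ A * s ^ B * ∫ t, abelKernel B x t * t ^ (-(A + B)) * abelKernel A s t ∂unitVol =
        (1 - r) * abelKernel (A + B) x s := by
    intro A B r x s h hA hB hs hsx hx1
    have hx := hs.trans hsx
    rw [integral_abelKernel_abelKernel_rpow hA h.lt_one hs hsx hx1]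
    have hg := h.gamma_eq hA hB
    simp only [abelKernel, hsx, if_true]
    have e1 : x ^ A * x ^ (-A) = 1 := by rw [← Real.rpow_add hx]; simp
    have e2 : s ^ B * s ^ (-B) = 1 := by rw [← Real.rpow_add hs]; simp
    calc _ = (lam * (Real.Gamma (1 - (A + B)) / (Real.Gamma B * Real.Gamma (1 - B)))) *
          (x ^ A * x ^ (-A)) * (s ^ B * s ^ (-B)) * (x - s) ^ (A + B - 1) := by ring
      _ = _ := by rw [hg, e1, e2]; ring
  rcases lt_or_gt_of_ne hne with hsx | hxs
  · rw [key h hA hB hs.1 hsx hx.2.le]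
    simp [abelKernel, hsx.not_gt]
  · have := key h.symm hB hA hx.1 hxs hs.2.le
    rw [add_comm B A, sub_sub_cancel] at this
    have h0 : abelKernel (A + B) x s = 0 := by simp [abelKernel, hxs.not_gt]
    rw [h0, mul_zero, add_zero, ← this]
    have e : ∀ t, abelKernel B x t * t ^ (-(A + B)) * abelKernel A s t =
      abelKernel A s t * t ^ (-(A + B)) * abelKernel B x t := fun t => by ring
    simp only [e]
    ring

theorem integrable_abelKernel_mul_rpow {b c x : ℝ} (hb : 0 < b) (hc : -1 < c) (hx : x ≤ 1) :
    Integrable (fun t => abelKernel b x t * t ^ c) unitVol := by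
  rw [integrable_abelKernel_mul_iff hx]
  have := integrableOn_beta_Ioo (a := 0) (x := x) (p := c + 1) (q := b) (by linarith) hb
  refine IntegrableOn.congr_fun (this.div_const (Real.Gamma b)) (fun t _ => ?_) measurableSet_Ioo
  simp only [sub_zero, add_sub_cancel_right]
  ring

theorem fracLeft_congr_on {a x : ℝ} (hx : x ∈ Ioo (0 : ℝ) 1) {h₁ h₂ : ℝ → ℝ}
    (h : ∀ s ∈ Ioo (0 : ℝ) 1, h₁ s = h₂ s) : fracLeft a h₁ x = fracLeft a h₂ x := by
  by_cases ha : a = 0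
  · simp [fracLeft, ha, h x hx]
  · simp only [fracLeft, ha, if_false]
    refine setIntegral_congr_fun measurableSet_Ioo fun s hs => ?_
    simp only [h s hs]

theorem fracRight_congr_on {a x : ℝ} (hx : x ∈ Ioo (0 : ℝ) 1) {h₁ h₂ : ℝ → ℝ}
    (h : ∀ s ∈ Ioo (0 : ℝ) 1, h₁ s = h₂ s) : fracRight a h₁ x = fracRight a h₂ x := by
  by_cases ha : a = 0
  · simp [fracRight, ha, h x hx]
  · simp only [fracRight, ha, if_false]
    refine setIntegral_congr_fun measurableSet_Ioo fun s hs => ?_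
    simp only [h s hs]

/-- The two-sided fractional integral is a product of one-sided ones with power weights. -/
theorem Admissible.factorization {A B r lam x M : ℝ} (h : Admissible A B r lam)
    (hx : x ∈ Ioo (0 : ℝ) 1) {φ : ℝ → ℝ} (hM : 0 ≤ M) (hφ : AEStronglyMeasurable φ unitVol)
    (hle : ∀ s ∈ Ioo (0 : ℝ) 1, |φ s| ≤ M) :
    r * fracRight (A + B) φ x + (1 - r) * fracLeft (A + B) φ x =
      lam * (x ^ A * fracLeft B
        (fun t => t ^ (-(A + B)) * fracRight A (fun s => s ^ B * φ s) t) x) := by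
  rcases h.nonneg_left.eq_or_lt with hA | hA
  -- With `A = 0` the coefficient identities force `r = 0` and `lam = 1`; the inner integral is the
  -- identity and the powers of `s` cancel. The case `B = 0` is the mirror image.
  · subst hA
    have hS := h.sin_pos
    have h1 := h.coeff_right
    have h2 := h.coeff_factor
    simp only [mul_zero, Real.sin_zero, zero_add] at hS h1 h2
    have hr : r = 0 := (mul_eq_zero.1 h1).resolve_right hS.ne'
    have hl : lam = 1 := by
      have : (lam - 1) * Real.sin (Real.pi * B) = 0 := by linear_combination h2
      exact sub_eq_zero.1 ((mul_eq_zero.1 this).resolve_right hS.ne')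
    rw [hr, hl]
    simp only [zero_mul, zero_add, sub_zero, one_mul, Real.rpow_zero, fracRight_zero]
    refine fracLeft_congr_on hx fun s hs => ?_
    rw [← mul_assoc, ← Real.rpow_add hs.1]
    simp
  rcases h.nonneg_right.eq_or_lt with hB | hB
  · subst hB
    have hS := h.sin_pos
    have h1 := h.coeff_left
    have h2 := h.coeff_factor
    simp only [mul_zero, Real.sin_zero, add_zero] at hS h1 h2
    have hr : 1 - r = 0 := (mul_eq_zero.1 h1).resolve_right hS.ne'
    have hl : lam = 1 := by
      have : (lam - 1) * Real.sin (Real.pi * A) = 0 := by linear_combination h2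
      exact sub_eq_zero.1 ((mul_eq_zero.1 this).resolve_right hS.ne')
    rw [hr, hl, show r = 1 by linarith]
    simp only [zero_mul, add_zero, one_mul, Real.rpow_zero, fracLeft_zero]
    rw [← mul_assoc, ← Real.rpow_add hx.1]
    simp
  have hmeas : AEStronglyMeasurable (fun s => s ^ B * φ s) unitVol :=
    (by fun_prop : Measurable fun s : ℝ => s ^ B).aestronglyMeasurable.mul hφ
  have hle' : ∀ s ∈ Ioo (0 : ℝ) 1, |s ^ B * φ s| ≤ M := fun s hs => by
    rw [abs_mul, abs_of_nonneg (Real.rpow_nonneg hs.1.le B)]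
    calc s ^ B * |φ s| ≤ 1 * M := by
          refine mul_le_mul (Real.rpow_le_one hs.1.le hs.2.le hB.le) (hle s hs) (abs_nonneg _)
            zero_le_one
      _ = M := one_mul M
  -- The outer weight is integrable because `-(A+B) > -1`, and the inner right integral of a bounded
  -- function is bounded.
  have hI : Integrable (fun z : ℝ × ℝ => abelKernel B x z.1 * z.1 ^ (-(A + B)) *
      (abelKernel A z.2 z.1 * (z.2 ^ B * φ z.2))) (unitVol.prod unitVol) := by
    refine integrable_prod_of_kernel_bound (k := fun t s => abelKernel A s t)
      (h := fun s => s ^ B * φ s)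
      (m := fun _ => M / Real.Gamma (A + 1)) ((measurable_abelKernel A).comp measurable_swap)
      (integrable_abelKernel_mul_rpow hB (by linarith [h.lt_one]) hx.2.le).1 hmeas ?_ ?_
      ((integrable_abelKernel_mul_rpow hB (by linarith [h.lt_one]) hx.2.le).mul_const _)
    · filter_upwards [ae_unitVol_mem] with t ht
      refine (integrable_abelKernel_right hA ht.1.le).mul_bdd (c := M) hmeas ?_
      filter_upwards [ae_unitVol_mem] with s hs using hle' s hs
    · filter_upwards [ae_unitVol_mem] with t ht
      have h3 := abs_fracRight_le hA.le hM ht (h := fun s => |s ^ B * φ s|)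
        (by simpa using hle' t ht) (by
          filter_upwards [ae_unitVol_mem] with s hs _
          simpa using hle' s hs)
      rw [fracRight_of_pos hA] at h3
      refine le_trans (le_of_eq ?_) ((le_abs_self _).trans h3)
      congr 1 with s
      rw [abs_mul, abs_of_nonneg (abelKernel_nonneg hA _ _)]
  have hsw := integral_integral_swap (f := fun t s => abelKernel B x t * t ^ (-(A + B)) *
      (abelKernel A s t * (s ^ B * φ s))) hI
  have hbd : ∀ᵐ s ∂unitVol, ‖φ s‖ ≤ M := by
    filter_upwards [ae_unitVol_mem] with s hs using hle s hs
  have i1 := ((integrable_abelKernel_right h.pos hx.1.le).mul_bdd (c := M) hφ hbd).const_mul r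
  have i2 := ((integrable_abelKernel h.pos hx.2.le).mul_bdd (c := M) hφ hbd).const_mul (1 - r)
  rw [fracLeft_of_pos hB, fracLeft_of_pos h.pos, fracRight_of_pos h.pos, ← integral_const_mul,
    ← integral_const_mul, ← integral_add i1 i2]
  have e1 : ∀ t, ∫ s, abelKernel B x t * t ^ (-(A + B)) *
      (abelKernel A s t * (s ^ B * φ s)) ∂unitVol =
      abelKernel B x t * (t ^ (-(A + B)) * fracRight A (fun s => s ^ B * φ s) t) := fun t => by
    rw [integral_const_mul, fracRight_of_pos hA, mul_assoc]
  simp only [e1] at hsw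
  rw [hsw, ← mul_assoc, ← integral_const_mul]
  have hne : ∀ᵐ s ∂unitVol, s ≠ x := by
    refine ae_restrict_of_ae ?_
    simp [ae_iff]
  refine integral_congr_ae ?_
  filter_upwards [ae_unitVol_mem, hne] with s hs hsx
  have hk := h.kernel_factor hA hB hx hs hsx
  have e2 : ∀ t, abelKernel B x t * t ^ (-(A + B)) * (abelKernel A s t * (s ^ B * φ s)) =
    abelKernel B x t * t ^ (-(A + B)) * abelKernel A s t * (s ^ B * φ s) := fun t => by ring
  simp only [e2, integral_mul_const]
  linear_combination (-φ s) * hk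

/-! ### Test functions and derivatives of their fractional integrals. -/

theorem IsTest.deriv {φ : ℝ → ℝ} (h : IsTest φ) : IsTest (deriv φ) := by
  obtain ⟨h1, h2, h3⟩ := h
  exact ⟨(contDiff_infty_iff_deriv.1 h1).2, h2.deriv,
    (closure_minimal support_deriv_subset (isClosed_tsupport φ)).trans h3⟩

theorem IsTest.exists_bound {φ : ℝ → ℝ} (h : IsTest φ) : ∃ M, 0 ≤ M ∧ ∀ x, |φ x| ≤ M := by
  obtain ⟨M, hM⟩ := h.1.continuous.bounded_above_of_compact_support h.2.1
  exact ⟨M, (norm_nonneg _).trans (hM 0), hM⟩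

theorem IsTest.eq_zero {φ : ℝ → ℝ} (h : IsTest φ) {x : ℝ} (hx : x ∉ Ioo (0 : ℝ) 1) : φ x = 0 :=
  image_eq_zero_of_notMem_tsupport fun h' => hx (h.2.2 h')

theorem IsTest.hasDerivAt {φ : ℝ → ℝ} (h : IsTest φ) (x : ℝ) : HasDerivAt φ (_root_.deriv φ x) x :=
  ((h.1.differentiable (by simp)) x).hasDerivAt

theorem IsTest.comp_one_sub {φ : ℝ → ℝ} (h : IsTest φ) : IsTest fun x => φ (1 - x) := by
  obtain ⟨h1, h2, h3⟩ := h
  refine ⟨h1.comp (contDiff_const.sub contDiff_id),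
    h2.comp_homeomorph (Homeomorph.subLeft (1 : ℝ)), ?_⟩
  have : tsupport (fun x => φ (1 - x)) = (fun x => 1 - x) ⁻¹' tsupport φ :=
    tsupport_comp_eq_preimage φ (Homeomorph.subLeft (1 : ℝ))
  rw [this]
  intro x hx
  simpa using one_sub_mem_Ioo (h3 hx)

/-- The support stays away from `0`, where the power may fail to be smooth. Multiplication by `s^B`
is thus invertible on test functions, so the weight in the flux formula can be moved to the test
function. -/
theorem IsTest.mul_rpow {φ : ℝ → ℝ} (h : IsTest φ) (c : ℝ) : IsTest fun x => x ^ c * φ x := by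
  obtain ⟨h1, h2, h3⟩ := h
  have hsub : tsupport (fun x => x ^ c * φ x) ⊆ tsupport φ :=
    closure_mono fun x hx hx0 => hx (by simp [hx0])
  refine ⟨contDiff_iff_contDiffAt.2 fun x => ?_, h2.mul_left, hsub.trans h3⟩
  by_cases hx : x ∈ tsupport (fun x => x ^ c * φ x)
  swap
  · exact contDiffAt_const.congr_of_eventuallyEq (notMem_tsupport_iff_eventuallyEq.1 hx)
  exact (Real.contDiffAt_rpow_const_of_ne (h3 (hsub hx)).1.ne').mul h1.contDiffAt

/-- The substitution `s = x - y` moves `x` into the smooth factor, and the domain can be taken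
independent of `x` since `χ (x - y) = 0` for `y ≥ x`. -/
theorem IsTest.fracLeft_eq {a x : ℝ} (ha : 0 < a) {χ : ℝ → ℝ} (h : IsTest χ)
    (hx : x ∈ Ioo (0 : ℝ) 1) :
    fracLeft a χ x = ∫ y, y ^ (a - 1) / Real.Gamma a * χ (x - y) ∂unitVol := by
  rw [fracLeft_of_pos ha, integral_abelKernel_mul hx.2.le]
  have e1 : ∫ s in Ioo 0 x, (x - s) ^ (a - 1) / Real.Gamma a * χ s =
      ∫ y in Ioo 0 x, y ^ (a - 1) / Real.Gamma a * χ (x - y) := by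
    rw [← integral_Ioc_eq_integral_Ioo, ← integral_Ioc_eq_integral_Ioo,
      ← intervalIntegral.integral_of_le hx.1.le, ← intervalIntegral.integral_of_le hx.1.le]
    have := intervalIntegral.integral_comp_sub_left (a := 0) (b := x)
      (fun y => y ^ (a - 1) / Real.Gamma a * χ (x - y)) x
    simpa using this
  rw [e1]
  refine (setIntegral_eq_of_subset_of_forall_sdiff_eq_zero measurableSet_Ioo
    (Ioo_subset_Ioo_right hx.2.le) fun y hy => ?_).symm
  rw [h.eq_zero (x := x - y), mul_zero]
  intro h'
  exact hy.2 ⟨hy.1.1, by linarith [h'.1]⟩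

/-- In convolution form the derivative falls on `χ` alone; vanishing of `χ` near `0` leaves no
boundary term. -/
theorem IsTest.hasDerivAt_fracLeft {a x : ℝ} (ha : 0 ≤ a) {χ : ℝ → ℝ} (h : IsTest χ)
    (hx : x ∈ Ioo (0 : ℝ) 1) :
    HasDerivAt (fracLeft a χ) (fracLeft a (_root_.deriv χ) x) x := by
  rcases ha.eq_or_lt with rfl | ha
  · simpa [fracLeft_zero] using h.hasDerivAt x
  have h' := h.deriv
  obtain ⟨M, hM0, hM⟩ := h.exists_bound
  obtain ⟨M', hM'0, hM'⟩ := h'.exists_bound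
  have hint : Integrable (fun y : ℝ => y ^ (a - 1) / Real.Gamma a) unitVol := by
    have := integrable_abelKernel_right (x := 0) ha le_rfl
    refine this.congr ?_
    filter_upwards [ae_unitVol_mem] with y hy
    simp [abelKernel, hy.1]
  have key := (hasDerivAt_integral_of_dominated_loc_of_deriv_le (μ := unitVol) (x₀ := x)
    (s := Ioo 0 1) (F := fun x y => y ^ (a - 1) / Real.Gamma a * χ (x - y))
    (F' := fun x y => y ^ (a - 1) / Real.Gamma a * _root_.deriv χ (x - y))
    (bound := fun y => y ^ (a - 1) / Real.Gamma a * M') (Ioo_mem_nhds hx.1 hx.2)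
    (Eventually.of_forall fun z => hint.1.mul
      (h.1.continuous.comp (continuous_const.sub continuous_id)).aestronglyMeasurable)
    (hint.mul_bdd (c := M)
      (h.1.continuous.comp (continuous_const.sub continuous_id)).aestronglyMeasurable
      (Eventually.of_forall fun y => hM _))
    (hint.1.mul
      (h'.1.continuous.comp (continuous_const.sub continuous_id)).aestronglyMeasurable)
    (by
      filter_upwards [ae_unitVol_mem] with y hy z _
      have : 0 ≤ y ^ (a - 1) / Real.Gamma a :=
        div_nonneg (Real.rpow_nonneg hy.1.le _) (Real.Gamma_pos_of_pos ha).le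
      rw [norm_mul, Real.norm_of_nonneg this]
      exact mul_le_mul_of_nonneg_left (hM' _) this)
    (hint.mul_const M')
    (Eventually.of_forall fun y z _ => by
      have := (h.hasDerivAt (z - y)).comp z ((hasDerivAt_id z).sub_const y)
      simpa [Function.comp_def] using this.const_mul (y ^ (a - 1) / Real.Gamma a))).2
  rw [h'.fracLeft_eq ha hx]
  refine key.congr_of_eventuallyEq ?_
  filter_upwards [Ioo_mem_nhds hx.1 hx.2] with z hz
  exact h.fracLeft_eq ha hz

theorem IsTest.hasDerivAt_fracRight {a x : ℝ} (ha : 0 ≤ a) {χ : ℝ → ℝ} (h : IsTest χ)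
    (hx : x ∈ Ioo (0 : ℝ) 1) :
    HasDerivAt (fracRight a χ) (fracRight a (_root_.deriv χ) x) x := by
  have h1 := h.comp_one_sub.hasDerivAt_fracLeft ha (one_sub_mem_Ioo hx)
  have h2 := h1.comp x ((hasDerivAt_id x).const_sub 1)
  have e : fracRight a χ = fracLeft a (fun s => χ (1 - s)) ∘ fun x => 1 - x := by
    ext y; exact fracRight_eq_fracLeft a χ y
  rw [e]
  refine h2.congr_deriv ?_
  have e2 : _root_.deriv (fun s => χ (1 - s)) = fun s => -_root_.deriv χ (1 - s) := by
    ext s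
    rw [deriv_comp_const_sub]
  rw [e2, fracRight_eq_fracLeft]
  by_cases ha0 : a = 0
  · simp [fracLeft, ha0]
  · simp [fracLeft, ha0, integral_neg]

theorem IsTest.continuousOn_fracRight {a : ℝ} (ha : 0 ≤ a) {χ : ℝ → ℝ} (h : IsTest χ) :
    ContinuousOn (fracRight a χ) (Ioo 0 1) := fun _ hx =>
  (h.hasDerivAt_fracRight ha hx).continuousAt.continuousWithinAt

theorem IsTest.continuousOn_fracLeft {a : ℝ} (ha : 0 ≤ a) {χ : ℝ → ℝ} (h : IsTest χ) :
    ContinuousOn (fracLeft a χ) (Ioo 0 1) := fun _ hx =>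
  (h.hasDerivAt_fracLeft ha hx).continuousAt.continuousWithinAt

theorem fracLeft_eq_scaled {b x : ℝ} (hb : 0 < b) (hx : x ∈ Ioo (0 : ℝ) 1) (h : ℝ → ℝ) :
    fracLeft b h x = x ^ b * ∫ y, (1 - y) ^ (b - 1) / Real.Gamma b * h (x * y) ∂unitVol := by
  rw [fracLeft_of_pos hb, integral_abelKernel_mul hx.2.le, integral_Ioo_eq_affine hx.1,
    ← integral_const_mul, ← integral_const_mul]
  refine setIntegral_congr_fun measurableSet_Ioo fun y hy => ?_
  simp only [sub_zero, zero_add]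
  rw [show x - x * y = x * (1 - y) by ring, Real.mul_rpow hx.1.le (sub_pos.2 hy.2).le,
    show b = 1 + (b - 1) by ring, Real.rpow_add hx.1, Real.rpow_one]
  simp only [add_sub_cancel_left]
  ring

/-- After the scaling `t = x y` the powers of `x` cancel, since `A + B - (A + B) = 0`, and `x`
occurs only in `ψ (x y)`. Differentiation under the integral produces the factor `y`, which accounts
for the shifts `A - 1` and `1 - (A + B)` of the exponents. -/
theorem hasDerivAt_weighted_fracLeft {A B M x : ℝ} (hB : 0 ≤ B) (hAB : A + B < 1)
    {ψ ψ' : ℝ → ℝ} (hd : ∀ y ∈ Ioo (0 : ℝ) 1, HasDerivAt ψ (ψ' y) y)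
    (hc : ContinuousOn ψ' (Ioo 0 1)) (hψ : ∀ y ∈ Ioo (0 : ℝ) 1, |ψ y| ≤ M)
    (hψ' : ∀ y ∈ Ioo (0 : ℝ) 1, |ψ' y| ≤ M) (hx : x ∈ Ioo (0 : ℝ) 1) :
    HasDerivAt (fun x => x ^ A * fracLeft B (fun t => t ^ (-(A + B)) * ψ t) x)
      (x ^ (A - 1) * fracLeft B (fun b => b ^ (1 - (A + B)) * ψ' b) x) x := by
  rcases hB.eq_or_lt with rfl | hB
  · simp only [fracLeft_zero, add_zero]
    have e : x ^ (A - 1) * (x ^ (1 - A) * ψ' x) = ψ' x := by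
      rw [← mul_assoc, ← Real.rpow_add hx.1]; simp
    rw [e]
    refine (hd x hx).congr_of_eventuallyEq ?_
    filter_upwards [Ioo_mem_nhds hx.1 hx.2] with y hy
    rw [← mul_assoc, ← Real.rpow_add hy.1]; simp
  have hmul : ∀ {x y : ℝ}, x ∈ Ioo (0 : ℝ) 1 → y ∈ Ioo (0 : ℝ) 1 → x * y ∈ Ioo (0 : ℝ) 1 :=
    fun hx hy => ⟨mul_pos hx.1 hy.1, mul_lt_one_of_nonneg_of_lt_one_left hx.1.le hx.2 hy.2.le⟩
  have hcψ : ContinuousOn ψ (Ioo 0 1) := fun y hy => (hd y hy).continuousAt.continuousWithinAt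
  have hint : ∀ c : ℝ, -1 < c →
      Integrable (fun y : ℝ => (1 - y) ^ (B - 1) / Real.Gamma B * y ^ c) unitVol := by
    intro c hc
    have := integrableOn_beta (p := c + 1) (q := B) (by linarith) hB
    refine (this.div_const (Real.Gamma B)).congr (Eventually.of_forall fun y => ?_)
    simp only [add_sub_cancel_right]
    ring
  have hmeas : ∀ {g : ℝ → ℝ} {z : ℝ}, ContinuousOn g (Ioo 0 1) → z ∈ Ioo (0 : ℝ) 1 →
      AEStronglyMeasurable (fun y => g (z * y)) unitVol := fun hg hz =>
    (hg.comp (continuous_const.mul continuous_id).continuousOn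
      fun y hy => hmul hz hy).aestronglyMeasurable measurableSet_Ioo
  have e1 : ∀ z ∈ Ioo (0 : ℝ) 1, z ^ A * fracLeft B (fun t => t ^ (-(A + B)) * ψ t) z =
      ∫ y, (1 - y) ^ (B - 1) / Real.Gamma B * y ^ (-(A + B)) * ψ (z * y) ∂unitVol := by
    intro z hz
    rw [fracLeft_eq_scaled hB hz, ← mul_assoc, ← integral_const_mul]
    refine setIntegral_congr_fun measurableSet_Ioo fun y hy => ?_
    rw [Real.mul_rpow hz.1.le hy.1.le]
    have : z ^ A * z ^ B * z ^ (-(A + B)) = 1 := by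
      rw [← Real.rpow_add hz.1, ← Real.rpow_add hz.1]; simp
    linear_combination ((1 - y) ^ (B - 1) / Real.Gamma B * y ^ (-(A + B)) * ψ (z * y)) * this
  have e2 : x ^ (A - 1) * fracLeft B (fun b => b ^ (1 - (A + B)) * ψ' b) x =
      ∫ y, (1 - y) ^ (B - 1) / Real.Gamma B * y ^ (-(A + B)) * (ψ' (x * y) * y) ∂unitVol := by
    rw [fracLeft_eq_scaled hB hx, ← mul_assoc, ← integral_const_mul]
    refine setIntegral_congr_fun measurableSet_Ioo fun y hy => ?_
    rw [Real.mul_rpow hx.1.le hy.1.le]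
    have h1 : x ^ (A - 1) * x ^ B * x ^ (1 - (A + B)) = 1 := by
      rw [← Real.rpow_add hx.1, ← Real.rpow_add hx.1]; ring_nf; simp
    have h2 : y ^ (1 - (A + B)) = y ^ (-(A + B)) * y := by
      rw [sub_eq_neg_add, Real.rpow_add hy.1, Real.rpow_one]
    rw [h2]
    linear_combination
      ((1 - y) ^ (B - 1) / Real.Gamma B * y ^ (-(A + B)) * y * ψ' (x * y)) * h1
  rw [e2]
  have hw := hint (-(A + B)) (by linarith)
  have key := (hasDerivAt_integral_of_dominated_loc_of_deriv_le (μ := unitVol) (x₀ := x)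
    (s := Ioo 0 1)
    (F := fun z y => (1 - y) ^ (B - 1) / Real.Gamma B * y ^ (-(A + B)) * ψ (z * y))
    (F' := fun z y => (1 - y) ^ (B - 1) / Real.Gamma B * y ^ (-(A + B)) * (ψ' (z * y) * y))
    (bound := fun y => (1 - y) ^ (B - 1) / Real.Gamma B * y ^ (-(A + B)) * M)
    (Ioo_mem_nhds hx.1 hx.2)
    (by
      filter_upwards [Ioo_mem_nhds hx.1 hx.2] with z hz
      exact hw.1.mul (hmeas hcψ hz))
    (hw.mul_bdd (c := M) (hmeas hcψ hx) (by
      filter_upwards [ae_unitVol_mem] with y hy using hψ _ (hmul hx hy)))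
    (hw.1.mul ((hmeas hc hx).mul continuous_id.aestronglyMeasurable))
    (by
      filter_upwards [ae_unitVol_mem] with y hy z hz
      have h0 : 0 ≤ (1 - y) ^ (B - 1) / Real.Gamma B * y ^ (-(A + B)) :=
        mul_nonneg (div_nonneg (Real.rpow_nonneg (sub_pos.2 hy.2).le _)
          (Real.Gamma_pos_of_pos hB).le) (Real.rpow_nonneg hy.1.le _)
      rw [norm_mul, Real.norm_of_nonneg h0, norm_mul, Real.norm_of_nonneg hy.1.le]
      refine mul_le_mul_of_nonneg_left ?_ h0
      have h3 := hψ' _ (hmul hz hy)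
      exact (mul_le_of_le_one_right (norm_nonneg _) hy.2.le).trans h3)
    (hw.mul_const M)
    (by
      filter_upwards [ae_unitVol_mem] with y hy z hz
      have := (hd _ (hmul hz hy)).comp z (hasDerivAt_mul_const (𝕜 := ℝ) (x := z) y)
      simpa [Function.comp_def] using
        this.const_mul ((1 - y) ^ (B - 1) / Real.Gamma B * y ^ (-(A + B))))).2
  refine key.congr_of_eventuallyEq ?_
  filter_upwards [Ioo_mem_nhds hx.1 hx.2] with z hz using e1 z hz

/-! ### The flux expressed through potentials. -/

/-- The inner potential `b^{1-(A+B)} ₓI_1^B [x^{A-1} u]`. -/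
noncomputable def innerPotential (A B : ℝ) (u : ℝ → ℝ) (b : ℝ) : ℝ :=
  b ^ (1 - (A + B)) * fracRight B (fun x => x ^ (A - 1) * u x) b

/-- The flux of `u` is a multiple of `s^B D W`, where `W` is the flux potential. -/
noncomputable def fluxPotential (A B : ℝ) (u : ℝ → ℝ) : ℝ → ℝ :=
  fracLeft A (innerPotential A B u)

theorem aestronglyMeasurable_rpow_mul {u : ℝ → ℝ} (hu : AEStronglyMeasurable u unitVol) (c : ℝ) :
    AEStronglyMeasurable (fun x => x ^ c * u x) unitVol :=
  (by fun_prop : Measurable fun s : ℝ => s ^ c).aestronglyMeasurable.mul hu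

/-- Transposition of the outer factor `₀I^B`. The exponents balance, `x^{A-1} x^{B+1-(A+B)} = 1`, so
integrability of `u` suffices although `x^{A-1} u` need not be integrable. -/
theorem Admissible.duality_inner {A B r lam M : ℝ} (h : Admissible A B r lam) {u G : ℝ → ℝ}
    (hu : Integrable u unitVol) (hG : AEStronglyMeasurable G unitVol) (hM : 0 ≤ M)
    (hle : ∀ x ∈ Ioo (0 : ℝ) 1, |G x| ≤ M) :
    Integrable (fun x => x ^ (A - 1) * u x * fracLeft B (fun b => b ^ (1 - (A + B)) * G b) x)
      unitVol ∧
    Integrable (fun b => innerPotential A B u b * G b) unitVol ∧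
    ∫ x, x ^ (A - 1) * u x * fracLeft B (fun b => b ^ (1 - (A + B)) * G b) x ∂unitVol =
      ∫ b, innerPotential A B u b * G b ∂unitVol := by
  have hgi : Integrable (fun x => x ^ (A - 1) * u x * x ^ (B + (1 - (A + B)))) unitVol := by
    refine hu.congr ?_
    filter_upwards [ae_unitVol_mem] with x hx
    have : x ^ (A - 1) * x ^ (B + (1 - (A + B))) = 1 := by
      rw [← Real.rpow_add hx.1]; ring_nf; simp
    linear_combination (-u x) * this
  have := fracLeft_duality_of_le_rpow (a := B) (c := 1 - (A + B)) h.nonneg_right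
    (by linarith [h.lt_one]) hM (aestronglyMeasurable_rpow_mul hu.1 (A - 1))
    (aestronglyMeasurable_rpow_mul hG (1 - (A + B)))
    (fun s hs => by
      rw [abs_mul, abs_of_nonneg (Real.rpow_nonneg hs.1.le _), mul_comm]
      exact mul_le_mul_of_nonneg_right (hle s hs) (Real.rpow_nonneg hs.1.le _)) hgi
  have e : (fun s => fracRight B (fun x => x ^ (A - 1) * u x) s * (s ^ (1 - (A + B)) * G s)) =
      fun b => innerPotential A B u b * G b := by
    ext b; simp only [innerPotential]; ring
  rw [← e]
  exact this

theorem Admissible.integrable_innerPotential {A B r lam : ℝ} (h : Admissible A B r lam)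
    {u : ℝ → ℝ} (hu : Integrable u unitVol) : Integrable (innerPotential A B u) unitVol := by
  simpa using (h.duality_inner (G := fun _ => 1) hu aestronglyMeasurable_const zero_le_one
    (by simp)).2.1

theorem Admissible.integrable_fluxPotential {A B r lam : ℝ} (h : Admissible A B r lam)
    {u : ℝ → ℝ} (hu : Integrable u unitVol) : Integrable (fluxPotential A B u) unitVol :=
  integrable_fracLeft h.nonneg_left (h.integrable_innerPotential hu)

/-- Both sides are the derivative at `x` of the two sides of the factorization, so they agree by
uniqueness of derivatives. -/
theorem Admissible.deriv_eq {A B r lam x : ℝ} (h : Admissible A B r lam) {φ : ℝ → ℝ}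
    (hφ : IsTest φ) (hx : x ∈ Ioo (0 : ℝ) 1) :
    r * fracRight (A + B) (deriv φ) x + (1 - r) * fracLeft (A + B) (deriv φ) x =
      lam * (x ^ (A - 1) * fracLeft B (fun b => b ^ (1 - (A + B)) *
        fracRight A (deriv fun s => s ^ B * φ s) b) x) := by
  have hχ := hφ.mul_rpow B
  obtain ⟨M, hM0, hM⟩ := hφ.exists_bound
  obtain ⟨M₁, hM₁0, hM₁⟩ := hχ.exists_bound
  obtain ⟨M₂, hM₂0, hM₂⟩ := hχ.deriv.exists_bound
  have hA := h.nonneg_left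
  have hGp := Real.Gamma_pos_of_pos (show 0 < A + 1 by linarith)
  have d1 := ((hφ.hasDerivAt_fracRight h.pos.le hx).const_mul r).add
    ((hφ.hasDerivAt_fracLeft h.pos.le hx).const_mul (1 - r))
  have d2 := (hasDerivAt_weighted_fracLeft (A := A) (B := B)
    (M := max M₁ M₂ / Real.Gamma (A + 1)) h.nonneg_right h.lt_one
    (fun y hy => hχ.hasDerivAt_fracRight hA hy) (hχ.deriv.continuousOn_fracRight hA)
    (fun y hy => (abs_fracRight_le hA hM₁0 hy (hM₁ y)
      (Eventually.of_forall fun s _ => hM₁ s)).trans (by gcongr; exact le_max_left _ _))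
    (fun y hy => (abs_fracRight_le hA hM₂0 hy (hM₂ y)
      (Eventually.of_forall fun s _ => hM₂ s)).trans (by gcongr; exact le_max_right _ _))
    hx).const_mul lam
  refine d1.unique (d2.congr_of_eventuallyEq ?_)
  filter_upwards [Ioo_mem_nhds hx.1 hx.2] with y hy
  exact h.factorization hy hM0 hφ.1.continuous.aestronglyMeasurable fun s _ => hM s

theorem IsTest.deriv_rightInt {a x : ℝ} (ha : 0 < a) {φ : ℝ → ℝ} (hφ : IsTest φ)
    (hx : x ∈ Ioo (0 : ℝ) 1) :
    _root_.deriv (rightInt a φ) x = fracRight a (_root_.deriv φ) x := by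
  refine ((hφ.hasDerivAt_fracRight ha.le hx).congr_of_eventuallyEq ?_).deriv
  filter_upwards [Ioo_mem_nhds hx.1 hx.2] with y hy using rightInt_eq_fracRight ha hy φ

theorem IsTest.deriv_leftInt {a x : ℝ} (ha : 0 < a) {φ : ℝ → ℝ} (hφ : IsTest φ)
    (hx : x ∈ Ioo (0 : ℝ) 1) :
    _root_.deriv (leftInt a φ) x = fracLeft a (_root_.deriv φ) x := by
  refine ((hφ.hasDerivAt_fracLeft ha.le hx).congr_of_eventuallyEq ?_).deriv
  filter_upwards [Ioo_mem_nhds hx.1 hx.2] with y hy using leftInt_eq_fracLeft ha hy φ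

theorem IsTest.integrable_mul_fracRight {a : ℝ} (ha : 0 ≤ a) {φ u : ℝ → ℝ} (hφ : IsTest φ)
    (hu : Integrable u unitVol) : Integrable (fun x => u x * fracRight a φ x) unitVol := by
  obtain ⟨M, hM0, hM⟩ := hφ.exists_bound
  refine hu.mul_bdd (c := M / Real.Gamma (a + 1))
    ((hφ.continuousOn_fracRight ha).aestronglyMeasurable measurableSet_Ioo) ?_
  filter_upwards [ae_unitVol_mem] with x hx
  exact abs_fracRight_le ha hM0 hx (hM x) (Eventually.of_forall fun s _ => hM s)

theorem IsTest.integrable_mul_fracLeft {a : ℝ} (ha : 0 ≤ a) {φ u : ℝ → ℝ} (hφ : IsTest φ)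
    (hu : Integrable u unitVol) : Integrable (fun x => u x * fracLeft a φ x) unitVol := by
  obtain ⟨M, hM0, hM⟩ := hφ.exists_bound
  refine hu.mul_bdd (c := M / Real.Gamma (a + 1))
    ((hφ.continuousOn_fracLeft ha).aestronglyMeasurable measurableSet_Ioo) ?_
  filter_upwards [ae_unitVol_mem] with x hx
  have hG := Real.Gamma_pos_of_pos (show 0 < a + 1 by linarith)
  refine (abs_fracLeft_le (c := 0) ha le_rfl hM0 hx (by simpa using hM x)
    (Eventually.of_forall fun s _ => by simpa using hM s)).trans ?_
  gcongr
  exact mul_le_of_le_one_right hM0 (Real.rpow_le_one hx.1.le hx.2.le (by linarith))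

theorem IsTest.derivPairing_rightInt {a : ℝ} (ha : 0 < a) {φ : ℝ → ℝ} (hφ : IsTest φ)
    (u : ℝ → ℝ) : derivPairing u (rightInt a φ) =
      -∫ x, u x * fracRight a (_root_.deriv φ) x ∂unitVol := by
  rw [derivPairing]
  congr 1
  refine setIntegral_congr_fun measurableSet_Ioo fun x hx => ?_
  simp only [hφ.deriv_rightInt ha hx]

theorem IsTest.derivPairing_leftInt {a : ℝ} (ha : 0 < a) {φ : ℝ → ℝ} (hφ : IsTest φ)
    (u : ℝ → ℝ) : derivPairing u (leftInt a φ) =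
      -∫ x, u x * fracLeft a (_root_.deriv φ) x ∂unitVol := by
  rw [derivPairing]
  congr 1
  refine setIntegral_congr_fun measurableSet_Ioo fun x hx => ?_
  simp only [hφ.deriv_leftInt ha hx]

/-- The distributional flux in terms of the flux potential. -/
theorem Admissible.pairing_eq {A B r lam : ℝ} (h : Admissible A B r lam) {u φ : ℝ → ℝ}
    (hu : Integrable u unitVol) (hφ : IsTest φ) :
    r * derivPairing u (rightInt (A + B) φ) + (1 - r) * derivPairing u (leftInt (A + B) φ) =
      -(lam * ∫ s, fluxPotential A B u s * deriv (fun s => s ^ B * φ s) s ∂unitVol) := by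
  have hχ := (hφ.mul_rpow B).deriv
  obtain ⟨M, hM0, hM⟩ := hχ.exists_bound
  have hA := h.nonneg_left
  rw [hφ.derivPairing_rightInt h.pos, hφ.derivPairing_leftInt h.pos]
  have i1 := (hφ.deriv.integrable_mul_fracRight h.pos.le hu).const_mul r
  have i2 := (hφ.deriv.integrable_mul_fracLeft h.pos.le hu).const_mul (1 - r)
  have e1 := integral_add i1 i2
  rw [integral_const_mul, integral_const_mul] at e1
  have e2 : ∫ x, (r * (u x * fracRight (A + B) (deriv φ) x) +
      (1 - r) * (u x * fracLeft (A + B) (deriv φ) x)) ∂unitVol =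
      lam * ∫ x, x ^ (A - 1) * u x * fracLeft B (fun b => b ^ (1 - (A + B)) *
        fracRight A (deriv fun s => s ^ B * φ s) b) x ∂unitVol := by
    rw [← integral_const_mul]
    refine setIntegral_congr_fun measurableSet_Ioo fun x hx => ?_
    have := h.deriv_eq hφ hx
    linear_combination u x * this
  have e3 := (h.duality_inner hu ((hχ.continuousOn_fracRight hA).aestronglyMeasurable
    measurableSet_Ioo) (M := M / Real.Gamma (A + 1))
    (div_nonneg hM0 (Real.Gamma_pos_of_pos (by linarith)).le)
    (fun x hx => abs_fracRight_le hA hM0 hx (hM x) (Eventually.of_forall fun s _ => hM s))).2.2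
  have e4 := (fracLeft_duality_of_bounded hA hM0 hχ.1.continuous.aestronglyMeasurable
    (h.integrable_innerPotential hu) (fun s _ => hM s)).2.2
  have e5 : ∫ s, fluxPotential A B u s * deriv (fun s => s ^ B * φ s) s ∂unitVol =
      ∫ b, innerPotential A B u b * fracRight A (deriv fun s => s ^ B * φ s) b ∂unitVol := by
    simp only [fluxPotential, mul_comm (fracLeft A _ _), e4, mul_comm (innerPotential A B u _)]
  rw [e5, ← e3, ← e2, e1]
  ring

/-! ### Distributional derivatives on the interval. -/

theorem exists_Icc_of_isCompact_subset_Ioo {K : Set ℝ} (hK : IsCompact K) (h : K ⊆ Ioo 0 1) :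
    ∃ a b : ℝ, 0 < a ∧ a < b ∧ b < 1 ∧ K ⊆ Icc a b := by
  rcases K.eq_empty_or_nonempty with rfl | hne
  · exact ⟨1 / 3, 1 / 2, by norm_num, by norm_num, by norm_num, empty_subset _⟩
  · obtain ⟨a, ha, ha'⟩ := hK.exists_isLeast hne
    obtain ⟨b, hb, hb'⟩ := hK.exists_isGreatest hne
    have h1 := (h ha).1
    have h2 := (h hb).2
    have h3 : a ≤ b := ha' hb
    refine ⟨a / 2, (b + 1) / 2, by linarith, by linarith, by linarith, fun x hx => ?_⟩
    have h4 : a ≤ x := ha' hx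
    have h5 : x ≤ b := hb' hx
    constructor <;> linarith

theorem IsTest.integrable_mul {G φ : ℝ → ℝ} (hG : LocallyIntegrableOn G (Ioo 0 1))
    (hφ : IsTest φ) : Integrable (fun x => G x * φ x) unitVol := by
  obtain ⟨M, hM0, hM⟩ := hφ.exists_bound
  have h1 : IntegrableOn (fun x => G x * φ x) (tsupport φ) :=
    (hG.integrableOn_compact_subset hφ.2.2 hφ.2.1).mul_bdd (c := M)
      hφ.1.continuous.aestronglyMeasurable (Eventually.of_forall hM)
  refine IntegrableOn.of_forall_sdiff_eq_zero h1 measurableSet_Ioo fun x hx => ?_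
  rw [image_eq_zero_of_notMem_tsupport hx.2, mul_zero]

theorem IsTest.integrable {φ : ℝ → ℝ} (hφ : IsTest φ) : Integrable φ unitVol :=
  (hφ.1.continuous.integrable_of_hasCompactSupport hφ.2.1).restrict

theorem IsTest.fracRight_one_deriv {χ : ℝ → ℝ} (hχ : IsTest χ) {s : ℝ} (hs : s ∈ Ioo (0 : ℝ) 1) :
    fracRight 1 (_root_.deriv χ) s = -χ s := by
  rw [fracRight_of_pos one_pos, integral_abelKernel_mul' hs.1.le]
  simp only [sub_self, Real.rpow_zero, Real.Gamma_one, div_one, one_mul]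
  rw [← integral_Ioc_eq_integral_Ioo, ← intervalIntegral.integral_of_le hs.2.le,
    intervalIntegral.integral_deriv_eq_sub (fun x _ => (hχ.hasDerivAt x).differentiableAt)
      (hχ.deriv.1.continuous.intervalIntegrable _ _), hχ.eq_zero (x := 1) (by simp)]
  ring

/-- Integration by parts, read as duality of order one: the right integral of order one of `χ'` is
`-χ`. -/
theorem IsTest.integral_primitive_mul_deriv {p χ : ℝ → ℝ} (hp : Integrable p unitVol)
    (hχ : IsTest χ) :
    ∫ s, fracLeft 1 p s * _root_.deriv χ s ∂unitVol = -∫ s, p s * χ s ∂unitVol := by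
  obtain ⟨M, hM0, hM⟩ := hχ.deriv.exists_bound
  have := (fracLeft_duality_of_bounded zero_le_one hM0
    hχ.deriv.1.continuous.aestronglyMeasurable hp (fun s _ => hM s)).2.2
  simp only [mul_comm (fracLeft 1 p _)]
  rw [this, ← integral_neg]
  refine setIntegral_congr_fun measurableSet_Ioo fun s hs => ?_
  simp only [hχ.fracRight_one_deriv hs]
  ring

theorem exists_isTest_integral_eq_one : ∃ η : ℝ → ℝ, IsTest η ∧ ∫ x, η x ∂unitVol = 1 := by
  let f : ContDiffBump (1 / 2 : ℝ) := ⟨1 / 8, 1 / 4, by norm_num, by norm_num⟩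
  have hs : tsupport (f.normed volume) ⊆ Ioo 0 1 := by
    rw [f.tsupport_normed_eq, Real.closedBall_eq_Icc]
    intro x hx
    have h1 := hx.1
    have h2 := hx.2
    simp only [f] at h1 h2
    constructor <;> linarith
  refine ⟨f.normed volume, ⟨f.contDiff_normed, f.hasCompactSupport_normed, hs⟩, ?_⟩
  rw [setIntegral_eq_integral_of_forall_compl_eq_zero, f.integral_normed]
  intro x hx
  exact image_eq_zero_of_notMem_tsupport fun h => hx (hs h)

/-- The primitive from `0` vanishes to the left of the support of `ψ`, and mean zero makes it vanish
to the right as well. -/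
theorem IsTest.exists_primitive {ψ : ℝ → ℝ} (hψ : IsTest ψ) (h0 : ∫ x, ψ x ∂unitVol = 0) :
    ∃ χ, IsTest χ ∧ _root_.deriv χ = ψ := by
  obtain ⟨a, b, ha, hab, hb, hK⟩ := exists_Icc_of_isCompact_subset_Ioo hψ.2.1 hψ.2.2
  have hd : ∀ x, HasDerivAt (fun x => ∫ t in (0 : ℝ)..x, ψ t) (ψ x) x := fun x =>
    intervalIntegral.integral_hasDerivAt_right (hψ.1.continuous.intervalIntegrable _ _)
      (hψ.1.continuous.stronglyMeasurableAtFilter _ _) hψ.1.continuous.continuousAt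
  have hder : _root_.deriv (fun x => ∫ t in (0 : ℝ)..x, ψ t) = ψ := funext fun x => (hd x).deriv
  have hz : ∀ x, x ∉ Icc a b → ψ x = 0 := fun x hx =>
    image_eq_zero_of_notMem_tsupport fun h => hx (hK h)
  have hsub : tsupport (fun x => ∫ t in (0 : ℝ)..x, ψ t) ⊆ Icc a b := by
    refine closure_minimal (fun x hx => ?_) isClosed_Icc
    by_contra hxab
    apply hx
    rcases lt_or_ge x a with h | h
    · refine (intervalIntegral.integral_congr (g := fun _ => 0) fun t ht => hz t ?_).trans (by simp)
      intro h'
      have := ht.2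
      have := h'.1
      have := max_lt ha h
      linarith
    · have hbx : b < x := by
        by_contra hbx
        exact hxab ⟨h, not_lt.1 hbx⟩
      have h1 : ∫ t in (0 : ℝ)..1, ψ t = 0 := by
        rw [intervalIntegral.integral_of_le zero_le_one, integral_Ioc_eq_integral_Ioo]
        exact h0
      have h2 : ∫ t in x..(1 : ℝ), ψ t = 0 := by
        refine (intervalIntegral.integral_congr (g := fun _ => 0) fun t ht => hz t ?_).trans
          (by simp)
        intro h'
        have := ht.1
        have := h'.2
        have := lt_min hbx hb
        linarith
      have h3 := intervalIntegral.integral_add_adjacent_intervals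
        (hψ.1.continuous.intervalIntegrable (μ := volume) 0 x)
        (hψ.1.continuous.intervalIntegrable x 1)
      simp only
      linarith
  refine ⟨_, ⟨contDiff_infty_iff_deriv.2 ⟨fun x => (hd x).differentiableAt, ?_⟩,
    isCompact_Icc.of_isClosed_subset (isClosed_tsupport _) hsub,
    hsub.trans fun x hx => ⟨ha.trans_le hx.1, hx.2.trans_lt hb⟩⟩, hder⟩
  rw [hder]
  exact hψ.1

/-- A locally integrable function with vanishing distributional derivative is constant. -/
theorem ae_eq_const_of_integral_mul_deriv_eq_zero {G : ℝ → ℝ}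
    (hG : LocallyIntegrableOn G (Ioo 0 1))
    (h : ∀ χ, IsTest χ → ∫ x, G x * deriv χ x ∂unitVol = 0) :
    ∃ c, ∀ᵐ x ∂unitVol, G x = c := by
  obtain ⟨η, hη, hη1⟩ := exists_isTest_integral_eq_one
  refine ⟨∫ x, G x * η x ∂unitVol, ?_⟩
  set c := ∫ x, G x * η x ∂unitVol with hc
  have hGc : LocallyIntegrableOn (fun x => G x - c) (Ioo 0 1) :=
    hG.sub ((locallyIntegrable_const c).locallyIntegrableOn _)
  have key := isOpen_Ioo.ae_eq_zero_of_integral_contDiff_smul_eq_zero hGc (by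
    intro φ h1 h2 h3
    have hφ : IsTest φ := ⟨h1, h2, h3⟩
    have hz : ∀ x, x ∉ Ioo (0 : ℝ) 1 → φ x • (G x - c) = 0 := fun x hx => by
      rw [hφ.eq_zero hx, zero_smul]
    rw [← setIntegral_eq_integral_of_forall_compl_eq_zero hz]
    -- Subtracting `m η` gives `φ` mean zero, so the difference is the derivative of a test function
    -- and is annihilated by `G`. Hence `∫ G φ = m ∫ G η = c ∫ φ`.
    set m := ∫ x, φ x ∂unitVol with hm
    have hψ : IsTest fun x => φ x - m * η x := by
      refine ⟨h1.sub (contDiff_const.mul hη.1), h2.sub hη.2.1.mul_left, ?_⟩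
      refine (tsupport_sub φ fun x => m * η x).trans (union_subset h3 ?_)
      exact (tsupport_mul_subset_right (f := fun _ => m)).trans hη.2.2
    obtain ⟨χ, hχ, hχ'⟩ := hψ.exists_primitive (by
      rw [integral_sub hφ.integrable (hη.integrable.const_mul m), integral_const_mul, hη1]
      simp [hm])
    have h4 := h χ hχ
    rw [hχ'] at h4
    have i1 := hφ.integrable_mul hG
    have i2 := (hη.integrable_mul hG).const_mul m
    have e : ∫ x, (G x * φ x - m * (G x * η x)) ∂unitVol = 0 := by
      rw [← h4]; congr 1 with x; ring
    rw [integral_sub i1 i2, integral_const_mul, ← hc] at e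
    have e2 : ∫ x, φ x • (G x - c) ∂unitVol = ∫ x, (G x * φ x - c * φ x) ∂unitVol := by
      congr 1 with x; simp only [smul_eq_mul]; ring
    rw [e2, integral_sub i1 (hφ.integrable.const_mul c), integral_const_mul, ← hm]
    linarith)
  refine (ae_restrict_iff' measurableSet_Ioo).2 ?_
  filter_upwards [key] with x hx hx1
  exact sub_eq_zero.1 (hx hx1)

/-! ### Boundary behaviour of the potentials. -/

theorem exists_mem_Ioo_of_ae {P : ℝ → Prop} (h : ∀ᵐ x ∂unitVol, P x) {a b : ℝ} (ha : 0 ≤ a)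
    (hab : a < b) (hb : b ≤ 1) : ∃ x ∈ Ioo a b, P x := by
  have h1 := (ae_restrict_iff' measurableSet_Ioo).1 h
  have hd := Measure.dense_of_ae h1
  obtain ⟨x, hx, hP⟩ := hd.exists_mem_open isOpen_Ioo (nonempty_Ioo.2 hab)
  exact ⟨x, hP, hx ⟨ha.trans_lt hP.1, hP.2.trans_le hb⟩⟩

theorem ae_abs_le_of_tendsto_zero {u : ℝ → ℝ} (h : Tendsto u (𝓝[>] 0 ⊓ ae volume) (𝓝 0))
    {ε : ℝ} (hε : 0 < ε) : ∃ δ ∈ Ioo (0 : ℝ) 1, ∀ᵐ x ∂unitVol, x < δ → |u x| ≤ ε := by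
  have h1 := h.eventually (Metric.ball_mem_nhds 0 hε)
  obtain ⟨t₁, ht₁, t₂, ht₂, hsub⟩ := mem_inf_iff_superset.1 h1
  obtain ⟨d, hd, hd'⟩ := mem_nhdsGT_iff_exists_Ioo_subset.1 ht₁
  have hd0 : (0 : ℝ) < d := hd
  refine ⟨min d (1 / 2), ⟨lt_min hd0 (by norm_num), (min_le_right _ _).trans_lt (by norm_num)⟩, ?_⟩
  filter_upwards [ae_restrict_of_ae ht₂, ae_unitVol_mem] with x hx hx1 hxd
  have h2 : x ∈ {x | u x ∈ Metric.ball 0 ε} :=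
    hsub ⟨hd' ⟨hx1.1, hxd.trans_le (min_le_left _ _)⟩, hx⟩
  simp only [mem_ofPred_eq, mem_ball_zero_iff] at h2
  exact h2.le

theorem ae_abs_le_of_tendsto_one {u : ℝ → ℝ} (h : Tendsto u (𝓝[<] 1 ⊓ ae volume) (𝓝 0))
    {ε : ℝ} (hε : 0 < ε) : ∃ δ ∈ Ioo (0 : ℝ) 1, ∀ᵐ x ∂unitVol, δ < x → |u x| ≤ ε := by
  have h1 := h.eventually (Metric.ball_mem_nhds 0 hε)
  obtain ⟨t₁, ht₁, t₂, ht₂, hsub⟩ := mem_inf_iff_superset.1 h1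
  obtain ⟨d, hd, hd'⟩ := mem_nhdsLT_iff_exists_Ioo_subset.1 ht₁
  have hd0 : d < (1 : ℝ) := hd
  refine ⟨max d (1 / 2), ⟨lt_max_of_lt_right (by norm_num), max_lt hd0 (by norm_num)⟩, ?_⟩
  filter_upwards [ae_restrict_of_ae ht₂, ae_unitVol_mem] with x hx hx1 hxd
  have h2 : x ∈ {x | u x ∈ Metric.ball 0 ε} :=
    hsub ⟨hd' ⟨(le_max_left _ _).trans_lt hxd, hx1.2⟩, hx⟩
  simp only [mem_ofPred_eq, mem_ball_zero_iff] at h2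
  exact h2.le

theorem image_const_div_Ioo {b : ℝ} (hb : 0 < b) :
    (fun y : ℝ => b / y) '' Ioo b 1 = Ioo b 1 := by
  ext t
  simp only [mem_image, mem_Ioo]
  constructor
  · rintro ⟨y, ⟨h0, h1⟩, rfl⟩
    have hy : 0 < y := hb.trans h0
    exact ⟨by rw [lt_div_iff₀ hy]; nlinarith, by rwa [div_lt_one hy]⟩
  · rintro ⟨h0, h1⟩
    have ht : 0 < t := hb.trans h0
    refine ⟨b / t, ⟨by rw [lt_div_iff₀ ht]; nlinarith, by rwa [div_lt_one ht]⟩, ?_⟩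
    field_simp

theorem inversion_rpow_eq {A B b y : ℝ} (hb : 0 < b) (hy : y ∈ Ioo b 1) :
    |(-b / y ^ 2)| * ((b / y - b) ^ (B - 1) / Real.Gamma B * (b / y) ^ (A - 1)) =
      b ^ (A + B - 1) / Real.Gamma B * (y ^ (1 - (A + B) - 1) * (1 - y) ^ (B - 1)) := by
  have hy0 : 0 < y := hb.trans hy.1
  have hy1 : 0 < 1 - y := sub_pos.2 hy.2
  have e : b / y - b = b * (1 - y) / y := by field_simp
  have e2 : |(-b / y ^ 2)| = b * y ^ (-2 : ℝ) := by
    rw [neg_div, abs_neg, abs_of_pos (by positivity), Real.rpow_neg hy0.le]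
    norm_num [div_eq_mul_inv]
  rw [e, e2, Real.div_rpow (by positivity) hy0.le, Real.mul_rpow hb.le hy1.le,
    Real.div_rpow hb.le hy0.le]
  have e3 : b ^ (A + B - 1) = b * b ^ (B - 1) * b ^ (A - 1) := by
    rw [show A + B - 1 = 1 + (B - 1) + (A - 1) by ring, Real.rpow_add hb, Real.rpow_add hb,
      Real.rpow_one]
  have e4 : y ^ (1 - (A + B) - 1) = y ^ (-2 : ℝ) / y ^ (B - 1) / y ^ (A - 1) := by
    rw [← Real.rpow_sub hy0, ← Real.rpow_sub hy0]
    congr 1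
    ring
  rw [e3, e4]
  ring

/-- The inversion `x = b / y` maps `(b,1)` onto itself, splits off the power `b^{A+B-1}` and leaves
a Beta integrand; enlarging the domain to `(0,1)` makes the constant independent of `b`. -/
theorem abelKernel_right_mul_rpow {A B b : ℝ} (hB : 0 < B) (hAB : A + B < 1)
    (hb : b ∈ Ioo (0 : ℝ) 1) :
    Integrable (fun x => abelKernel B x b * x ^ (A - 1)) unitVol ∧
    ∫ x, abelKernel B x b * x ^ (A - 1) ∂unitVol ≤
      b ^ (A + B - 1) * (Real.Gamma (1 - (A + B)) / Real.Gamma (1 - A)) := by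
  have hder : ∀ y ∈ Ioo b 1, HasDerivWithinAt (fun y : ℝ => b / y) (-b / y ^ 2) (Ioo b 1) y :=
    fun y hy => by
      have hy0 : y ≠ 0 := (hb.1.trans hy.1).ne'
      have := (hasDerivAt_const y b).div (hasDerivAt_id y) hy0
      exact (this.congr_deriv (by simp)).hasDerivWithinAt
  have hinj : InjOn (fun y : ℝ => b / y) (Ioo b 1) := by
    intro y hy z hz h
    have hy0 : y ≠ 0 := (hb.1.trans hy.1).ne'
    have hz0 : z ≠ 0 := (hb.1.trans hz.1).ne'
    have hb0 := hb.1.ne'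
    simp only at h
    field_simp at h
    exact h.symm
  have hsub : Ioo b 1 ⊆ Ioo (0 : ℝ) 1 := Ioo_subset_Ioo_left hb.1.le
  have hbeta := integrableOn_beta (p := 1 - (A + B)) (q := B) (by linarith) hB
  have hGB := Real.Gamma_pos_of_pos hB
  constructor
  · rw [abelKernel_mul_eq_indicator', integrable_indicator_iff measurableSet_Ioi, IntegrableOn,
      Measure.restrict_restrict measurableSet_Ioi, Ioi_inter_Ioo_of_le hb.1.le]
    have : IntegrableOn (fun x => (x - b) ^ (B - 1) / Real.Gamma B * x ^ (A - 1)) (Ioo b 1) := by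
      rw [← image_const_div_Ioo hb.1, integrableOn_image_iff_integrableOn_abs_deriv_smul
        measurableSet_Ioo hder hinj]
      refine IntegrableOn.congr_fun ((hbeta.mono_set hsub).const_mul
        (b ^ (A + B - 1) / Real.Gamma B)) (fun y hy => ?_) measurableSet_Ioo
      exact (inversion_rpow_eq hb.1 hy).symm
    exact this
  · rw [integral_abelKernel_mul' hb.1.le, ← image_const_div_Ioo hb.1,
      integral_image_eq_integral_abs_deriv_smul measurableSet_Ioo hder hinj]
    simp only [smul_eq_mul]
    rw [setIntegral_congr_fun measurableSet_Ioo fun y hy => inversion_rpow_eq hb.1 hy,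
      integral_const_mul]
    have h1 : ∫ y in Ioo b 1, y ^ (1 - (A + B) - 1) * (1 - y) ^ (B - 1) ≤
        Real.Gamma (1 - (A + B)) * Real.Gamma B / Real.Gamma (1 - (A + B) + B) := by
      rw [← integral_beta (by linarith) hB]
      refine setIntegral_mono_set hbeta ?_ hsub.eventuallyLE
      filter_upwards [ae_unitVol_mem] with y hy
      exact mul_nonneg (Real.rpow_nonneg hy.1.le _) (Real.rpow_nonneg (sub_pos.2 hy.2).le _)
    rw [show 1 - (A + B) + B = 1 - A by ring] at h1
    calc _ ≤ b ^ (A + B - 1) / Real.Gamma B *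
          (Real.Gamma (1 - (A + B)) * Real.Gamma B / Real.Gamma (1 - A)) :=
        mul_le_mul_of_nonneg_left h1 (div_nonneg (Real.rpow_nonneg hb.1.le _) hGB.le)
      _ = _ := by field_simp

/-- The prefactor `b^{1-(A+B)}` exactly compensates the mass of the kernel, so the part of the
integral where `u` is small contributes little. The part away from `0` is bounded by the integral of
`|u|` and is killed by the prefactor. -/
theorem Admissible.innerPotential_small_zero {A B r lam : ℝ} (h : Admissible A B r lam)
    {u : ℝ → ℝ} (hu : Integrable u unitVol) (h0 : Tendsto u (𝓝[>] 0 ⊓ ae volume) (𝓝 0))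
    {ε : ℝ} (hε : 0 < ε) :
    ∃ δ ∈ Ioo (0 : ℝ) 1, ∀ᵐ b ∂unitVol, b < δ → |innerPotential A B u b| ≤ ε := by
  rcases h.nonneg_right.eq_or_lt with hB | hB
  · subst hB
    obtain ⟨δ, hδ, hδ'⟩ := ae_abs_le_of_tendsto_zero h0 hε
    refine ⟨δ, hδ, ?_⟩
    filter_upwards [hδ', ae_unitVol_mem] with b hb hb1 hbδ
    have e : innerPotential A 0 u b = u b := by
      simp only [innerPotential, fracRight_zero]
      rw [← mul_assoc, ← Real.rpow_add hb1.1]; simp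
    rw [e]; exact hb hbδ
  have hA1 : 0 < 1 - A := by linarith [h.lt_one]
  have hσ : 0 < 1 - (A + B) := by linarith [h.lt_one]
  set C := Real.Gamma (1 - (A + B)) / Real.Gamma (1 - A) with hC
  have hC0 : 0 < C := div_pos (Real.Gamma_pos_of_pos hσ) (Real.Gamma_pos_of_pos hA1)
  have hGB := Real.Gamma_pos_of_pos hB
  obtain ⟨d, hd, hd'⟩ := ae_abs_le_of_tendsto_zero h0 (ε := ε / 2 / C) (by positivity)
  have hd0 := hd.1
  -- For `b < d/2` and `x ≥ d` one has `x - b ≥ d/2`, so `c` bounds the kernel times `x^{A-1}`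
  -- there.
  set c := (d / 2) ^ (B - 1) / Real.Gamma B * d ^ (A - 1) with hc
  have hc0 : 0 ≤ c := by positivity
  set N := ∫ x, |u x| ∂unitVol with hN
  have hN0 : 0 ≤ N := integral_nonneg fun _ => abs_nonneg _
  have hlim : Tendsto (fun b : ℝ => b ^ (1 - (A + B)) * (c * N)) (𝓝 0) (𝓝 0) := by
    have := ((Real.continuous_rpow_const hσ.le).tendsto 0).mul_const (c * N)
    simpa [Real.zero_rpow hσ.ne'] using this
  obtain ⟨δ, hδ0, hδ⟩ := Metric.eventually_nhds_iff.1
    (hlim.eventually (gt_mem_nhds (show (0 : ℝ) < ε / 2 by positivity)))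
  refine ⟨min δ (d / 2), ⟨lt_min hδ0 (by linarith), (min_le_right _ _).trans_lt
    (by linarith [hd.2])⟩, ?_⟩
  filter_upwards [ae_unitVol_mem] with b hb hbδ
  have hbδ1 := hbδ.trans_le (min_le_left _ _)
  have hbd := hbδ.trans_le (min_le_right _ _)
  obtain ⟨i1, i2⟩ := abelKernel_right_mul_rpow hB h.lt_one hb
  have hbound : ∀ᵐ x ∂unitVol, ‖abelKernel B x b * (x ^ (A - 1) * u x)‖ ≤
      ε / 2 / C * (abelKernel B x b * x ^ (A - 1)) + c * |u x| := by
    filter_upwards [hd', ae_unitVol_mem] with x hx hx1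
    have k0 := abelKernel_nonneg hB x b
    have x0 := Real.rpow_nonneg hx1.1.le (A - 1)
    rw [norm_mul, norm_mul, Real.norm_of_nonneg k0, Real.norm_of_nonneg x0, Real.norm_eq_abs]
    rcases lt_or_ge x d with hxd | hxd
    · have h1 := mul_le_mul_of_nonneg_left (hx hxd) (mul_nonneg k0 x0)
      have h2 : 0 ≤ c * |u x| := by positivity
      nlinarith
    · have hbx : b < x := by linarith
      have h1 : abelKernel B x b ≤ (d / 2) ^ (B - 1) / Real.Gamma B := by
        simp only [abelKernel, hbx, if_true]
        refine div_le_div_of_nonneg_right (Real.rpow_le_rpow_of_nonpos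
          (show 0 < d / 2 by linarith) (by linarith) ?_) hGB.le
        linarith [h.lt_one, h.nonneg_left]
      have h2 : x ^ (A - 1) ≤ d ^ (A - 1) :=
        Real.rpow_le_rpow_of_nonpos hd0 hxd (by linarith)
      have h3 : abelKernel B x b * x ^ (A - 1) ≤ c :=
        mul_le_mul h1 h2 x0 (by positivity)
      have h4 := mul_le_mul_of_nonneg_right h3 (abs_nonneg (u x))
      have h5 : 0 ≤ ε / 2 / C * (abelKernel B x b * x ^ (A - 1)) := by positivity
      rw [← mul_assoc]
      linarith
  have hle := norm_integral_le_of_norm_le ((i1.const_mul (ε / 2 / C)).add (hu.abs.const_mul c))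
    hbound
  rw [integral_add' (i1.const_mul (ε / 2 / C)) (hu.abs.const_mul c), integral_const_mul,
    integral_const_mul, ← hN] at hle
  have hb0 := Real.rpow_nonneg hb.1.le (1 - (A + B))
  have hdist := hδ (show dist b 0 < δ by simpa [abs_of_pos hb.1] using hbδ1)
  have hone : b ^ (1 - (A + B)) * b ^ (A + B - 1) = 1 := by
    rw [← Real.rpow_add hb.1]; simp
  rw [innerPotential, abs_mul, abs_of_nonneg hb0, fracRight_of_pos hB]
  calc b ^ (1 - (A + B)) * |∫ x, abelKernel B x b * (x ^ (A - 1) * u x) ∂unitVol|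
      ≤ b ^ (1 - (A + B)) * (ε / 2 / C * (b ^ (A + B - 1) * C) + c * N) := by
        refine mul_le_mul_of_nonneg_left (hle.trans ?_) hb0
        gcongr
    _ = ε / 2 * (b ^ (1 - (A + B)) * b ^ (A + B - 1)) + b ^ (1 - (A + B)) * (c * N) := by
        field_simp
    _ ≤ ε := by rw [hone]; linarith

/-- For `b` near `1` the right integral sees only values of `u` near `1`, where `u` is small and the
weight `x^{A-1}` is at most `2`. -/
theorem Admissible.innerPotential_small_one {A B r lam : ℝ} (h : Admissible A B r lam)
    {u : ℝ → ℝ} (h1 : Tendsto u (𝓝[<] 1 ⊓ ae volume) (𝓝 0)) {ε : ℝ} (hε : 0 < ε) :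
    ∃ δ ∈ Ioo (0 : ℝ) 1, ∀ᵐ b ∂unitVol, δ < b → |innerPotential A B u b| ≤ ε := by
  have hB := h.nonneg_right
  have hG := Real.Gamma_pos_of_pos (show 0 < B + 1 by linarith)
  obtain ⟨d, hd, hd'⟩ := ae_abs_le_of_tendsto_one h1 (ε := ε * Real.Gamma (B + 1) / 2)
    (by positivity)
  refine ⟨max d (1 / 2), ⟨lt_max_of_lt_left hd.1, max_lt hd.2 (by norm_num)⟩, ?_⟩
  have hb' : ∀ᵐ x ∂unitVol, max d (1 / 2) < x →
      |x ^ (A - 1) * u x| ≤ ε * Real.Gamma (B + 1) := by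
    filter_upwards [hd', ae_unitVol_mem] with x hx hx1 hxd
    have hx2 : 1 / 2 < x := (le_max_right _ _).trans_lt hxd
    have h2 : x ^ (A - 1) ≤ 2 := by
      calc x ^ (A - 1) ≤ x ^ (-1 : ℝ) :=
            Real.rpow_le_rpow_of_exponent_ge hx1.1 hx1.2.le (by linarith [h.nonneg_left])
        _ = x⁻¹ := Real.rpow_neg_one x
        _ ≤ (1 / 2)⁻¹ := inv_anti₀ (by norm_num) hx2.le
        _ = 2 := by norm_num
    rw [abs_mul, abs_of_nonneg (Real.rpow_nonneg hx1.1.le _)]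
    calc x ^ (A - 1) * |u x| ≤ 2 * (ε * Real.Gamma (B + 1) / 2) :=
          mul_le_mul h2 (hx ((le_max_left _ _).trans_lt hxd)) (abs_nonneg _) (by norm_num)
      _ = _ := by ring
  filter_upwards [hb', ae_unitVol_mem] with b hb hb1 hbd
  have h3 := abs_fracRight_le hB (by positivity) hb1 (hb hbd)
    (hb'.mono fun s hs hbs => hs (hbd.trans hbs))
  rw [innerPotential, abs_mul, abs_of_nonneg (Real.rpow_nonneg hb1.1.le _)]
  refine (mul_le_of_le_one_left (abs_nonneg _) (Real.rpow_le_one hb1.1.le hb1.2.le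
    (by linarith [h.lt_one]))).trans (h3.trans_eq ?_)
  field_simp

theorem Admissible.fluxPotential_small_zero {A B r lam : ℝ} (h : Admissible A B r lam)
    {u : ℝ → ℝ} (hu : Integrable u unitVol) (h0 : Tendsto u (𝓝[>] 0 ⊓ ae volume) (𝓝 0))
    {ε : ℝ} (hε : 0 < ε) :
    ∃ δ ∈ Ioo (0 : ℝ) 1, ∀ᵐ b ∂unitVol, b < δ → |fluxPotential A B u b| ≤ ε := by
  have hA := h.nonneg_left
  have hG := Real.Gamma_pos_of_pos (show 0 < A + 1 by linarith)
  obtain ⟨d, hd, hd'⟩ := h.innerPotential_small_zero hu h0 (ε := ε * Real.Gamma (A + 1))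
    (by positivity)
  refine ⟨d, hd, ?_⟩
  filter_upwards [hd', ae_unitVol_mem] with b hb hb1 hbd
  have h3 := abs_fracLeft_le (c := 0) hA le_rfl (M := ε * Real.Gamma (A + 1)) (by positivity) hb1
    (by simpa using hb hbd)
    (hd'.mono fun s hs hbs => by simpa using hs (hbs.trans hbd))
  refine h3.trans ?_
  rw [div_le_iff₀ hG]
  exact mul_le_of_le_one_right (by positivity)
    (Real.rpow_le_one hb1.1.le hb1.2.le (by linarith))

/-! ### Uniqueness. -/

/-- Injectivity of the right Abel integral needs an integrable function, which `x^{A-1} u` need not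
be at `0`. Cutting it off below `1/(n+1)` does not change its right integral beyond that point, and
`n` is arbitrary. -/
theorem Admissible.ae_eq_zero_of_innerPotential {A B r lam : ℝ} (h : Admissible A B r lam)
    {u : ℝ → ℝ} (hu : Integrable u unitVol) (h0 : ∀ᵐ b ∂unitVol, innerPotential A B u b = 0) :
    ∀ᵐ x ∂unitVol, u x = 0 := by
  have key : ∀ n : ℕ, ∀ᵐ x ∂unitVol, 1 / ((n : ℝ) + 1) < x → u x = 0 := by
    intro n
    set d := 1 / ((n : ℝ) + 1) with hd
    have hd0 : 0 < d := by positivity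
    have hi : Integrable ((Ioi d).indicator fun x => x ^ (A - 1) * u x) unitVol := by
      refine Integrable.mono' (hu.norm.const_mul (d ^ (A - 1)))
        ((aestronglyMeasurable_rpow_mul hu.1 (A - 1)).indicator measurableSet_Ioi) ?_
      filter_upwards [ae_unitVol_mem] with x hx
      by_cases hxd : d < x
      · have hle : x ^ (A - 1) ≤ d ^ (A - 1) := Real.rpow_le_rpow_of_nonpos hd0 hxd.le
          (by linarith [h.lt_one, h.nonneg_right])
        simp only [mem_Ioi, hxd, indicator_of_mem, norm_mul,
          Real.norm_of_nonneg (Real.rpow_nonneg hx.1.le (A - 1))]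
        gcongr
      · simp only [mem_Ioi, hxd, not_false_eq_true, indicator_of_notMem, norm_zero]
        positivity
    have := fracRight_injective (c := d) h.nonneg_right
      (by linarith [h.lt_one, h.nonneg_left]) hi (integrable_zero ℝ ℝ unitVol) (by
        filter_upwards [h0, ae_unitVol_mem] with b hb hb1 hbd
        have hb2 : fracRight B (fun x => x ^ (A - 1) * u x) b = 0 :=
          (mul_eq_zero.1 hb).resolve_left (Real.rpow_pos_of_pos hb1.1 _).ne'
        have e1 : fracRight B ((Ioi d).indicator fun x => x ^ (A - 1) * u x) b =
            fracRight B (fun x => x ^ (A - 1) * u x) b := by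
          by_cases hB : B = 0
          · simp [fracRight, hB, hbd]
          · simp only [fracRight, hB, if_false]
            congr 1 with s
            by_cases hs : b < s
            · simp [hbd.trans hs]
            · simp [abelKernel, hs]
        rw [e1, hb2]
        by_cases hB : B = 0 <;> simp [fracRight, hB])
    filter_upwards [this, ae_unitVol_mem] with x hx hx1 hxd
    have h2 := hx hxd
    simp only [mem_Ioi, hxd, indicator_of_mem] at h2
    exact (mul_eq_zero.1 h2).resolve_left (Real.rpow_pos_of_pos hx1.1 _).ne'
  filter_upwards [ae_all_iff.2 key, ae_unitVol_mem] with x hx hx1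
  obtain ⟨n, hn⟩ := exists_nat_one_div_lt hx1.1
  exact hx n hn

/-- The flux `C / K` determines the potential of `u` up to the constants `C` and `D`; the limit at
`0` removes `D` and the limit at `1` removes `C`. -/
theorem Admissible.unique {A B r lam C Km KM : ℝ} (h : Admissible A B r lam)
    {u q K : ℝ → ℝ} (hu : Integrable u unitVol)
    (h0 : Tendsto u (𝓝[>] 0 ⊓ ae volume) (𝓝 0)) (h1 : Tendsto u (𝓝[<] 1 ⊓ ae volume) (𝓝 0))
    (hKm : 0 < Km) (hKmeas : AEMeasurable K unitVol)
    (hK : ∀ x ∈ Ioo (0 : ℝ) 1, Km ≤ K x ∧ K x ≤ KM)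
    (hq : ∀ᵐ x ∂unitVol, q x = C / K x)
    (hflux : ∀ φ : ℝ → ℝ, IsTest φ → ∫ x, q x * φ x ∂unitVol =
      r * derivPairing u (rightInt (A + B) φ) + (1 - r) * derivPairing u (leftInt (A + B) φ)) :
    ∀ᵐ x ∂unitVol, u x = 0 := by
  have hA := h.nonneg_left
  have hB := h.nonneg_right
  have hB1 : 0 < 1 - B := by linarith [h.lt_one]
  have hA1 : 0 < 1 - A := by linarith [h.lt_one]
  have hl := h.lam_pos
  have hGA := Real.Gamma_pos_of_pos hA1
  set k : ℝ → ℝ := fun s => s ^ (-B) / K s with hk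
  have hpow : Integrable (fun s : ℝ => s ^ (-B)) unitVol := by
    have := integrableOn_beta hB1 zero_lt_one
    simp only [sub_self, Real.rpow_zero, mul_one] at this
    rwa [show 1 - B - 1 = -B by ring] at this
  have hki : Integrable k unitVol := by
    refine Integrable.mono' (hpow.div_const Km)
      ((by fun_prop : Measurable fun s : ℝ => s ^ (-B)).aemeasurable.div
        hKmeas).aestronglyMeasurable ?_
    filter_upwards [ae_unitVol_mem] with s hs
    have h2 := hK s hs
    have h3 := Real.rpow_nonneg hs.1.le (-B)
    rw [hk, Real.norm_of_nonneg (div_nonneg h3 (hKm.le.trans h2.1))]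
    exact div_le_div_of_nonneg_left h3 hKm h2.1
  -- Testing the flux identity with `s^{-B} χ` cancels the weight `s^B`, so `lam W` and `C` times
  -- the primitive of `k` have the same distributional derivative.
  obtain ⟨D, hD⟩ := ae_eq_const_of_integral_mul_deriv_eq_zero
    (G := fun s => lam * fluxPotential A B u s - C * fracLeft 1 k s) (by
      refine IntegrableOn.locallyIntegrableOn ?_
      exact ((h.integrable_fluxPotential hu).const_mul lam).sub
        ((integrable_fracLeft zero_le_one hki).const_mul C)) (by
      intro χ hχ
      have hφ := hχ.mul_rpow (-B)
      have e : (fun s => s ^ B * (s ^ (-B) * χ s)) = χ := by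
        ext s
        by_cases hs : s ∈ Ioo (0 : ℝ) 1
        · rw [← mul_assoc, ← Real.rpow_add hs.1]; simp
        · simp [hχ.eq_zero hs]
      have h2 := hflux _ hφ
      rw [h.pairing_eq hu hφ, e] at h2
      have h3 := hχ.integral_primitive_mul_deriv hki
      have h4 : ∫ x, q x * (x ^ (-B) * χ x) ∂unitVol = C * ∫ s, k s * χ s ∂unitVol := by
        rw [← integral_const_mul]
        refine integral_congr_ae ?_
        filter_upwards [hq] with x hx
        rw [hx, hk]
        ring
      have i1 := (hχ.deriv.integrable_mul (G := fluxPotential A B u)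
        (IntegrableOn.locallyIntegrableOn (h.integrable_fluxPotential hu))).const_mul lam
      have i2 := (hχ.deriv.integrable_mul (G := fracLeft 1 k)
        (IntegrableOn.locallyIntegrableOn (integrable_fracLeft zero_le_one hki))).const_mul C
      have e2 : ∫ x, (lam * fluxPotential A B u x - C * fracLeft 1 k x) * deriv χ x ∂unitVol =
          ∫ x, (lam * (fluxPotential A B u x * deriv χ x) -
            C * (fracLeft 1 k x * deriv χ x)) ∂unitVol := by
        congr 1 with x; ring
      rw [e2, integral_sub i1 i2, integral_const_mul, integral_const_mul]
      rw [h3]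
      linarith)
  have hprim : ∀ x ∈ Ioo (0 : ℝ) 1, |fracLeft 1 k x| ≤ x ^ (1 - B) / (Km * (1 - B)) := by
    intro x hx
    have e : ∫ s in Ioo 0 x, s ^ (-B) = x ^ (1 - B) / (1 - B) := by
      have := integral_beta_Ioo hx.1 hB1 zero_lt_one
      simp only [sub_zero, sub_self, Real.rpow_zero, mul_one, Real.Gamma_one,
        add_sub_cancel_right] at this
      rw [Real.Gamma_add_one hB1.ne'] at this
      have hne := (Real.Gamma_pos_of_pos hB1).ne'
      rw [show (1 : ℝ) - B - 1 = -B by ring] at this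
      rw [this]
      field_simp
    rw [fracLeft_one hx.2.le]
    have hsub : Ioo 0 x ⊆ Ioo (0 : ℝ) 1 := Ioo_subset_Ioo_right hx.2.le
    have := norm_integral_le_of_norm_le (μ := volume.restrict (Ioo 0 x)) (f := k)
      (IntegrableOn.mono_set (hpow.div_const Km) hsub) (by
        filter_upwards [ae_restrict_mem measurableSet_Ioo] with s hs
        have h2 := hK s (hsub hs)
        have h3 := Real.rpow_nonneg hs.1.le (-B)
        rw [hk, Real.norm_of_nonneg (div_nonneg h3 (hKm.le.trans h2.1))]
        exact div_le_div_of_nonneg_left h3 hKm h2.1)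
    rw [integral_div, e] at this
    refine this.trans_eq ?_
    field_simp
  -- Near `0` both `lam W` and `C` times the primitive become smaller than `|D|/3`, so their
  -- difference cannot equal a nonzero `D`.
  have hD0 : D = 0 := by
    by_contra hne
    have hDp : 0 < |D| := abs_pos.2 hne
    obtain ⟨d, hd, hd'⟩ := h.fluxPotential_small_zero hu h0 (ε := |D| / (3 * lam)) (by positivity)
    have hlim : Tendsto (fun x : ℝ => |C| * (x ^ (1 - B) / (Km * (1 - B)))) (𝓝 0) (𝓝 0) := by
      have := (((Real.continuous_rpow_const hB1.le).tendsto 0).div_const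
        (Km * (1 - B))).const_mul |C|
      simpa [Real.zero_rpow hB1.ne'] using this
    obtain ⟨δ, hδ0, hδ⟩ := Metric.eventually_nhds_iff.1
      (hlim.eventually (gt_mem_nhds (show (0 : ℝ) < |D| / 3 by positivity)))
    obtain ⟨x, hx, hx1, hx2⟩ := exists_mem_Ioo_of_ae (hD.and hd') le_rfl (lt_min hδ0 hd.1)
      ((min_le_right _ _).trans hd.2.le)
    have hxd := hx.2.trans_le (min_le_right _ _)
    have hx01 : x ∈ Ioo (0 : ℝ) 1 := ⟨hx.1, hxd.trans hd.2⟩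
    have h2 := hx2 hxd
    have h3 := hδ (show dist x 0 < δ by
      simpa [abs_of_pos hx.1] using hx.2.trans_le (min_le_left _ _))
    have h4 : |C * fracLeft 1 k x| ≤ |C| * (x ^ (1 - B) / (Km * (1 - B))) := by
      rw [abs_mul]
      exact mul_le_mul_of_nonneg_left (hprim x hx01) (abs_nonneg _)
    have h5 : |lam * fluxPotential A B u x| ≤ |D| / 3 := by
      rw [abs_mul, abs_of_pos hl]
      calc lam * |fluxPotential A B u x| ≤ lam * (|D| / (3 * lam)) := by gcongr
        _ = |D| / 3 := by field_simp
    have h6 := abs_sub (lam * fluxPotential A B u x) (C * fracLeft 1 k x)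
    rw [hx1] at h6
    linarith
  have hkf : Integrable (fracLeft (1 - A) k) unitVol := integrable_fracLeft hA1.le hki
  -- Writing the primitive of `k` as `₀I^A ₀I^{1-A} k` allows `₀I^A` to be cancelled.
  have hU := fracLeft_injective (c := 1) hA (by linarith) (h.integrable_innerPotential hu)
    (hkf.const_mul (C / lam)) (by
      filter_upwards [hD, ae_unitVol_mem] with x hx hx1 _
      rw [fracLeft_const_mul, fracLeft_fracLeft hA hA1.le (by ring) hx1.2.le hki, ← fracLeft_one hx1.2.le]
      rw [hD0] at hx
      have : lam * fluxPotential A B u x = C * fracLeft 1 k x := by linarith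
      change fluxPotential A B u x = _
      field_simp
      linarith)
  have hKM : 0 < KM := by
    have := hK (1 / 2) (by norm_num)
    linarith
  -- Both powers in the integrand are at least `1`, `1/K ≥ 1/KM`, and the interval `(0,x)` has
  -- length at least `1/2`.
  have hlow : ∀ x ∈ Ioo (1 / 2 : ℝ) 1, 1 / (2 * KM * Real.Gamma (1 - A)) ≤
      fracLeft (1 - A) k x := by
    intro x hx
    have hx01 : x ∈ Ioo (0 : ℝ) 1 := ⟨by linarith [hx.1], hx.2⟩
    have hint : IntegrableOn (fun s => (x - s) ^ (1 - A - 1) / Real.Gamma (1 - A) * k s)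
        (Ioo 0 x) := by
      rw [← integrable_abelKernel_mul_iff hx.2.le]
      have hb : Integrable (fun s => abelKernel (1 - A) x s * s ^ (-B)) unitVol :=
        integrable_abelKernel_mul_rpow hA1 (by linarith) hx.2.le
      refine Integrable.mono' (hb.div_const Km)
        ((measurable_abelKernel_left _ _).aestronglyMeasurable.mul hki.1) ?_
      filter_upwards [ae_unitVol_mem] with s hs
      have h2 := hK s hs
      have h3 := Real.rpow_nonneg hs.1.le (-B)
      have h4 := abelKernel_nonneg hA1 x s
      rw [hk, norm_mul, Real.norm_of_nonneg h4,
        Real.norm_of_nonneg (div_nonneg h3 (hKm.le.trans h2.1)), mul_div_assoc]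
      exact mul_le_mul_of_nonneg_left (div_le_div_of_nonneg_left h3 hKm h2.1) h4
    rw [fracLeft_of_pos hA1, integral_abelKernel_mul hx.2.le]
    have h2 : ∫ s in Ioo 0 x, 1 / (KM * Real.Gamma (1 - A)) ≤
        ∫ s in Ioo 0 x, (x - s) ^ (1 - A - 1) / Real.Gamma (1 - A) * k s := by
      refine setIntegral_mono_on (integrableOn_const (by simp)) hint measurableSet_Ioo fun s hs => ?_
      have hs01 : s ∈ Ioo (0 : ℝ) 1 := ⟨hs.1, hs.2.trans hx.2⟩
      have h3 : 1 ≤ (x - s) ^ (1 - A - 1) :=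
        Real.one_le_rpow_of_pos_of_le_one_of_nonpos (by linarith [hs.2])
          (by linarith [hs.1, hx.2]) (by linarith)
      have h4 : 1 ≤ s ^ (-B) :=
        Real.one_le_rpow_of_pos_of_le_one_of_nonpos hs.1 hs01.2.le (by linarith)
      have h5 := hK s hs01
      have h6 : 0 < K s := hKm.trans_le h5.1
      have h7 : 1 / KM ≤ k s := by
        rw [hk]
        exact div_le_div₀ (by linarith) h4 h6 h5.2
      have h8 : 1 / Real.Gamma (1 - A) ≤ (x - s) ^ (1 - A - 1) / Real.Gamma (1 - A) := by
        gcongr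
      calc 1 / (KM * Real.Gamma (1 - A)) = 1 / Real.Gamma (1 - A) * (1 / KM) := by field_simp
        _ ≤ _ := mul_le_mul h8 h7 (by positivity) (by positivity)
    refine le_trans ?_ h2
    simp only [integral_const, MeasurableSet.univ, measureReal_restrict_apply, univ_inter,
      Real.volume_real_Ioo_of_le hx01.1.le, sub_zero, smul_eq_mul]
    rw [show 1 / (2 * KM * Real.Gamma (1 - A)) = 1 / 2 * (1 / (KM * Real.Gamma (1 - A))) by
      field_simp]
    gcongr
    exact hx.1.le
  have hC0 : C = 0 := by
    by_contra hne
    have hCp : 0 < |C| := abs_pos.2 hne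
    set m := |C| / lam * (1 / (2 * KM * Real.Gamma (1 - A))) with hm
    have hm0 : 0 < m := by positivity
    obtain ⟨d, hd, hd'⟩ := h.innerPotential_small_one h1 (ε := m / 2) (by positivity)
    obtain ⟨x, hx, hx1, hx2⟩ := exists_mem_Ioo_of_ae (hU.and hd') (a := max d (1 / 2)) (b := 1)
      (le_max_of_le_left hd.1.le) (max_lt hd.2 (by norm_num)) le_rfl
    have h2 := hx2 ((le_max_left _ _).trans_lt hx.1)
    rw [hx1 hx.2, abs_mul, abs_div, abs_of_pos hl] at h2
    have h3 := hlow x ⟨(le_max_right _ _).trans_lt hx.1, hx.2⟩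
    have h4 : m ≤ |C| / lam * |fracLeft (1 - A) k x| :=
      mul_le_mul_of_nonneg_left (h3.trans (le_abs_self _)) (by positivity)
    linarith
  refine h.ae_eq_zero_of_innerPotential hu ?_
  filter_upwards [hU, ae_unitVol_mem] with x hx hx1
  simpa [hC0] using hx hx1.2

/-! ### Hölder estimates for weighted fractional integrals. -/

/-- With `z = x/y` the claim reduces to `1 - z^{1-a} ≤ 1 - z ≤ (1 - z)^η`, followed by replacing the
denominator `y` by the smaller `x`. -/
theorem rpow_sub_rpow_le {a η x y : ℝ} (ha0 : 0 ≤ a) (ha1 : a ≤ 1) (hη0 : 0 ≤ η) (hη1 : η ≤ 1)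
    (hx : 0 < x) (hxy : x < y) :
    |y ^ (a - 1) - x ^ (a - 1)| ≤ (y - x) ^ η * x ^ (a - 1 - η) := by
  have hy : 0 < y := hx.trans hxy
  have hmono : y ^ (a - 1) ≤ x ^ (a - 1) :=
    Real.rpow_le_rpow_of_nonpos hx hxy.le (by linarith)
  rw [abs_sub_comm, abs_of_nonneg (sub_nonneg.2 hmono)]
  have hz0 : 0 < x / y := by positivity
  have hz1 : x / y ≤ 1 := by rw [div_le_one hy]; exact hxy.le
  have h1 : x / y ≤ (x / y) ^ (1 - a) := by
    conv_lhs => rw [← Real.rpow_one (x / y)]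
    exact Real.rpow_le_rpow_of_exponent_ge hz0 hz1 (by linarith)
  have e1 : y ^ (a - 1) = x ^ (a - 1) * (x / y) ^ (1 - a) := by
    rw [Real.div_rpow hx.le hy.le, ← mul_div_assoc, ← Real.rpow_add hx,
      show a - 1 = -(1 - a) by ring, Real.rpow_neg hy.le]
    simp
  have h2 : (y - x) / y ≤ ((y - x) / y) ^ η := by
    have h3 : 0 < (y - x) / y := div_pos (by linarith) hy
    conv_lhs => rw [← Real.rpow_one ((y - x) / y)]
    exact Real.rpow_le_rpow_of_exponent_ge h3 (by rw [div_le_one hy]; linarith) hη1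
  have h4 : ((y - x) / y) ^ η ≤ ((y - x) / x) ^ η := by
    refine Real.rpow_le_rpow (div_nonneg (by linarith) hy.le) ?_ hη0
    exact div_le_div_of_nonneg_left (by linarith) hx hxy.le
  have e2 : ((y - x) / x) ^ η = (y - x) ^ η * x ^ (-η) := by
    rw [Real.div_rpow (by linarith) hx.le, Real.rpow_neg hx.le, div_eq_mul_inv]
  have e3 : 1 - x / y = (y - x) / y := by field_simp
  have hxp := Real.rpow_nonneg hx.le (a - 1)
  calc x ^ (a - 1) - y ^ (a - 1) = x ^ (a - 1) * (1 - (x / y) ^ (1 - a)) := by rw [e1]; ring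
    _ ≤ x ^ (a - 1) * ((y - x) ^ η * x ^ (-η)) := by
        refine mul_le_mul_of_nonneg_left ?_ hxp
        rw [← e2]
        linarith
    _ = (y - x) ^ η * x ^ (a - 1 - η) := by
        rw [sub_eq_add_neg (a - 1) η, Real.rpow_add hx]; ring

/-- Hölder exponent `η` is traded for `η` orders of the kernel. Between `b` and `b'` only one kernel
is nonzero, and there `b' - s ≤ b' - b`. -/
theorem abs_abelKernel_sub_le {a η b b' s : ℝ} (ha0 : 0 < a) (ha1 : a ≤ 1) (hη0 : 0 ≤ η)
    (hηa : η < a) (hb : b < b') :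
    |abelKernel a b' s - abelKernel a b s| ≤ (b' - b) ^ η *
      (Real.Gamma (a - η) / Real.Gamma a * (abelKernel (a - η) b s + abelKernel (a - η) b' s)) := by
  have hG := Real.Gamma_pos_of_pos ha0
  have hG' := Real.Gamma_pos_of_pos (sub_pos.2 hηa)
  have hd : 0 ≤ (b' - b) ^ η := Real.rpow_nonneg (by linarith) _
  rcases lt_or_ge s b with hsb | hsb
  · have hsb' : s < b' := hsb.trans hb
    have h1 := rpow_sub_rpow_le ha0.le ha1 hη0 (hηa.le.trans ha1) (sub_pos.2 hsb)
      (show b - s < b' - s by linarith)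
    have h2 : 0 ≤ (b' - s) ^ (a - η - 1) := Real.rpow_nonneg (by linarith) _
    simp only [abelKernel, hsb, hsb', if_true]
    rw [← sub_div, abs_div, abs_of_pos hG]
    rw [show b' - s - (b - s) = b' - b by ring, show a - 1 - η = a - η - 1 by ring] at h1
    calc _ ≤ (b' - b) ^ η * (b - s) ^ (a - η - 1) / Real.Gamma a := by gcongr
      _ ≤ (b' - b) ^ η * ((b - s) ^ (a - η - 1) + (b' - s) ^ (a - η - 1)) / Real.Gamma a := by
          gcongr; linarith
      _ = _ := by field_simp
  · rcases lt_or_ge s b' with hsb' | hsb'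
    · have h0 : 0 < b' - s := sub_pos.2 hsb'
      simp only [abelKernel, hsb.not_gt, hsb', if_true, if_false, sub_zero, zero_add]
      rw [abs_of_nonneg (div_nonneg (Real.rpow_nonneg h0.le _) hG.le)]
      have e : (b' - s) ^ (a - 1) = (b' - s) ^ η * (b' - s) ^ (a - η - 1) := by
        rw [← Real.rpow_add h0]; congr 1; ring
      have h3 : (b' - s) ^ η ≤ (b' - b) ^ η := Real.rpow_le_rpow h0.le (by linarith) hη0
      have h4 := Real.rpow_nonneg h0.le (a - η - 1)
      calc (b' - s) ^ (a - 1) / Real.Gamma a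
          ≤ (b' - b) ^ η * (b' - s) ^ (a - η - 1) / Real.Gamma a := by rw [e]; gcongr
        _ = _ := by field_simp
    · simp [abelKernel, hsb.not_gt, hsb'.not_gt]

/-- As `b ≤ 1`, the singularity `(1-s)^{-e}` is at most `(b-s)^{-e}` and merges with the kernel into
one Beta integral. The bound holds up to and including `b = 1`. -/
theorem abelKernel_mul_bound {a d e M b : ℝ} (ha : 0 < a) (hea : e < a) (he : 0 ≤ e) (hd : d < 1)
    {p : ℝ → ℝ} (hp : AEStronglyMeasurable p unitVol)
    (hle : ∀ s ∈ Ioo (0 : ℝ) 1, |p s| ≤ M * (s ^ (-d) * (1 - s) ^ (-e))) (hM : 0 ≤ M)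
    (hb : b ∈ Ioc (0 : ℝ) 1) :
    Integrable (fun s => abelKernel a b s * |p s|) unitVol ∧
    ∫ s, abelKernel a b s * |p s| ∂unitVol ≤
      M * (Real.Gamma (1 - d) * Real.Gamma (a - e) / Real.Gamma (1 - d + (a - e)) /
        Real.Gamma a) * b ^ (a - d - e) := by
  have hG := Real.Gamma_pos_of_pos ha
  have hbeta := integrableOn_beta_Ioo (a := 0) (x := b) (p := 1 - d) (q := a - e)
    (by linarith) (by linarith)
  have hval := integral_beta_Ioo (a := 0) (x := b) (p := 1 - d) (q := a - e) hb.1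
    (by linarith) (by linarith)
  simp only [sub_zero] at hbeta hval
  have hsub : Ioo 0 b ⊆ Ioo (0 : ℝ) 1 := Ioo_subset_Ioo_right hb.2
  have hbound : ∀ s ∈ Ioo 0 b, (b - s) ^ (a - 1) / Real.Gamma a * |p s| ≤
      M / Real.Gamma a * (s ^ (1 - d - 1) * (b - s) ^ (a - e - 1)) := by
    intro s hs
    have h1 := hle s (hsub hs)
    have h0 : 0 < b - s := sub_pos.2 hs.2
    have h2 : (1 - s) ^ (-e) ≤ (b - s) ^ (-e) :=
      Real.rpow_le_rpow_of_nonpos h0 (by linarith [hb.2]) (by linarith)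
    have h3 := Real.rpow_nonneg hs.1.le (-d)
    have h4 := Real.rpow_nonneg h0.le (a - 1)
    have e1 : (b - s) ^ (a - e - 1) = (b - s) ^ (a - 1) * (b - s) ^ (-e) := by
      rw [← Real.rpow_add h0]; congr 1; ring
    calc (b - s) ^ (a - 1) / Real.Gamma a * |p s|
        ≤ (b - s) ^ (a - 1) / Real.Gamma a * (M * (s ^ (-d) * (b - s) ^ (-e))) := by
          gcongr
          exact h1.trans (by gcongr)
      _ = _ := by
          rw [e1, show 1 - d - 1 = -d by ring]; ring
  have hint : IntegrableOn (fun s => (b - s) ^ (a - 1) / Real.Gamma a * |p s|) (Ioo 0 b) := by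
    refine Integrable.mono' (hbeta.const_mul (M / Real.Gamma a)) ?_ ?_
    · have hm : Measurable fun s : ℝ => (b - s) ^ (a - 1) / Real.Gamma a := by fun_prop
      exact hm.aestronglyMeasurable.mul (hp.mono_measure
        (Measure.restrict_mono hsub le_rfl)).norm
    · filter_upwards [ae_restrict_mem measurableSet_Ioo] with s hs
      rw [Real.norm_of_nonneg (mul_nonneg (div_nonneg (Real.rpow_nonneg
        (sub_pos.2 hs.2).le _) hG.le) (abs_nonneg _))]
      exact hbound s hs
  refine ⟨(integrable_abelKernel_mul_iff hb.2 _).2 hint, ?_⟩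
  rw [integral_abelKernel_mul hb.2]
  refine (setIntegral_mono_on hint (hbeta.const_mul _) measurableSet_Ioo hbound).trans_eq ?_
  rw [integral_const_mul, hval, show 1 - d + (a - e) - 1 = a - d - e by ring]
  field_simp

/-- Weighted Hölder continuity of the Erdélyi–Kober integral `b^{c-1} ₀I_b^a p`. -/
theorem exists_holder_const {a c d e η M : ℝ} (ha1 : a ≤ 1) (hc0 : 0 ≤ c) (hc1 : c ≤ 1)
    (he : 0 ≤ e) (hd : d < 1) (hη : 0 < η) (hηa : η + e < a) (hacd : c + a = 1 + d - e)
    {p : ℝ → ℝ} (hp : AEStronglyMeasurable p unitVol)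
    (hle : ∀ s ∈ Ioo (0 : ℝ) 1, |p s| ≤ M * (s ^ (-d) * (1 - s) ^ (-e))) (hM : 0 ≤ M) :
    ∃ H, 0 ≤ H ∧ ∀ b b', 0 < b → b < b' → b' ≤ 1 →
      |b' ^ (c - 1) * fracLeft a p b' - b ^ (c - 1) * fracLeft a p b| ≤
        H * (b' - b) ^ η * b ^ (-(η + 2 * e)) := by
  have ha0 : 0 < a := by linarith
  have hG := Real.Gamma_pos_of_pos ha0
  have hG' := Real.Gamma_pos_of_pos (show 0 < a - η by linarith)
  have hg1 := Real.Gamma_pos_of_pos (show 0 < 1 - d by linarith)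
  have hg2 := Real.Gamma_pos_of_pos (show 0 < a - e by linarith)
  have hg3 := Real.Gamma_pos_of_pos (show 0 < a - η - e by linarith)
  have hg4 := Real.Gamma_pos_of_pos (show 0 < 1 - d + (a - e) by linarith)
  have hg5 := Real.Gamma_pos_of_pos (show 0 < 1 - d + (a - η - e) by linarith)
  set c₀ := Real.Gamma (1 - d) * Real.Gamma (a - e) / Real.Gamma (1 - d + (a - e)) /
    Real.Gamma a with hc₀
  set c₁ := Real.Gamma (1 - d) * Real.Gamma (a - η - e) / Real.Gamma (1 - d + (a - η - e)) /
    Real.Gamma (a - η) with hc₁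
  have hc₀0 : 0 ≤ c₀ := by positivity
  have hc₁0 : 0 ≤ c₁ := by positivity
  -- The first summand comes from the increment of the fractional integral (one kernel at each of
  -- `b`, `b'`), the second from that of the power `b^{c-1}`.
  refine ⟨2 * (Real.Gamma (a - η) / Real.Gamma a * (M * c₁)) + M * c₀, by positivity, ?_⟩
  intro b b' hb hbb hb'
  have hb'0 : 0 < b' := hb.trans hbb
  have m0 : b ∈ Ioc (0 : ℝ) 1 := ⟨hb, hbb.le.trans hb'⟩
  have m1 : b' ∈ Ioc (0 : ℝ) 1 := ⟨hb'0, hb'⟩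
  obtain ⟨i0, j0⟩ := abelKernel_mul_bound (a := a) ha0 (by linarith) he hd hp hle hM m0
  obtain ⟨i1, -⟩ := abelKernel_mul_bound (a := a) ha0 (by linarith) he hd hp hle hM m1
  obtain ⟨i2, j2⟩ := abelKernel_mul_bound (a := a - η) (by linarith) (by linarith) he hd hp hle hM m0
  obtain ⟨i3, j3⟩ := abelKernel_mul_bound (a := a - η) (by linarith) (by linarith) he hd hp hle hM m1
  rw [← hc₀] at j0
  rw [← hc₁] at j2 j3
  have habs : ∀ {x : ℝ}, Integrable (fun s => abelKernel a x s * |p s|) unitVol →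
      Integrable (fun s => abelKernel a x s * p s) unitVol := fun {x} hi => by
    refine Integrable.mono' hi ((measurable_abelKernel_left a x).aestronglyMeasurable.mul hp) ?_
    refine Eventually.of_forall fun s => ?_
    rw [norm_mul, Real.norm_of_nonneg (abelKernel_nonneg ha0 x s), Real.norm_eq_abs]
  have hdη : 0 ≤ (b' - b) ^ η := Real.rpow_nonneg (by linarith) _
  have hR : |fracLeft a p b| ≤ M * c₀ * b ^ (a - d - e) := by
    rw [fracLeft_of_pos ha0]
    refine (norm_integral_le_of_norm_le (f := fun s => abelKernel a b s * p s) i0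
      (Eventually.of_forall fun s => ?_)).trans j0
    rw [norm_mul, Real.norm_of_nonneg (abelKernel_nonneg ha0 b s), Real.norm_eq_abs]
  have hdiff : |fracLeft a p b' - fracLeft a p b| ≤ (b' - b) ^ η *
      (Real.Gamma (a - η) / Real.Gamma a *
        (M * c₁ * b ^ (a - η - d - e) + M * c₁ * b' ^ (a - η - d - e))) := by
    rw [fracLeft_of_pos ha0, fracLeft_of_pos ha0, ← integral_sub (habs i1) (habs i0)]
    have h1 := norm_integral_le_of_norm_le (μ := unitVol)
      (f := fun s => abelKernel a b' s * p s - abelKernel a b s * p s)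
      (((i2.add i3).const_mul (Real.Gamma (a - η) / Real.Gamma a)).const_mul ((b' - b) ^ η))
      (Eventually.of_forall fun s => by
        rw [← sub_mul, norm_mul, Real.norm_eq_abs, Real.norm_eq_abs]
        have := mul_le_mul_of_nonneg_right (abs_abelKernel_sub_le (s := s) ha0 ha1 hη.le
          (by linarith) hbb) (abs_nonneg (p s))
        refine this.trans_eq ?_
        simp only [Pi.add_apply]
        ring)
    refine h1.trans ?_
    rw [integral_const_mul, integral_const_mul, integral_add' i2 i3]
    gcongr
  have hw := rpow_sub_rpow_le hc0 hc1 hη.le (show η ≤ 1 by linarith) hb hbb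
  have hbc : b' ^ (c - 1) ≤ b ^ (c - 1) := Real.rpow_le_rpow_of_nonpos hb hbb.le (by linarith)
  have hbc0 := Real.rpow_nonneg hb'0.le (c - 1)
  -- By `hacd` the total degree is `c - 1 + a - η - d - e = -(η + 2e)`; the same count is behind
  -- `k2` and `k3`.
  have k1 : b' ^ (c - 1) * b ^ (a - η - d - e) ≤ b ^ (-(η + 2 * e)) := by
    calc b' ^ (c - 1) * b ^ (a - η - d - e) ≤ b ^ (c - 1) * b ^ (a - η - d - e) := by gcongr
      _ = b ^ (-(η + 2 * e)) := by
        rw [← Real.rpow_add hb]; congr 1; linarith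
  have k2 : b' ^ (c - 1) * b' ^ (a - η - d - e) ≤ b ^ (-(η + 2 * e)) := by
    rw [← Real.rpow_add hb'0, show c - 1 + (a - η - d - e) = -(η + 2 * e) by linarith]
    exact Real.rpow_le_rpow_of_nonpos hb hbb.le (by linarith)
  have k3 : b ^ (c - 1 - η) * b ^ (a - d - e) = b ^ (-(η + 2 * e)) := by
    rw [← Real.rpow_add hb]; congr 1; linarith
  have t1 : |b' ^ (c - 1) * (fracLeft a p b' - fracLeft a p b)| ≤
      2 * (Real.Gamma (a - η) / Real.Gamma a * (M * c₁)) * (b' - b) ^ η *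
        b ^ (-(η + 2 * e)) := by
    rw [abs_mul, abs_of_nonneg hbc0]
    calc _ ≤ b' ^ (c - 1) * ((b' - b) ^ η * (Real.Gamma (a - η) / Real.Gamma a *
          (M * c₁ * b ^ (a - η - d - e) + M * c₁ * b' ^ (a - η - d - e)))) := by gcongr
      _ = (b' - b) ^ η * (Real.Gamma (a - η) / Real.Gamma a * (M * c₁)) *
          (b' ^ (c - 1) * b ^ (a - η - d - e) + b' ^ (c - 1) * b' ^ (a - η - d - e)) := by ring
      _ ≤ (b' - b) ^ η * (Real.Gamma (a - η) / Real.Gamma a * (M * c₁)) *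
          (b ^ (-(η + 2 * e)) + b ^ (-(η + 2 * e))) := by gcongr
      _ = _ := by ring
  have t2 : |(b' ^ (c - 1) - b ^ (c - 1)) * fracLeft a p b| ≤
      M * c₀ * (b' - b) ^ η * b ^ (-(η + 2 * e)) := by
    rw [abs_mul]
    calc _ ≤ ((b' - b) ^ η * b ^ (c - 1 - η)) * (M * c₀ * b ^ (a - d - e)) :=
          mul_le_mul hw hR (abs_nonneg _)
            (mul_nonneg hdη (Real.rpow_nonneg hb.le _))
      _ = M * c₀ * (b' - b) ^ η * (b ^ (c - 1 - η) * b ^ (a - d - e)) := by ring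
      _ = _ := by rw [k3]
  calc _ = |b' ^ (c - 1) * (fracLeft a p b' - fracLeft a p b) +
        (b' ^ (c - 1) - b ^ (c - 1)) * fracLeft a p b| := by congr 1; ring
    _ ≤ _ := (abs_add_le _ _).trans (add_le_add t1 t2)
    _ = _ := by ring

/-! ### The Marchaud derivative and the right Abel equation. -/

theorem fracRight_fracRight {a b x : ℝ} (ha : 0 ≤ a) (hb : 0 ≤ b) (hab : a + b = 1)
    (hx : x ∈ Ioo (0 : ℝ) 1) {h : ℝ → ℝ} (hh : Integrable h unitVol) :
    fracRight a (fracRight b h) x = ∫ s in Ioo x 1, h s := by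
  have hx' := one_sub_mem_Ioo hx
  have e : (fun s => fracRight b h (1 - s)) = fracLeft b fun s => h (1 - s) := by
    ext s; rw [fracRight_eq_fracLeft, sub_sub_cancel]
  rw [fracRight_eq_fracLeft, e,
    fracLeft_fracLeft ha hb hab hx'.2.le (integrable_one_sub hh),
    ← integral_Ioc_eq_integral_Ioo, ← integral_Ioc_eq_integral_Ioo,
    ← intervalIntegral.integral_of_le hx'.1.le, ← intervalIntegral.integral_of_le hx.2.le]
  simp

theorem integrable_fracRight {a : ℝ} (ha : 0 ≤ a) {h : ℝ → ℝ} (hh : Integrable h unitVol) :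
    Integrable (fracRight a h) unitVol := by
  have := integrable_one_sub (integrable_fracLeft ha (integrable_one_sub hh))
  refine this.congr (Eventually.of_forall fun x => ?_)
  exact (fracRight_eq_fracLeft a h x).symm

/-- Weighted Hölder functions on `(0,1)` that vanish at `1`, extended by zero. -/
structure IsHolderVanishing (Q : ℝ → ℝ) (H η δ : ℝ) : Prop where
  nonneg : 0 ≤ H
  eq_zero : ∀ x ∉ Ioo (0 : ℝ) 1, Q x = 0
  holder : ∀ b b', 0 < b → b < b' → b' ≤ 1 → |Q b' - Q b| ≤ H * (b' - b) ^ η * b ^ (-δ)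

namespace IsHolderVanishing

variable {Q : ℝ → ℝ} {H η δ B : ℝ}

theorem abs_le (h : IsHolderVanishing Q H η δ) {x : ℝ} (hx : x ∈ Ioo (0 : ℝ) 1) :
    |Q x| ≤ H * (1 - x) ^ η * x ^ (-δ) := by
  have := h.holder x 1 hx.1 hx.2 le_rfl
  rwa [h.eq_zero 1 (by simp), zero_sub, abs_neg] at this

/-- Since `Q` is zero from `1` on, an increment past the endpoint equals the increment up to `1`;
hence the minimum, which makes the Marchaud integrand integrable at infinity. -/
theorem abs_sub_le (h : IsHolderVanishing Q H η δ) {x y : ℝ}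
    (hx : x ∈ Ioo (0 : ℝ) 1) (hy : 0 < y) :
    |Q x - Q (x + y)| ≤ H * (min y (1 - x)) ^ η * x ^ (-δ) := by
  rcases le_or_gt (x + y) 1 with hxy | hxy
  · have := h.holder x (x + y) hx.1 (by linarith) hxy
    rw [min_eq_left (by linarith), abs_sub_comm]
    simpa using this
  · rw [min_eq_right (by linarith), h.eq_zero (x + y) (fun h' => by linarith [h'.2]), sub_zero]
    exact h.abs_le hx

theorem continuousOn (h : IsHolderVanishing Q H η δ) (hη : 0 < η) (hδ : 0 ≤ δ) :
    ContinuousOn Q (Ioo 0 1) := by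
  intro x hx
  refine ContinuousAt.continuousWithinAt ?_
  have hx2 : 0 < x / 2 := by linarith [hx.1]
  have hlim : Tendsto (fun y => H * |y - x| ^ η * (x / 2) ^ (-δ)) (𝓝 x) (𝓝 0) := by
    have h1 : Continuous fun y : ℝ => H * |y - x| ^ η * (x / 2) ^ (-δ) := by
      have : Continuous fun y : ℝ => |y - x| ^ η :=
        (continuous_abs.comp (continuous_id.sub continuous_const)).rpow_const
          fun _ => Or.inr hη.le
      fun_prop
    have := h1.tendsto x
    simpa [Real.zero_rpow hη.ne'] using this
  rw [ContinuousAt, tendsto_iff_norm_sub_tendsto_zero]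
  refine squeeze_zero' (Eventually.of_forall fun _ => norm_nonneg _) ?_ hlim
  filter_upwards [Ioo_mem_nhds (show x / 2 < x by linarith [hx.1]) hx.2] with y hy
  have hpow : ∀ z, x / 2 ≤ z → z ^ (-δ) ≤ (x / 2) ^ (-δ) := fun z hz =>
    Real.rpow_le_rpow_of_nonpos hx2 hz (by linarith)
  rw [Real.norm_eq_abs]
  have hH := h.nonneg
  rcases lt_trichotomy y x with hyx | rfl | hyx
  · have := h.holder y x (by linarith [hy.1]) hyx hx.2.le
    rw [abs_sub_comm, abs_sub_comm y x, abs_of_pos (sub_pos.2 hyx)]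
    have h0 := Real.rpow_nonneg (sub_pos.2 hyx).le η
    exact this.trans (mul_le_mul_of_nonneg_left (hpow y hy.1.le) (by positivity))
  · simp only [sub_self, abs_zero]
    positivity
  · have := h.holder x y hx.1 hyx hy.2.le
    rw [abs_of_pos (sub_pos.2 hyx)]
    have h0 := Real.rpow_nonneg (sub_pos.2 hyx).le η
    exact this.trans (mul_le_mul_of_nonneg_left (hpow x (by linarith [hx.1])) (by positivity))

theorem measurable (h : IsHolderVanishing Q H η δ) (hη : 0 < η) (hδ : 0 ≤ δ) : Measurable Q := by
  have e : Q = (Ioo (0 : ℝ) 1).piecewise Q fun _ => 0 := by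
    ext x
    by_cases hx : x ∈ Ioo (0 : ℝ) 1
    · simp [hx]
    · rw [piecewise_eq_of_notMem _ _ _ hx, h.eq_zero x hx]
  rw [e]
  exact (h.continuousOn hη hδ).measurable_piecewise continuousOn_const measurableSet_Ioo

theorem integrable (h : IsHolderVanishing Q H η δ) (hη : 0 < η) (hδ : 0 ≤ δ) (hδ1 : δ < 1) :
    Integrable Q := by
  have hi : IntegrableOn Q (Ioo 0 1) := by
    have hb := integrableOn_beta (p := 1 - δ) (q := η + 1) (by linarith) (by linarith)
    refine Integrable.mono' (hb.const_mul H) (h.measurable hη hδ).aestronglyMeasurable ?_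
    filter_upwards [ae_unitVol_mem] with x hx
    refine (h.abs_le hx).trans_eq ?_
    rw [show 1 - δ - 1 = -δ by ring, add_sub_cancel_right]
    ring
  rw [← integrableOn_univ]
  exact IntegrableOn.of_forall_sdiff_eq_zero hi MeasurableSet.univ fun x hx => h.eq_zero x hx.2

/-- The dominating function of the Marchaud integral. -/
theorem integral_min_rpow (hB : 0 < B) (hBη : B < η) {m : ℝ} (hm : 0 < m) :
    IntegrableOn (fun y => (min y m) ^ η * y ^ (-1 - B)) (Ioi 0) ∧
    ∫ y in Ioi 0, (min y m) ^ η * y ^ (-1 - B) = m ^ (η - B) * (1 / (η - B) + 1 / B) := by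
  have e1 : ∀ y ∈ Ioc 0 m, (min y m) ^ η * y ^ (-1 - B) = y ^ (η - B - 1) := fun y hy => by
    rw [min_eq_left hy.2, ← Real.rpow_add hy.1]; congr 1; ring
  have e2 : ∀ y ∈ Ioi m, (min y m) ^ η * y ^ (-1 - B) = m ^ η * y ^ (-1 - B) := fun y hy => by
    rw [min_eq_right (le_of_lt hy)]
  have i1 : IntegrableOn (fun y : ℝ => y ^ (η - B - 1)) (Ioc 0 m) := by
    rw [← intervalIntegrable_iff_integrableOn_Ioc_of_le hm.le]
    exact intervalIntegral.intervalIntegrable_rpow' (by linarith)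
  have i2 : IntegrableOn (fun y : ℝ => m ^ η * y ^ (-1 - B)) (Ioi m) :=
    (integrableOn_Ioi_rpow_of_lt (by linarith) hm).const_mul _
  have i1' := i1.congr_fun (fun y hy => (e1 y hy).symm) measurableSet_Ioc
  have i2' := i2.congr_fun (fun y hy => (e2 y hy).symm) measurableSet_Ioi
  rw [← Ioc_union_Ioi_eq_Ioi hm.le]
  refine ⟨i1'.union i2', ?_⟩
  rw [setIntegral_union (Set.disjoint_left.2 fun x (hx : x ∈ Ioc 0 m) (hx' : x ∈ Ioi m) =>
    not_lt.2 hx.2 hx') measurableSet_Ioi i1' i2', setIntegral_congr_fun measurableSet_Ioc e1, setIntegral_congr_fun measurableSet_Ioi e2,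
    integral_const_mul, integral_Ioi_rpow_of_lt (by linarith) hm,
    ← intervalIntegral.integral_of_le hm.le, integral_rpow (Or.inl (by linarith))]
  rw [show η - B - 1 + 1 = η - B by ring, show -1 - B + 1 = -B by ring,
    Real.zero_rpow (by linarith)]
  have : m ^ (η - B) = m ^ η * m ^ (-B) := by rw [← Real.rpow_add hm]; rfl
  have hB0 := hB.ne'
  rw [this]
  have hne : η - B ≠ 0 := by linarith
  field_simp
  ring

/-- The Marchaud derivative of order `B`. -/
noncomputable def marchaud (B : ℝ) (Q : ℝ → ℝ) (x : ℝ) : ℝ :=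
  B / Real.Gamma (1 - B) * ∫ y in Ioi 0, (Q x - Q (x + y)) * y ^ (-1 - B)

theorem measurable_integrand (h : IsHolderVanishing Q H η δ) (hη : 0 < η) (hδ : 0 ≤ δ) :
    Measurable fun z : ℝ × ℝ => (Q z.1 - Q (z.1 + z.2)) * z.2 ^ (-1 - B) := by
  have := h.measurable hη hδ
  fun_prop

theorem norm_integrand_le (h : IsHolderVanishing Q H η δ) {x y : ℝ}
    (hx : x ∈ Ioo (0 : ℝ) 1) (hy : 0 < y) :
    ‖(Q x - Q (x + y)) * y ^ (-1 - B)‖ ≤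
      H * x ^ (-δ) * ((min y (1 - x)) ^ η * y ^ (-1 - B)) := by
  have h1 := h.abs_sub_le hx hy
  have h2 := Real.rpow_nonneg hy.le (-1 - B)
  rw [norm_mul, Real.norm_eq_abs, Real.norm_of_nonneg h2]
  refine (mul_le_mul_of_nonneg_right h1 h2).trans_eq ?_
  ring

theorem integrableOn_integrand (h : IsHolderVanishing Q H η δ) (hB : 0 < B) (hBη : B < η)
    (hδ : 0 ≤ δ) {x : ℝ} (hx : x ∈ Ioo (0 : ℝ) 1) :
    IntegrableOn (fun y => (Q x - Q (x + y)) * y ^ (-1 - B)) (Ioi 0) := by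
  have hη : 0 < η := hB.trans hBη
  refine Integrable.mono' ((integral_min_rpow hB hBη (sub_pos.2 hx.2)).1.const_mul
    (H * x ^ (-δ))) ((h.measurable_integrand hη hδ).comp
      measurable_prodMk_left).aestronglyMeasurable ?_
  filter_upwards [ae_restrict_mem measurableSet_Ioi] with y hy
  exact h.norm_integrand_le hx hy

theorem integral_norm_integrand_le (h : IsHolderVanishing Q H η δ) (hB : 0 < B) (hBη : B < η)
    (hδ : 0 ≤ δ) {x : ℝ} (hx : x ∈ Ioo (0 : ℝ) 1) :
    ∫ y in Ioi 0, ‖(Q x - Q (x + y)) * y ^ (-1 - B)‖ ≤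
      H * (1 / (η - B) + 1 / B) * (x ^ (-δ) * (1 - x) ^ (η - B)) := by
  obtain ⟨i, e⟩ := integral_min_rpow hB hBη (sub_pos.2 hx.2)
  calc _ ≤ ∫ y in Ioi 0, H * x ^ (-δ) * ((min y (1 - x)) ^ η * y ^ (-1 - B)) :=
        setIntegral_mono_on (h.integrableOn_integrand hB hBη hδ hx).norm (i.const_mul _)
          measurableSet_Ioi fun y hy => h.norm_integrand_le hx hy
    _ = _ := by rw [integral_const_mul, e]; ring

theorem measurable_marchaud (h : IsHolderVanishing Q H η δ) (hη : 0 < η) (hδ : 0 ≤ δ) :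
    Measurable (marchaud B Q) := by
  have := ((h.measurable_integrand (B := B) hη hδ).stronglyMeasurable.integral_prod_right'
    (ν := volume.restrict (Ioi 0))).measurable
  exact this.const_mul _

theorem abs_marchaud_le (h : IsHolderVanishing Q H η δ) (hB : 0 < B) (hB1 : B < 1) (hBη : B < η)
    (hδ : 0 ≤ δ) {x : ℝ} (hx : x ∈ Ioo (0 : ℝ) 1) :
    |marchaud B Q x| ≤ B / Real.Gamma (1 - B) * (H * (1 / (η - B) + 1 / B)) *
      (x ^ (-δ) * (1 - x) ^ (η - B)) := by
  have hG := Real.Gamma_pos_of_pos (sub_pos.2 hB1)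
  rw [marchaud, abs_mul, abs_of_pos (div_pos hB hG), mul_assoc]
  refine mul_le_mul_of_nonneg_left ?_ (div_pos hB hG).le
  exact (norm_integral_le_integral_norm _).trans (h.integral_norm_integrand_le hB hBη hδ hx)

theorem integrable_marchaud (h : IsHolderVanishing Q H η δ) (hB : 0 < B) (hB1 : B < 1)
    (hBη : B < η) (hδ : 0 ≤ δ) (hδ1 : δ < 1) : Integrable (marchaud B Q) unitVol := by
  have hη : 0 < η := hB.trans hBη
  have hb := integrableOn_beta (p := 1 - δ) (q := η - B + 1) (by linarith) (by linarith)
  refine Integrable.mono' (hb.const_mul (B / Real.Gamma (1 - B) * (H * (1 / (η - B) + 1 / B))))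
    (h.measurable_marchaud hη hδ).aestronglyMeasurable ?_
  filter_upwards [ae_unitVol_mem] with x hx
  have := h.abs_marchaud_le hB hB1 hBη hδ hx
  rwa [show 1 - δ - 1 = -δ by ring, add_sub_cancel_right]

/-- `Q` vanishes beyond `1`, so the difference of the integrals of `Q` and of its translate
telescopes to the integral over `(z, z + y]`. -/
theorem integral_translate (h : IsHolderVanishing Q H η δ) (hη : 0 < η) (hδ : 0 ≤ δ) (hδ1 : δ < 1)
    {z y : ℝ} (hy : 0 < y) :
    ∫ x in Ioo z 1, (Q x - Q (x + y)) = ∫ x in Ioo z 1, (Iic (z + y)).indicator Q x := by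
  have hi := h.integrable hη hδ hδ1
  have hi' : Integrable fun x => Q (x + y) := hi.comp_add_right y
  have z1 : ∀ {g : ℝ → ℝ}, (∀ x, 1 ≤ x → g x = 0) → ∫ x in Ioo z 1, g x = ∫ x in Ioi z, g x :=
    fun hg => (setIntegral_eq_of_subset_of_forall_sdiff_eq_zero measurableSet_Ioi
      Ioo_subset_Ioi_self fun x hx => hg x (by
        by_contra hlt
        exact hx.2 ⟨hx.1, not_le.1 hlt⟩)).symm
  rw [integral_sub hi.integrableOn hi'.integrableOn,
    z1 fun x hx => h.eq_zero x fun h' => not_lt.2 hx h'.2,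
    z1 fun x hx => h.eq_zero (x + y) fun h' => by linarith [h'.2],
    z1 fun x hx => by
      rw [indicator_apply_eq_zero]
      exact fun _ => h.eq_zero x fun h' => not_lt.2 hx h'.2]
  have e1 : ∫ x in Ioi z, Q (x + y) = ∫ x in Ioi (z + y), Q x := by
    rw [← integral_indicator measurableSet_Ioi, ← integral_indicator measurableSet_Ioi,
      ← integral_add_right_eq_self (fun x => (Ioi (z + y)).indicator Q x) y]
    congr 1 with x
    by_cases hx : z < x <;> simp [indicator, hx]
  rw [e1, setIntegral_indicator measurableSet_Iic, Ioi_inter_Iic]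
  have e2 := setIntegral_union (μ := volume) (f := Q)
    (Set.disjoint_left.2 fun x (hx : x ∈ Ioc z (z + y)) (hx' : x ∈ Ioi (z + y)) =>
      not_lt.2 hx.2 hx') measurableSet_Ioi hi.integrableOn hi.integrableOn
  rw [Ioc_union_Ioi_eq_Ioi (by linarith)] at e2
  linarith

/-- Fubini turns the integral into that of `y^{-1-B} ∫_z^{z+y} Q`. A second interchange integrates
the tail `y > x - z` first, giving `(x-z)^{-B}/B`, which after normalization is the kernel of order
`1 - B`. -/
theorem integral_marchaud (h : IsHolderVanishing Q H η δ) (hB : 0 < B) (hB1 : B < 1)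
    (hBη : B < η) (hδ : 0 ≤ δ) (hδ1 : δ < 1) {z : ℝ} (hz : z ∈ Ioo (0 : ℝ) 1) :
    ∫ x in Ioo z 1, marchaud B Q x = fracRight (1 - B) Q z := by
  have hη : 0 < η := hB.trans hBη
  have hB1' : 0 < 1 - B := sub_pos.2 hB1
  have hH := h.nonneg
  have hsub : Ioo z 1 ⊆ Ioo (0 : ℝ) 1 := Ioo_subset_Ioo_left hz.1.le
  have hQ := h.measurable hη hδ
  have hc0 : 0 ≤ H * (1 / (η - B) + 1 / B) := by
    have : 0 < η - B := sub_pos.2 hBη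
    positivity
  have hI : Integrable (fun w : ℝ × ℝ => (Q w.1 - Q (w.1 + w.2)) * w.2 ^ (-1 - B))
      ((volume.restrict (Ioo z 1)).prod (volume.restrict (Ioi 0))) := by
    have hm := h.measurable_integrand (B := B) hη hδ
    rw [integrable_prod_iff hm.aestronglyMeasurable]
    constructor
    · filter_upwards [ae_restrict_mem measurableSet_Ioo] with x hx
      exact h.integrableOn_integrand hB hBη hδ (hsub hx)
    · refine Integrable.mono' (integrable_const (H * (1 / (η - B) + 1 / B) * z ^ (-δ)))
        (hm.aestronglyMeasurable.norm.integral_prod_right') ?_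
      filter_upwards [ae_restrict_mem measurableSet_Ioo] with x hx
      rw [Real.norm_of_nonneg (integral_nonneg fun _ => norm_nonneg _)]
      refine (h.integral_norm_integrand_le hB hBη hδ (hsub hx)).trans ?_
      refine mul_le_mul_of_nonneg_left ?_ hc0
      have h1 : x ^ (-δ) ≤ z ^ (-δ) := Real.rpow_le_rpow_of_nonpos hz.1 hx.1.le (by linarith)
      have h2 : (1 - x) ^ (η - B) ≤ 1 := Real.rpow_le_one (by linarith [hx.2])
        (by linarith [hx.1, hz.1]) (by linarith)
      calc x ^ (-δ) * (1 - x) ^ (η - B) ≤ z ^ (-δ) * 1 :=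
            mul_le_mul h1 h2 (Real.rpow_nonneg (by linarith [hx.2]) _)
              (Real.rpow_nonneg hz.1.le _)
        _ = _ := mul_one _
  have htail : ∀ x ∈ Ioo z 1, ∀ c : ℝ,
      ((fun y => (Iic (z + y)).indicator (fun _ => c) x * y ^ (-1 - B)) =ᵐ[volume.restrict (Ioi 0)]
        (Ioi (x - z)).indicator fun y => c * y ^ (-1 - B)) := by
    intro x hx c
    have hne : ∀ᵐ y ∂(volume.restrict (Ioi (0 : ℝ))), y ≠ x - z := by
      refine ae_restrict_of_ae ?_
      simp [ae_iff]
    filter_upwards [hne] with y hy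
    by_cases hxy : x - z < y
    · have : x ≤ z + y := by linarith
      simp [this, hxy]
    · have : ¬ x ≤ z + y := fun h' => hxy (lt_of_le_of_ne (by linarith) (Ne.symm hy))
      simp [this, hxy]
  have hsubI : ∀ x ∈ Ioo z 1, Ioi (x - z) ∩ Ioi 0 = Ioi (x - z) := fun x hx =>
    inter_eq_left.2 (Ioi_subset_Ioi (by linarith [hx.1]))
  have htail_int : ∀ x ∈ Ioo z 1, ∀ c : ℝ,
      IntegrableOn (fun y => (Iic (z + y)).indicator (fun _ => c) x * y ^ (-1 - B)) (Ioi 0) ∧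
      ∫ y in Ioi 0, (Iic (z + y)).indicator (fun _ => c) x * y ^ (-1 - B) =
        c * ((x - z) ^ (-B) / B) := by
    intro x hx c
    have hxz : 0 < x - z := sub_pos.2 hx.1
    constructor
    · rw [IntegrableOn, integrable_congr (htail x hx c), integrable_indicator_iff measurableSet_Ioi,
        IntegrableOn, Measure.restrict_restrict measurableSet_Ioi, hsubI x hx]
      exact (integrableOn_Ioi_rpow_of_lt (by linarith) hxz).const_mul c
    · rw [integral_congr_ae (htail x hx c), integral_indicator measurableSet_Ioi,
        Measure.restrict_restrict measurableSet_Ioi, hsubI x hx, integral_const_mul,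
        integral_Ioi_rpow_of_lt (by linarith) hxz, show -1 - B + 1 = -B by ring]
      field_simp
  have hind : ∀ (g : ℝ → ℝ) (x y : ℝ), (Iic (z + y)).indicator g x =
      (Iic (z + y)).indicator (fun _ => g x) x := fun g x y => by
    by_cases hx : x ≤ z + y <;> simp [hx]
  -- The second interchange is justified by the tail formula with `|Q x|` in place of `Q x`: on
  -- `(z,1)` the result is bounded by a multiple of `(x-z)^{-B}`.
  have hJ : Integrable (fun w : ℝ × ℝ => (Iic (z + w.2)).indicator Q w.1 * w.2 ^ (-1 - B))
      ((volume.restrict (Ioo z 1)).prod (volume.restrict (Ioi 0))) := by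
    have hm : Measurable fun w : ℝ × ℝ => (Iic (z + w.2)).indicator Q w.1 * w.2 ^ (-1 - B) := by
      have e : (fun w : ℝ × ℝ => (Iic (z + w.2)).indicator Q w.1 * w.2 ^ (-1 - B)) =
          fun w => (if w.1 ≤ z + w.2 then Q w.1 else 0) * w.2 ^ (-1 - B) := by
        ext w
        by_cases hw : w.1 ≤ z + w.2 <;> simp [hw]
      rw [e]
      refine Measurable.mul (Measurable.ite (measurableSet_le measurable_fst (by fun_prop))
        (hQ.comp measurable_fst) measurable_const) (by fun_prop)
    rw [integrable_prod_iff hm.aestronglyMeasurable]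
    constructor
    · filter_upwards [ae_restrict_mem measurableSet_Ioo] with x hx
      simp only [hind Q x]
      exact (htail_int x hx (Q x)).1
    · have hb := integrableOn_beta_Ioo (a := z) (x := 1) (p := 1 - B) (q := 1) hB1' one_pos
      refine Integrable.mono' (hb.const_mul (H * z ^ (-δ) / B))
        (hm.aestronglyMeasurable.norm.integral_prod_right') ?_
      filter_upwards [ae_restrict_mem measurableSet_Ioo] with x hx
      have hxz : 0 < x - z := sub_pos.2 hx.1
      have e : ∀ y ∈ Ioi (0 : ℝ), ‖(Iic (z + y)).indicator Q x * y ^ (-1 - B)‖ =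
          (Iic (z + y)).indicator (fun _ => |Q x|) x * y ^ (-1 - B) := fun y hy => by
        rw [norm_mul, Real.norm_of_nonneg (Real.rpow_nonneg (le_of_lt hy) _)]
        by_cases hxy : x ≤ z + y <;> simp [hxy]
      rw [Real.norm_of_nonneg (integral_nonneg fun _ => norm_nonneg _)]
      rw [setIntegral_congr_fun measurableSet_Ioi e, (htail_int x hx |Q x|).2]
      have h1 : x ^ (-δ) ≤ z ^ (-δ) := Real.rpow_le_rpow_of_nonpos hz.1 hx.1.le (by linarith)
      have h2 : (1 - x) ^ η ≤ 1 := Real.rpow_le_one (by linarith [hx.2])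
        (by linarith [hx.1, hz.1]) hη.le
      have h3 : |Q x| ≤ H * z ^ (-δ) := by
        refine (h.abs_le (hsub hx)).trans ?_
        have h0 := Real.rpow_nonneg (hsub hx).1.le (-δ)
        calc H * (1 - x) ^ η * x ^ (-δ) ≤ H * 1 * z ^ (-δ) := by gcongr
          _ = _ := by ring
      have h4 := Real.rpow_nonneg hxz.le (-B)
      rw [show 1 - B - 1 = -B by ring, sub_self, Real.rpow_zero, mul_one]
      calc |Q x| * ((x - z) ^ (-B) / B) ≤ H * z ^ (-δ) * ((x - z) ^ (-B) / B) := by gcongr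
        _ = _ := by ring
  have s1 := integral_integral_swap
    (f := fun x y => (Q x - Q (x + y)) * y ^ (-1 - B)) hI
  have s2 := integral_integral_swap
    (f := fun x y => (Iic (z + y)).indicator Q x * y ^ (-1 - B)) hJ
  have e3 : ∫ y in Ioi 0, ∫ x in Ioo z 1, (Q x - Q (x + y)) * y ^ (-1 - B) =
      ∫ y in Ioi 0, ∫ x in Ioo z 1, (Iic (z + y)).indicator Q x * y ^ (-1 - B) := by
    refine setIntegral_congr_fun measurableSet_Ioi fun y hy => ?_
    simp only [integral_mul_const]
    rw [h.integral_translate hη hδ hδ1 hy]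
  have e4 : ∫ x in Ioo z 1, marchaud B Q x = B / Real.Gamma (1 - B) *
      ∫ x in Ioo z 1, ∫ y in Ioi 0, (Q x - Q (x + y)) * y ^ (-1 - B) := by
    rw [← integral_const_mul]; rfl
  rw [e4, s1, e3, ← s2, fracRight_of_pos hB1', integral_abelKernel_mul' hz.1.le,
    ← integral_const_mul]
  refine setIntegral_congr_fun measurableSet_Ioo fun x hx => ?_
  simp only [hind Q x]
  rw [(htail_int x hx (Q x)).2, show 1 - B - 1 = -B by ring]
  field_simp

/-- The Abel equation `ₓI_1^B v = Q` is solvable for weighted Hölder functions `Q`. -/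
theorem exists_abel_solution (h : IsHolderVanishing Q H η δ) (hB : 0 ≤ B) (hB1 : B < 1)
    (hBη : B < η) (hδ : 0 ≤ δ) (hδ1 : δ < 1) :
    ∃ v C, Measurable v ∧ (∀ x ∈ Ioo (0 : ℝ) 1, |v x| ≤ C * (x ^ (-δ) * (1 - x) ^ (η - B))) ∧
      fracRight B v =ᵐ[unitVol] Q := by
  have hη : 0 < η := hB.trans_lt hBη
  rcases hB.eq_or_lt with rfl | hB
  · refine ⟨Q, H, h.measurable hη hδ, fun x hx => ?_, by rw [fracRight_zero]⟩
    refine (h.abs_le hx).trans_eq ?_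
    rw [sub_zero]; ring
  refine ⟨marchaud B Q, _, h.measurable_marchaud hη hδ,
    fun x hx => h.abs_marchaud_le hB hB1 hBη hδ hx, ?_⟩
  have hv := h.integrable_marchaud hB hB1 hBη hδ hδ1
  -- The right integral of order `1 - B` takes both `ₓI_1^B v` and `Q` to `∫_z^1 v`, so they agree.
  have := fracRight_injective (a := 1 - B) (c := 0) (by linarith) (by linarith)
    (integrable_fracRight hB.le hv) (h.integrable hη hδ hδ1).restrict (by
      filter_upwards [ae_unitVol_mem] with z hz _
      rw [fracRight_fracRight (by linarith) hB.le (by ring) hz hv]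
      exact h.integral_marchaud hB hB1 hBη hδ hδ1 hz)
  filter_upwards [this, ae_unitVol_mem] with x hx hx1 using hx hx1.1

end IsHolderVanishing

/-! ### Existence of a function with prescribed flux. -/

/-- Every moderate function orthogonal to `(1-s)^{-A} s^{-B}` is the flux of a function that
vanishes at both ends at the rate of a power. -/
theorem Admissible.exists_of_flux {A B r lam M : ℝ} (h : Admissible A B r lam) {q : ℝ → ℝ}
    (hq : AEStronglyMeasurable q unitVol) (hM : 0 ≤ M)
    (hle : ∀ s ∈ Ioo (0 : ℝ) 1,
      |q s| ≤ M * (s ^ (-((1 - (A + B)) / 8)) * (1 - s) ^ (-((1 - (A + B)) / 8))))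
    (h0 : ∫ s, (1 - s) ^ (-A) * (s ^ (-B) * q s) ∂unitVol = 0) :
    ∃ u : ℝ → ℝ, ∃ C γ : ℝ, 0 < γ ∧ 0 ≤ C ∧ Measurable u ∧
      (∀ x ∈ Ioo (0 : ℝ) 1, |u x| ≤ C * (x ^ γ * (1 - x) ^ γ)) ∧
      ∀ φ : ℝ → ℝ, IsTest φ → ∫ x, q x * φ x ∂unitVol =
        r * derivPairing u (rightInt (A + B) φ) + (1 - r) * derivPairing u (leftInt (A + B) φ) := by
  have hA := h.nonneg_left
  have hB := h.nonneg_right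
  have hl := h.lam_pos
  have hlt := h.lt_one
  set g := 1 - (A + B) with hg
  have hg0 : 0 < g := by linarith
  have hg1 : g ≤ 1 := by linarith
  have hA1 : 0 < 1 - A := by linarith
  -- The gap `g` is shared out: `η = B + g/2` exceeds `B`, as the Abel equation needs, and `η + e <
  -- 1 - A = B + g`, as the Hölder estimate needs. The weight exponent `η + 2e = B + 3g/4` is below
  -- `1` and leaves `u` the power `1 - A - (η + 2e) = g/4` at `0`; at `1` it gets `η - B = g/2`.
  set e := g / 8 with he
  set η := B + g / 2 with hη
  set p : ℝ → ℝ := fun s => s ^ (-B) * q s with hp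
  have hpm : AEStronglyMeasurable p unitVol := aestronglyMeasurable_rpow_mul hq (-B)
  have hple : ∀ s ∈ Ioo (0 : ℝ) 1, |p s| ≤ M * (s ^ (-(B + e)) * (1 - s) ^ (-e)) := by
    intro s hs
    have h1 := Real.rpow_nonneg hs.1.le (-B)
    rw [hp, abs_mul, abs_of_nonneg h1]
    refine (mul_le_mul_of_nonneg_left (hle s hs) h1).trans_eq ?_
    rw [show -(B + e) = -B + -e by ring, Real.rpow_add hs.1]
    ring
  have hpi : Integrable p unitVol := by
    have hb := integrableOn_beta (p := 1 - (B + e)) (q := 1 - e) (by linarith) (by linarith)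
    refine Integrable.mono' (hb.const_mul M) hpm ?_
    filter_upwards [ae_unitVol_mem] with s hs
    refine (hple s hs).trans_eq ?_
    rw [show 1 - (B + e) - 1 = -(B + e) by ring, show 1 - e - 1 = -e by ring]
  -- The orthogonality hypothesis is the vanishing at `1` of the left integral of order `1 - A`, up
  -- to the Gamma factor.
  have hone : fracLeft (1 - A) p 1 = 0 := by
    rw [fracLeft_of_pos hA1, integral_abelKernel_mul le_rfl]
    have : ∀ s, (1 - s) ^ (1 - A - 1) / Real.Gamma (1 - A) * p s =
        (Real.Gamma (1 - A))⁻¹ * ((1 - s) ^ (-A) * (s ^ (-B) * q s)) := fun s => by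
      rw [show 1 - A - 1 = -A by ring, hp]; ring
    simp only [this]
    rw [integral_const_mul, h0, mul_zero]
  obtain ⟨H, hH0, hH⟩ := exists_holder_const (a := 1 - A) (c := A + B) (d := B + e) (e := e)
    (η := η) (by linarith) h.pos.le hlt.le (by linarith) (by linarith) (by linarith)
    (by linarith) (by ring) hpm hple hM
  -- By `hone` the extension by zero agrees with the formula at `b = 1` too, so the Hölder bound
  -- reaches the endpoint.
  set Q : ℝ → ℝ := (Ioo (0 : ℝ) 1).indicator fun b => b ^ (A + B - 1) * fracLeft (1 - A) p b with hQ
  have hQ1 : ∀ b, 0 < b → b ≤ 1 → Q b = b ^ (A + B - 1) * fracLeft (1 - A) p b := by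
    intro b hb0 hb1
    rcases hb1.eq_or_lt with rfl | hb1
    · rw [hone, hQ]; simp
    · rw [hQ, indicator_of_mem (show b ∈ Ioo (0 : ℝ) 1 from ⟨hb0, hb1⟩)]
  have hhol : IsHolderVanishing Q H η (η + 2 * e) := by
    refine ⟨hH0, fun x hx => by rw [hQ, indicator_of_notMem hx], fun b b' hb hbb hb' => ?_⟩
    rw [hQ1 b hb (hbb.le.trans hb'), hQ1 b' (hb.trans hbb) hb']
    exact hH b b' hb hbb hb'
  obtain ⟨v, C, hvm, hvle, hv⟩ := hhol.exists_abel_solution (B := B) hB (by linarith)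
    (by linarith) (by linarith) (by linarith)
  have hpowm : ∀ c : ℝ, Measurable fun x : ℝ => x ^ c := fun c => by fun_prop
  -- Chosen so that `x^{A-1} u = lam⁻¹ v`, whose right integral of order `B` is `lam⁻¹ Q`; the inner
  -- potential of `u` is then `lam⁻¹ ₀I^{1-A} p`.
  set u : ℝ → ℝ := fun x => lam⁻¹ * (x ^ (1 - A) * v x) with hu
  have hum : Measurable u := ((hpowm (1 - A)).mul hvm).const_mul _
  have hule : ∀ x ∈ Ioo (0 : ℝ) 1, |u x| ≤ lam⁻¹ * |C| * (x ^ (g / 4) * (1 - x) ^ (g / 4)) := by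
    intro x hx
    have hx1 : 0 < 1 - x := sub_pos.2 hx.2
    have n1 := Real.rpow_nonneg hx.1.le (1 - A)
    have n2 := Real.rpow_nonneg hx.1.le (-(η + 2 * e))
    have n3 := Real.rpow_nonneg hx1.le (η - B)
    have e1 : x ^ (1 - A) * x ^ (-(η + 2 * e)) = x ^ (g / 4) := by
      rw [← Real.rpow_add hx.1]; congr 1; linarith
    have h2 : (1 - x) ^ (η - B) ≤ (1 - x) ^ (g / 4) :=
      Real.rpow_le_rpow_of_exponent_ge hx1 (by linarith [hx.1]) (by linarith)
    rw [hu, abs_mul, abs_mul, abs_of_pos (inv_pos.2 hl), abs_of_nonneg n1, mul_assoc]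
    refine mul_le_mul_of_nonneg_left ?_ (inv_pos.2 hl).le
    calc x ^ (1 - A) * |v x| ≤
          x ^ (1 - A) * (|C| * (x ^ (-(η + 2 * e)) * (1 - x) ^ (η - B))) := by
          refine mul_le_mul_of_nonneg_left ((hvle x hx).trans ?_) n1
          exact mul_le_mul_of_nonneg_right (le_abs_self C) (mul_nonneg n2 n3)
      _ = |C| * ((x ^ (1 - A) * x ^ (-(η + 2 * e))) * (1 - x) ^ (η - B)) := by ring
      _ ≤ _ := by
          rw [e1]
          have := Real.rpow_nonneg hx.1.le (g / 4)
          gcongr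
  have hui : Integrable u unitVol := by
    refine Integrable.mono' (integrable_const (lam⁻¹ * |C|)) hum.aestronglyMeasurable ?_
    filter_upwards [ae_unitVol_mem] with x hx
    refine (hule x hx).trans (mul_le_of_le_one_right (by positivity) ?_)
    exact mul_le_one₀ (Real.rpow_le_one hx.1.le hx.2.le (by positivity))
      (Real.rpow_nonneg (sub_pos.2 hx.2).le _)
      (Real.rpow_le_one (sub_pos.2 hx.2).le (by linarith [hx.1]) (by positivity))
  refine ⟨u, lam⁻¹ * |C|, g / 4, by positivity, by positivity, hum, hule, fun φ hφ => ?_⟩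
  have hU : innerPotential A B u =ᵐ[unitVol] fun b => lam⁻¹ * fracLeft (1 - A) p b := by
    filter_upwards [hv, ae_unitVol_mem] with b hb hb1
    have e1 : fracRight B (fun x => x ^ (A - 1) * u x) b = lam⁻¹ * fracRight B v b := by
      rw [← fracRight_const_mul]
      refine fracRight_congr_on hb1 fun x hx => ?_
      have : x ^ (A - 1) * x ^ (1 - A) = 1 := by rw [← Real.rpow_add hx.1]; simp
      rw [hu]
      linear_combination (lam⁻¹ * v x) * this
    have e2 : b ^ (1 - (A + B)) * b ^ (A + B - 1) = 1 := by rw [← Real.rpow_add hb1.1]; simp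
    rw [innerPotential, e1, hb, hQ1 b hb1.1 hb1.2.le]
    linear_combination (lam⁻¹ * fracLeft (1 - A) p b) * e2
  have hW : fluxPotential A B u =ᵐ[unitVol] fun x => lam⁻¹ * fracLeft 1 p x := by
    filter_upwards [fracLeft_congr_ae (a := A) hU, ae_unitVol_mem] with x hx hx1
    rw [fluxPotential, hx, fracLeft_const_mul,
      fracLeft_fracLeft hA hA1.le (by ring) hx1.2.le hpi, fracLeft_one hx1.2.le]
  have hχ := hφ.mul_rpow B
  rw [h.pairing_eq hui hφ]
  have e3 : ∫ s, fluxPotential A B u s * deriv (fun s => s ^ B * φ s) s ∂unitVol =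
      lam⁻¹ * ∫ s, fracLeft 1 p s * deriv (fun s => s ^ B * φ s) s ∂unitVol := by
    rw [← integral_const_mul]
    refine integral_congr_ae ?_
    filter_upwards [hW] with s hs
    rw [hs]; ring
  rw [e3, hχ.integral_primitive_mul_deriv hpi, ← mul_assoc, mul_inv_cancel₀ hl.ne', one_mul,
    neg_neg]
  refine setIntegral_congr_fun measurableSet_Ioo fun s hs => ?_
  have : s ^ (-B) * s ^ B = 1 := by rw [← Real.rpow_add hs.1]; simp
  simp only [hp]
  linear_combination (-(q s * φ s)) * this

/-! ### Weighted spaces and primitives of the source. -/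

theorem measurable_weight (a b : ℝ) : Measurable fun x => weight a b x := by
  unfold weight
  fun_prop

theorem weight_pos {a b x : ℝ} (hx : x ∈ Ioo (0 : ℝ) 1) : 0 < weight a b x :=
  mul_pos (Real.rpow_pos_of_pos (sub_pos.2 hx.2) _) (Real.rpow_pos_of_pos hx.1 _)

theorem unitVol_absolutelyContinuous (a b : ℝ) : unitVol ≪ weightMeasure a b := by
  refine withDensity_absolutelyContinuous' (measurable_weight a b).ennreal_ofReal.aemeasurable ?_
  filter_upwards [ae_unitVol_mem] with x hx
  simpa using weight_pos hx

theorem weightMeasure_absolutelyContinuous (a b : ℝ) : weightMeasure a b ≪ unitVol :=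
  withDensity_absolutelyContinuous _ _

theorem integrable_weightMeasure_iff (a b : ℝ) (g : ℝ → ℝ) :
    Integrable g (weightMeasure a b) ↔ Integrable (fun x => weight a b x * g x) unitVol := by
  rw [weightMeasure, integrable_withDensity_iff_integrable_smul'
    (measurable_weight a b).ennreal_ofReal (by simp)]
  refine integrable_congr ?_
  filter_upwards [ae_unitVol_mem] with x hx
  rw [ENNReal.toReal_ofReal (weight_pos hx).le, smul_eq_mul]

theorem memLp_weightMeasure_iff (a b : ℝ) {g : ℝ → ℝ} (hg : AEStronglyMeasurable g unitVol) :
    MemLp g 2 (weightMeasure a b) ↔ Integrable (fun x => weight a b x * g x ^ 2) unitVol := by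
  rw [memLp_two_iff_integrable_sq (hg.mono_ac (weightMeasure_absolutelyContinuous a b)),
    integrable_weightMeasure_iff]

/-- The source weighted by a small power is integrable. -/
theorem integrable_mul_rpow_of_memLp {a b e : ℝ} (ha : a ≤ 1) (hb : b ≤ 1) (he : 0 < e)
    {f : ℝ → ℝ} (hf : MemLp f 2 (weightMeasure a b)) :
    Integrable (fun s => f s * (s * (1 - s)) ^ e) unitVol := by
  have hfm : AEStronglyMeasurable f unitVol := hf.1.mono_ac (unitVol_absolutelyContinuous a b)
  have h1 := (memLp_weightMeasure_iff a b hfm).1 hf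
  have h2 := integrableOn_beta (p := 2 * e) (q := 2 * e) (by linarith) (by linarith)
  refine Integrable.mono' (h1.add h2)
    (hfm.mul (by fun_prop : Measurable fun s : ℝ => (s * (1 - s)) ^ e).aestronglyMeasurable) ?_
  filter_upwards [ae_unitVol_mem] with s hs
  have hs1 : 0 < 1 - s := sub_pos.2 hs.2
  have hE : 0 < (s * (1 - s)) ^ e := Real.rpow_pos_of_pos (mul_pos hs.1 hs1) _
  have hw := weight_pos (a := a) (b := b) hs
  set E := (s * (1 - s)) ^ e with hEdef
  set w := weight a b s with hwdef
  -- Exponents at most `1` make the weight at least `s (1 - s)`. With this, Young's inequality gives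
  -- `|f| E ≤ w f² + z`, where `z` is a Beta integrand because `e > 0`.
  have hEw : E ^ 2 ≤ s ^ (2 * e - 1) * (1 - s) ^ (2 * e - 1) * w := by
    have e1 : E ^ 2 = s ^ (2 * e - 1) * (1 - s) ^ (2 * e - 1) * ((1 - s) * s) := by
      rw [hEdef, ← Real.rpow_natCast, ← Real.rpow_mul (mul_pos hs.1 hs1).le,
        Real.mul_rpow hs.1.le hs1.le, Real.rpow_sub_one hs.1.ne', Real.rpow_sub_one hs1.ne']
      push_cast
      rw [mul_comm e 2]
      have := hs.1.ne'
      field_simp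
    rw [e1]
    have h3 : 1 - s ≤ (1 - s) ^ a := by
      conv_lhs => rw [← Real.rpow_one (1 - s)]
      exact Real.rpow_le_rpow_of_exponent_ge hs1 (by linarith [hs.1]) ha
    have h4 : s ≤ s ^ b := by
      conv_lhs => rw [← Real.rpow_one s]
      exact Real.rpow_le_rpow_of_exponent_ge hs.1 hs.2.le hb
    have h5 : (1 - s) * s ≤ w := mul_le_mul h3 h4 hs.1.le (Real.rpow_nonneg hs1.le _)
    have h6 := Real.rpow_nonneg hs.1.le (2 * e - 1)
    have h7 := Real.rpow_nonneg hs1.le (2 * e - 1)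
    gcongr
  rw [norm_mul, Real.norm_eq_abs, Real.norm_of_nonneg hE.le]
  simp only [Pi.add_apply]
  rw [← sq_abs (f s)]
  set t := |f s|
  set z := s ^ (2 * e - 1) * (1 - s) ^ (2 * e - 1)
  have ht : 0 ≤ t := abs_nonneg _
  have key : t * E * w ≤ (w * t ^ 2 + z) * w := by
    nlinarith [sq_nonneg (t * w - E), mul_nonneg ht hE.le]
  exact le_of_mul_le_mul_right key hw

theorem locallyIntegrableOn_of_mul_rpow {e : ℝ} {f : ℝ → ℝ}
    (hf : Integrable (fun s => f s * (s * (1 - s)) ^ e) unitVol) :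
    LocallyIntegrableOn f (Ioo 0 1) := by
  have hcont : ContinuousOn (fun s : ℝ => (s * (1 - s)) ^ (-e)) (Ioo 0 1) := by
    intro s hs
    have : s * (1 - s) ≠ 0 := (mul_pos hs.1 (sub_pos.2 hs.2)).ne'
    have hc : ContinuousAt (fun s : ℝ => s * (1 - s)) s := by fun_prop
    exact (hc.rpow_const (Or.inl this)).continuousWithinAt
  have h1 := (IntegrableOn.locallyIntegrableOn hf).continuousOn_mul hcont
    isOpen_Ioo.isLocallyClosed
  rw [locallyIntegrableOn_iff isOpen_Ioo.isLocallyClosed] at h1 ⊢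
  intro k hk hkc
  refine (h1 k hk hkc).congr_fun (fun s hs => ?_) hkc.measurableSet
  have hs' := hk hs
  have hpos : 0 < s * (1 - s) := mul_pos hs'.1 (sub_pos.2 hs'.2)
  have : (s * (1 - s)) ^ (-e) * (s * (1 - s)) ^ e = 1 := by
    rw [← Real.rpow_add hpos]; simp
  simp only
  linear_combination f s * this

theorem intervalIntegrable_of_locallyIntegrableOn_Ioo {f : ℝ → ℝ} (hf : LocallyIntegrableOn f (Ioo 0 1))
    {a b : ℝ} (ha : a ∈ Ioo (0 : ℝ) 1) (hb : b ∈ Ioo (0 : ℝ) 1) :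
    IntervalIntegrable f volume a b := by
  rw [intervalIntegrable_iff']
  exact hf.integrableOn_compact_subset (ordConnected_Ioo.uIcc_subset ha hb) isCompact_uIcc

theorem continuousOn_primitive {f : ℝ → ℝ} (hf : LocallyIntegrableOn f (Ioo 0 1)) :
    ContinuousOn (fun x => ∫ t in (1 / 2 : ℝ)..x, f t) (Ioo 0 1) := by
  intro x hx
  refine ContinuousAt.continuousWithinAt ?_
  have hx0 := hx.1
  have hx1 := hx.2
  have hm0 : 0 < min x (1 / 2) := lt_min hx0 (by norm_num)
  have hm1 : max x (1 / 2) < 1 := max_lt hx1 (by norm_num)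
  have ha : min x (1 / 2) / 2 ∈ Ioo (0 : ℝ) 1 := ⟨by linarith, by
    linarith [min_le_right x (1 / 2)]⟩
  have hb : (max x (1 / 2) + 1) / 2 ∈ Ioo (0 : ℝ) 1 := ⟨by
    linarith [le_max_right x (1 / 2)], by linarith⟩
  have h1 : min x (1 / 2) / 2 < x := by linarith [min_le_left x (1 / 2)]
  have h2 : x < (max x (1 / 2) + 1) / 2 := by linarith [le_max_left x (1 / 2)]
  have hc := intervalIntegral.continuousOn_primitive_interval' (a := 1 / 2)
    (intervalIntegrable_of_locallyIntegrableOn_Ioo hf ha hb) (by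
      rw [uIcc_of_le (h1.trans h2).le]
      exact ⟨by linarith [min_le_right x (1 / 2)], by linarith [le_max_right x (1 / 2)]⟩)
  refine hc.continuousAt ?_
  rw [uIcc_of_le (h1.trans h2).le]
  exact Icc_mem_nhds h1 h2

/-- Between `1/2` and `x` the function `s (1 - s)` is smallest at `x`, so the weight can be pulled
out of the integral at the cost of `(x (1-x))^{-e}`. -/
theorem abs_primitive_le {e : ℝ} (he : 0 < e) {f : ℝ → ℝ}
    (hf : Integrable (fun s => f s * (s * (1 - s)) ^ e) unitVol) {x : ℝ}
    (hx : x ∈ Ioo (0 : ℝ) 1) :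
    |∫ t in (1 / 2 : ℝ)..x, f t| ≤
      (∫ s, |f s * (s * (1 - s)) ^ e| ∂unitVol) * (x ^ (-e) * (1 - x) ^ (-e)) := by
  have hx1 : 0 < 1 - x := sub_pos.2 hx.2
  have hsub : uIoc (1 / 2) x ⊆ Ioo (0 : ℝ) 1 := fun s hs => by
    have hs' := ordConnected_Ioo.uIcc_subset (s := Ioo (0 : ℝ) 1) (by norm_num) hx
      (uIoc_subset_uIcc hs)
    exact hs'
  have hEx : 0 < (x * (1 - x)) ^ (-e) := Real.rpow_pos_of_pos (mul_pos hx.1 hx1) _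
  rw [← Real.mul_rpow hx.1.le hx1.le, ← Real.norm_eq_abs,
    intervalIntegral.norm_integral_eq_norm_integral_uIoc]
  have hi : IntegrableOn (fun s => |f s * (s * (1 - s)) ^ e| * (x * (1 - x)) ^ (-e))
      (uIoc (1 / 2) x) := (IntegrableOn.mono_set hf.abs hsub).mul_const _
  refine (norm_integral_le_of_norm_le hi ?_).trans ?_
  · filter_upwards [ae_restrict_mem measurableSet_uIoc] with s hs
    have hs01 := hsub hs
    have hpos : 0 < s * (1 - s) := mul_pos hs01.1 (sub_pos.2 hs01.2)
    have hle : x * (1 - x) ≤ s * (1 - s) := by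
      have hs' := uIoc_subset_uIcc hs
      rcases le_total x (1 / 2) with hx2 | hx2
      · rw [uIcc_of_ge hx2] at hs'
        nlinarith [mul_nonneg (sub_nonneg.2 hs'.1) (show 0 ≤ 1 - s - x by linarith [hs'.2])]
      · rw [uIcc_of_le hx2] at hs'
        nlinarith [mul_nonneg (sub_nonneg.2 hs'.2) (show 0 ≤ s + x - 1 by linarith [hs'.1])]
    have h1 : (s * (1 - s)) ^ (-e) ≤ (x * (1 - x)) ^ (-e) :=
      Real.rpow_le_rpow_of_nonpos (mul_pos hx.1 hx1) hle (by linarith)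
    have h2 : (s * (1 - s)) ^ e * (s * (1 - s)) ^ (-e) = 1 := by
      rw [← Real.rpow_add hpos]; simp
    rw [abs_mul, abs_of_pos (Real.rpow_pos_of_pos hpos e), Real.norm_eq_abs]
    have h3 := Real.rpow_pos_of_pos hpos e
    calc |f s| = |f s| * (s * (1 - s)) ^ e * (s * (1 - s)) ^ (-e) := by
          rw [mul_assoc, h2, mul_one]
      _ ≤ _ := by gcongr
  · rw [integral_mul_const]
    refine mul_le_mul_of_nonneg_right ?_ hEx.le
    exact setIntegral_mono_set hf.abs (Eventually.of_forall fun _ => abs_nonneg _)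
      hsub.eventuallyLE

theorem IsTest.integral_deriv {φ : ℝ → ℝ} (hφ : IsTest φ) :
    ∫ x, _root_.deriv φ x ∂unitVol = 0 := by
  rw [← integral_Ioc_eq_integral_Ioo, ← intervalIntegral.integral_of_le zero_le_one,
    intervalIntegral.integral_deriv_eq_sub (fun x _ => (hφ.hasDerivAt x).differentiableAt)
      (hφ.deriv.1.continuous.intervalIntegrable _ _), hφ.eq_zero (x := 1) (by simp),
    hφ.eq_zero (x := 0) (by simp), sub_zero]

/-- The source need not be integrable up to the endpoints, so it is cut off to an interval carrying
`φ`. There the primitive of the cut-off differs from that of `f` by a constant, which drops out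
because `φ'` has mean zero. -/
theorem negWeakDeriv_primitive {f Q : ℝ → ℝ} (hf : LocallyIntegrableOn f (Ioo 0 1)) {c : ℝ}
    (hQ : ∀ x ∈ Ioo (0 : ℝ) 1, Q x = c - ∫ t in (1 / 2 : ℝ)..x, f t) : NegWeakDeriv Q f := by
  intro φ hφ
  obtain ⟨a, b, ha, hab, hb, hK⟩ := exists_Icc_of_isCompact_subset_Ioo hφ.2.1 hφ.2.2
  have hsub : Icc a b ⊆ Ioo (0 : ℝ) 1 := fun x hx => ⟨ha.trans_le hx.1, hx.2.trans_lt hb⟩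
  have ha01 : a ∈ Ioo (0 : ℝ) 1 := hsub ⟨le_rfl, hab.le⟩
  have hhalf : (1 / 2 : ℝ) ∈ Ioo (0 : ℝ) 1 := by norm_num
  have hpi : Integrable ((Icc a b).indicator f) unitVol :=
    ((integrable_indicator_iff measurableSet_Icc).2
      (hf.integrableOn_compact_subset hsub isCompact_Icc)).restrict
  have hz : ∀ x, x ∉ Icc a b → φ x = 0 := fun x hx =>
    image_eq_zero_of_notMem_tsupport fun h => hx (hK h)
  have hz' : ∀ x, x ∉ Icc a b → deriv φ x = 0 := fun x hx =>
    image_eq_zero_of_notMem_tsupport fun h => hx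
      (hK (closure_minimal support_deriv_subset (isClosed_tsupport φ) h))
  have hprim : ∀ x ∈ Icc a b, fracLeft 1 ((Icc a b).indicator f) x =
      (∫ t in (1 / 2 : ℝ)..x, f t) - ∫ t in (1 / 2 : ℝ)..a, f t := by
    intro x hx
    have hx01 := hsub hx
    rw [fracLeft_one hx01.2.le, setIntegral_indicator measurableSet_Icc,
      intervalIntegral.integral_interval_sub_left
        (intervalIntegrable_of_locallyIntegrableOn_Ioo hf hhalf hx01)
        (intervalIntegrable_of_locallyIntegrableOn_Ioo hf hhalf ha01),
      intervalIntegral.integral_of_le hx.1, integral_Ioc_eq_integral_Ioo]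
    have e : Ioo 0 x ∩ Icc a b = Ico a x := by
      ext s
      simp only [mem_inter_iff, mem_Ioo, mem_Icc, mem_Ico]
      constructor
      · rintro ⟨⟨_, h2⟩, h3, _⟩; exact ⟨h3, h2⟩
      · rintro ⟨h1, h2⟩; exact ⟨⟨ha.trans_le h1, h2⟩, h1, h2.le.trans hx.2⟩
    rw [e, integral_Ico_eq_integral_Ioo]
  have hibp := hφ.integral_primitive_mul_deriv hpi
  obtain ⟨M, hM0, hM⟩ := hφ.deriv.exists_bound
  have i1 : Integrable (fun x => fracLeft 1 ((Icc a b).indicator f) x * deriv φ x) unitVol :=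
    (integrable_fracLeft zero_le_one hpi).mul_bdd (c := M)
      hφ.deriv.1.continuous.aestronglyMeasurable (Eventually.of_forall hM)
  have e1 : ∫ x in Ioo (0 : ℝ) 1, Q x * deriv φ x =
      ∫ x, ((c - ∫ t in (1 / 2 : ℝ)..a, f t) * deriv φ x -
        fracLeft 1 ((Icc a b).indicator f) x * deriv φ x) ∂unitVol := by
    refine setIntegral_congr_fun measurableSet_Ioo fun x hx => ?_
    by_cases hxab : x ∈ Icc a b
    · simp only [hQ x hx, hprim x hxab]; ring
    · simp [hz' x hxab]
  rw [e1, integral_sub (hφ.deriv.integrable.const_mul _) i1, integral_const_mul,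
    hφ.integral_deriv, hibp, mul_zero, zero_sub, neg_neg]
  refine setIntegral_congr_fun measurableSet_Ioo fun x hx => ?_
  by_cases hxab : x ∈ Icc a b
  · simp [hxab]
  · simp [hz x hxab]

/-! ### Parameters of the problem and assembly of the theorem. -/

/-- Since `sin (π - t) = sin t`, the defining relation of `β` is the coefficient relation for the
orders `1 - β` and `1 - (α - β)`, and `lam` is defined by its own. One order may vanish, but not
both, so the sum of sines is positive. -/
theorem admissible_of_order {α β r : ℝ} (hα1 : 1 < α) (hα2 : α < 2) (hβ0 : α - 1 ≤ β) (hβ1 : β ≤ 1)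
    (hβ : r = Real.sin (Real.pi * β) /
      (Real.sin (Real.pi * (α - β)) + Real.sin (Real.pi * β))) :
    ∃ lam, Admissible (1 - β) (1 - (α - β)) r lam := by
  have eA : Real.sin (Real.pi * (1 - β)) = Real.sin (Real.pi * β) := by
    rw [mul_sub, mul_one, Real.sin_pi_sub]
  have eB : Real.sin (Real.pi * (1 - (α - β))) = Real.sin (Real.pi * (α - β)) := by
    rw [mul_sub, mul_one, Real.sin_pi_sub]
  have hnonneg : ∀ a : ℝ, 0 ≤ a → a ≤ 1 → 0 ≤ Real.sin (Real.pi * a) := fun a h0 h1 =>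
    Real.sin_nonneg_of_nonneg_of_le_pi (by positivity) (by nlinarith [Real.pi_pos])
  have hS : 0 < Real.sin (Real.pi * (α - β)) + Real.sin (Real.pi * β) := by
    rcases hβ1.lt_or_eq with h | h
    · exact add_pos_of_nonneg_of_pos (hnonneg _ (by linarith) (by linarith))
        (sin_pi_mul_pos (by linarith) h)
    · exact add_pos_of_pos_of_nonneg (sin_pi_mul_pos (by linarith) (by linarith))
        (hnonneg _ (by linarith) hβ1)
  have hr : r * (Real.sin (Real.pi * (α - β)) + Real.sin (Real.pi * β)) =
      Real.sin (Real.pi * β) := by rw [hβ, div_mul_cancel₀ _ hS.ne']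
  refine ⟨Real.sin (Real.pi * (1 - β + (1 - (α - β)))) /
    (Real.sin (Real.pi * (1 - β)) + Real.sin (Real.pi * (1 - (α - β)))), ?_, ?_, ?_, ?_, ?_, ?_, ?_,
    ?_⟩
  · linarith
  · linarith
  · linarith
  · linarith
  · rw [eA, eB, add_comm]; exact hS
  · rw [eA, eB]; linarith
  · rw [eA, eB]; linarith
  · rw [div_mul_cancel₀]
    rw [eA, eB, add_comm]; exact hS.ne'

theorem eventuallyEq_left_of_ae {u v : ℝ → ℝ} (huv : u =ᵐ[unitVol] v) :
    u =ᶠ[𝓝[>] 0 ⊓ ae volume] v := by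
  have h := (ae_restrict_iff' measurableSet_Ioo).1 huv
  filter_upwards [mem_inf_of_left (Ioo_mem_nhdsGT zero_lt_one), mem_inf_of_right h]
    with x hx hx' using hx' hx

theorem eventuallyEq_right_of_ae {u v : ℝ → ℝ} (huv : u =ᵐ[unitVol] v) :
    u =ᶠ[𝓝[<] 1 ⊓ ae volume] v := by
  have h := (ae_restrict_iff' measurableSet_Ioo).1 huv
  filter_upwards [mem_inf_of_left (Ioo_mem_nhdsLT zero_lt_one), mem_inf_of_right h]
    with x hx hx' using hx' hx

theorem derivPairing_congr_ae {u v : ℝ → ℝ} (huv : u =ᵐ[unitVol] v) (ψ : ℝ → ℝ) :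
    derivPairing u ψ = derivPairing v ψ := by
  rw [derivPairing, derivPairing]
  congr 1
  refine integral_congr_ae ?_
  filter_upwards [huv] with x hx
  rw [hx]

theorem IsSolution.congr_ae {α r : ℝ} {K f u v : ℝ → ℝ} (h : IsSolution α r K f u)
    (huv : u =ᵐ[unitVol] v) : IsSolution α r K f v where
  equation := by
    obtain ⟨q, ⟨hq, hfl⟩, hd⟩ := h.equation
    refine ⟨q, ⟨hq, fun φ hφ => ?_⟩, hd⟩
    rw [hfl φ hφ, derivPairing_congr_ae huv, derivPairing_congr_ae huv]
  left_zero := h.left_zero.congr' (eventuallyEq_left_of_ae huv)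
  right_zero := h.right_zero.congr' (eventuallyEq_right_of_ae huv)

theorem one_le_weight {a b x : ℝ} (ha : a ≤ 0) (hb : b ≤ 0) (hx : x ∈ Ioo (0 : ℝ) 1) :
    1 ≤ weight a b x :=
  one_le_mul_of_one_le_of_one_le
    (Real.one_le_rpow_of_pos_of_le_one_of_nonpos (sub_pos.2 hx.2) (by linarith [hx.1]) ha)
    (Real.one_le_rpow_of_pos_of_le_one_of_nonpos hx.1 hx.2.le hb)

/-- The weight is at least `1`, so `|u| ≤ 1 + w u²`. This places the elements of the solution space
in the class of integrable functions in which uniqueness is proved. -/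
theorem integrable_of_memLp_weightMeasure {a b : ℝ} (ha : a ≤ 0) (hb : b ≤ 0) {u : ℝ → ℝ}
    (hu : MemLp u 2 (weightMeasure a b)) : Integrable u unitVol := by
  have hum : AEStronglyMeasurable u unitVol := hu.1.mono_ac (unitVol_absolutelyContinuous a b)
  refine Integrable.mono' ((integrable_const (1 : ℝ)).add ((memLp_weightMeasure_iff a b hum).1 hu))
    hum ?_
  filter_upwards [ae_unitVol_mem] with x hx
  have hw := one_le_weight ha hb hx
  rw [Real.norm_eq_abs, Pi.add_apply, ← sq_abs]
  nlinarith [sq_nonneg (|u x| - 1), mul_nonneg (sub_nonneg.2 hw) (sq_nonneg |u x|)]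

theorem IsTest.derivPairing_rightInt_sub {a : ℝ} (ha : 0 < a) {φ u v : ℝ → ℝ} (hφ : IsTest φ)
    (hu : Integrable u unitVol) (hv : Integrable v unitVol) :
    derivPairing (fun x => u x - v x) (rightInt a φ) =
      derivPairing u (rightInt a φ) - derivPairing v (rightInt a φ) := by
  simp only [hφ.derivPairing_rightInt ha, sub_mul]
  rw [integral_sub (hφ.deriv.integrable_mul_fracRight ha.le hu)
    (hφ.deriv.integrable_mul_fracRight ha.le hv)]
  ring

theorem IsTest.derivPairing_leftInt_sub {a : ℝ} (ha : 0 < a) {φ u v : ℝ → ℝ} (hφ : IsTest φ)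
    (hu : Integrable u unitVol) (hv : Integrable v unitVol) :
    derivPairing (fun x => u x - v x) (leftInt a φ) =
      derivPairing u (leftInt a φ) - derivPairing v (leftInt a φ) := by
  simp only [hφ.derivPairing_leftInt ha, sub_mul]
  rw [integral_sub (hφ.deriv.integrable_mul_fracLeft ha.le hu)
    (hφ.deriv.integrable_mul_fracLeft ha.le hv)]
  ring

theorem locallyIntegrableOn_mul_of_bounded {K q : ℝ → ℝ} {M : ℝ} (hKmeas : AEMeasurable K unitVol)
    (hK : ∀ x ∈ Ioo (0 : ℝ) 1, |K x| ≤ M) (hq : LocallyIntegrableOn q (Ioo 0 1)) :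
    LocallyIntegrableOn (fun x => K x * q x) (Ioo 0 1) := by
  rw [locallyIntegrableOn_iff isOpen_Ioo.isLocallyClosed] at hq ⊢
  intro k hk hkc
  refine (hq k hk hkc).bdd_mul (c := M)
    (hKmeas.aestronglyMeasurable.mono_measure (Measure.restrict_mono hk le_rfl)) ?_
  filter_upwards [ae_restrict_mem hkc.measurableSet] with x hx using hK x (hk hx)

/-- Two integrable solutions agree almost everywhere. -/
theorem Admissible.ae_eq_of_isSolution {A B α r lam Km KM : ℝ} (h : Admissible A B r lam)
    (hα : A + B = 2 - α) {K f u v : ℝ → ℝ} (hKm : 0 < Km) (hKmeas : AEMeasurable K unitVol)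
    (hK : ∀ x ∈ Ioo (0 : ℝ) 1, Km ≤ K x ∧ K x ≤ KM)
    (hu : Integrable u unitVol) (hv : Integrable v unitVol)
    (hus : IsSolution α r K f u) (hvs : IsSolution α r K f v) : u =ᵐ[unitVol] v := by
  obtain ⟨q, ⟨hq, hqf⟩, hqd⟩ := hus.equation
  obtain ⟨p, ⟨hp, hpf⟩, hpd⟩ := hvs.equation
  have habs : ∀ x ∈ Ioo (0 : ℝ) 1, |K x| ≤ KM := fun x hx => by
    rw [abs_of_pos (hKm.trans_le (hK x hx).1)]; exact (hK x hx).2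
  have hKq := locallyIntegrableOn_mul_of_bounded hKmeas habs hq
  have hKp := locallyIntegrableOn_mul_of_bounded hKmeas habs hp
  -- The same source cancels, so `K (q - p)` has zero distributional derivative.
  obtain ⟨C, hC⟩ := ae_eq_const_of_integral_mul_deriv_eq_zero (hKq.sub hKp) fun χ hχ => by
    simp only [Pi.sub_apply, sub_mul]
    rw [integral_sub (hχ.deriv.integrable_mul hKq) (hχ.deriv.integrable_mul hKp), hqd χ hχ,
      hpd χ hχ, sub_self]
  have h0 := hus.left_zero.sub hvs.left_zero
  have h1 := hus.right_zero.sub hvs.right_zero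
  rw [sub_zero] at h0 h1
  have hz := h.unique (u := fun x => u x - v x) (q := fun x => q x - p x) (C := C) (hu.sub hv) h0 h1
    hKm hKmeas hK ?_ fun φ hφ => ?_
  · filter_upwards [hz] with x hx using sub_eq_zero.1 hx
  · filter_upwards [hC, ae_unitVol_mem] with x hx hx01
    have := hKm.trans_le (hK x hx01).1
    rw [eq_div_iff this.ne']
    simp only [Pi.sub_apply] at hx
    linarith
  · simp only [sub_mul]
    rw [integral_sub (hφ.integrable_mul hq) (hφ.integrable_mul hp), hqf φ hφ, hpf φ hφ, ← hα,
      hφ.derivPairing_rightInt_sub h.pos hu hv, hφ.derivPairing_leftInt_sub h.pos hu hv]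
    ring

/-- The flux of the solution: its constant of integration is fixed by orthogonality to
`(1-s)^{-A} s^{-B}`. -/
theorem Admissible.exists_flux {A B r lam Km KM e : ℝ} (h : Admissible A B r lam)
    {K f : ℝ → ℝ} (hKm : 0 < Km) (hKmeas : AEMeasurable K unitVol)
    (hK : ∀ x ∈ Ioo (0 : ℝ) 1, Km ≤ K x ∧ K x ≤ KM) (he : 0 < e) (heAB : A + B + e < 1)
    (hf : Integrable (fun s => f s * (s * (1 - s)) ^ e) unitVol) :
    ∃ q : ℝ → ℝ, ∃ M : ℝ, 0 ≤ M ∧ AEStronglyMeasurable q unitVol ∧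
      (∀ s ∈ Ioo (0 : ℝ) 1, |q s| ≤ M * (s ^ (-e) * (1 - s) ^ (-e))) ∧
      ∫ s, (1 - s) ^ (-A) * (s ^ (-B) * q s) ∂unitVol = 0 ∧
      NegWeakDeriv (fun x => K x * q x) f := by
  have hA := h.nonneg_left
  have hB := h.nonneg_right
  have hfl := locallyIntegrableOn_of_mul_rpow hf
  set F : ℝ → ℝ := fun x => ∫ t in (1 / 2 : ℝ)..x, f t with hF
  set N := ∫ s, |f s * (s * (1 - s)) ^ e| ∂unitVol with hN
  have hN0 : 0 ≤ N := integral_nonneg fun _ => abs_nonneg _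
  have hFle : ∀ s ∈ Ioo (0 : ℝ) 1, |F s| ≤ N * (s ^ (-e) * (1 - s) ^ (-e)) := fun s hs =>
    abs_primitive_le he hf hs
  have hFm : AEMeasurable F unitVol :=
    (continuousOn_primitive hfl).aemeasurable measurableSet_Ioo
  set w : ℝ → ℝ := fun s => (1 - s) ^ (-A) * s ^ (-B) with hw
  have hwm : Measurable w := by rw [hw]; fun_prop
  have hw1 : ∀ s ∈ Ioo (0 : ℝ) 1, 1 ≤ w s := fun s hs =>
    one_le_weight (neg_nonpos.2 hA) (neg_nonpos.2 hB) hs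
  have hKpos : ∀ s ∈ Ioo (0 : ℝ) 1, 0 < K s := fun s hs => hKm.trans_le (hK s hs).1
  have hKinv : ∀ s ∈ Ioo (0 : ℝ) 1, (K s)⁻¹ ≤ Km⁻¹ := fun s hs => inv_anti₀ hKm (hK s hs).1
  have hwi : Integrable w unitVol := by
    have := integrableOn_beta (p := 1 - B) (q := 1 - A) (by linarith) (by linarith)
    refine this.congr_fun (fun s _ => ?_) measurableSet_Ioo
    simp only [hw]
    rw [mul_comm, show 1 - A - 1 = -A by ring, show 1 - B - 1 = -B by ring]
  have hKim : AEStronglyMeasurable (fun s => (K s)⁻¹) unitVol := hKmeas.inv.aestronglyMeasurable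
  have hKib : ∀ᵐ s ∂unitVol, ‖(K s)⁻¹‖ ≤ Km⁻¹ := by
    filter_upwards [ae_unitVol_mem] with s hs
    rw [Real.norm_of_nonneg (inv_nonneg.2 (hKpos s hs).le)]
    exact hKinv s hs
  have hi1 : Integrable (fun s => w s * (K s)⁻¹) unitVol := hwi.mul_bdd hKim hKib
  have hwF : Integrable (fun s => w s * F s) unitVol := by
    have := (integrableOn_beta (p := 1 - B - e) (q := 1 - A - e) (by linarith)
      (by linarith)).const_mul N
    refine Integrable.mono' this (hwm.aemeasurable.mul hFm).aestronglyMeasurable ?_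
    filter_upwards [ae_unitVol_mem] with s hs
    have hs1 : 0 < 1 - s := sub_pos.2 hs.2
    have e1 : s ^ (1 - B - e - 1) = s ^ (-B) * s ^ (-e) := by
      rw [← Real.rpow_add hs.1]; ring_nf
    have e2 : (1 - s) ^ (1 - A - e - 1) = (1 - s) ^ (-A) * (1 - s) ^ (-e) := by
      rw [← Real.rpow_add hs1]; ring_nf
    have hwp : 0 < w s := zero_lt_one.trans_le (hw1 s hs)
    rw [norm_mul, Real.norm_of_nonneg hwp.le, Real.norm_eq_abs, e1, e2]
    refine (mul_le_mul_of_nonneg_left (hFle s hs) hwp.le).trans_eq ?_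
    simp only [hw]; ring
  have hi2 : Integrable (fun s => w s * F s * (K s)⁻¹) unitVol := hwF.mul_bdd hKim hKib
  have hI : 0 < ∫ s, w s * (K s)⁻¹ ∂unitVol := by
    have hKM : 0 < KM := (hKpos (1 / 2) (by norm_num)).trans_le (hK (1 / 2) (by norm_num)).2
    have : ∫ _, KM⁻¹ ∂unitVol ≤ ∫ s, w s * (K s)⁻¹ ∂unitVol := by
      refine integral_mono_ae (integrable_const _) hi1 ?_
      filter_upwards [ae_unitVol_mem] with s hs
      have h2 : KM⁻¹ ≤ (K s)⁻¹ := inv_anti₀ (hKpos s hs) (hK s hs).2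
      exact h2.trans (le_mul_of_one_le_left (inv_nonneg.2 (hKpos s hs).le) (hw1 s hs))
    refine lt_of_lt_of_le ?_ this
    simpa using hKM
  -- The solution of `∫ w (c - F)/K = 0`, a linear equation for `c`; its coefficient is positive by
  -- `hI`.
  set c := (∫ s, w s * F s * (K s)⁻¹ ∂unitVol) / ∫ s, w s * (K s)⁻¹ ∂unitVol with hc
  refine ⟨fun s => (c - F s) * (K s)⁻¹, (|c| + N) * Km⁻¹, by positivity,
    ((aemeasurable_const.sub hFm).mul hKmeas.inv).aestronglyMeasurable, fun s hs => ?_, ?_, ?_⟩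
  · have hs1 : 0 < 1 - s := sub_pos.2 hs.2
    have hz : 1 ≤ s ^ (-e) * (1 - s) ^ (-e) := one_le_mul_of_one_le_of_one_le
      (Real.one_le_rpow_of_pos_of_le_one_of_nonpos hs.1 hs.2.le (by linarith))
      (Real.one_le_rpow_of_pos_of_le_one_of_nonpos hs1 (by linarith [hs.1]) (by linarith))
    rw [abs_mul, abs_of_pos (inv_pos.2 (hKpos s hs))]
    have h1 : |c - F s| ≤ (|c| + N) * (s ^ (-e) * (1 - s) ^ (-e)) := by
      refine (abs_sub c (F s)).trans ?_
      have := le_mul_of_one_le_right (abs_nonneg c) hz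
      linarith [hFle s hs]
    calc |c - F s| * (K s)⁻¹ ≤ (|c| + N) * (s ^ (-e) * (1 - s) ^ (-e)) * Km⁻¹ :=
          mul_le_mul h1 (hKinv s hs) (inv_nonneg.2 (hKpos s hs).le) (by positivity)
      _ = _ := by ring
  · have : ∀ s, (1 - s) ^ (-A) * (s ^ (-B) * ((c - F s) * (K s)⁻¹)) =
        c * (w s * (K s)⁻¹) - w s * F s * (K s)⁻¹ := fun s => by simp only [hw]; ring
    simp only [this]
    rw [integral_sub (hi1.const_mul c) hi2, integral_const_mul, hc, div_mul_cancel₀ _ hI.ne',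
      sub_self]
  · refine negWeakDeriv_primitive hfl (c := c) fun x hx => ?_
    have := (hKpos x hx).ne'
    field_simp
    rfl

theorem tendsto_zero_of_abs_le {u : ℝ → ℝ} {C γ : ℝ} (hγ : 0 < γ)
    (hle : ∀ x ∈ Ioo (0 : ℝ) 1, |u x| ≤ C * (x ^ γ * (1 - x) ^ γ)) :
    Tendsto u (𝓝[>] 0) (𝓝 0) ∧ Tendsto u (𝓝[<] 1) (𝓝 0) := by
  have hcont : Continuous fun x : ℝ => C * (x ^ γ * (1 - x) ^ γ) := by
    have h1 : Continuous fun x : ℝ => x ^ γ := Real.continuous_rpow_const hγ.le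
    exact continuous_const.mul (h1.mul (h1.comp (continuous_const.sub continuous_id)))
  have h0 := hcont.tendsto 0
  have h1 := hcont.tendsto 1
  simp only [Real.zero_rpow hγ.ne', sub_self, zero_mul, mul_zero] at h0 h1
  constructor
  · refine squeeze_zero_norm' ?_ (h0.mono_left nhdsWithin_le_nhds)
    filter_upwards [Ioo_mem_nhdsGT zero_lt_one] with x hx using hle x hx
  · refine squeeze_zero_norm' ?_ (h1.mono_left nhdsWithin_le_nhds)
    filter_upwards [Ioo_mem_nhdsLT zero_lt_one] with x hx using hle x hx

/-- Squaring the bound on `u` adds `2γ` to the exponents `-b` and `-a`, which are at least `-1`, and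
so makes the product integrable at both ends. -/
theorem memLp_weightMeasure_of_abs_le {a b C γ : ℝ} (ha : a ≤ 1) (hb : b ≤ 1) (hγ : 0 < γ)
    {u : ℝ → ℝ} (hu : Measurable u)
    (hle : ∀ x ∈ Ioo (0 : ℝ) 1, |u x| ≤ C * (x ^ γ * (1 - x) ^ γ)) :
    MemLp u 2 (weightMeasure (-a) (-b)) := by
  rw [memLp_weightMeasure_iff _ _ hu.aestronglyMeasurable]
  have := (integrableOn_beta (p := 2 * γ + 1 - b) (q := 2 * γ + 1 - a) (by linarith)
    (by linarith)).const_mul (C ^ 2)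
  refine Integrable.mono' this
    ((measurable_weight _ _).mul (hu.pow_const 2)).aestronglyMeasurable ?_
  filter_upwards [ae_unitVol_mem] with x hx
  have hx1 : 0 < 1 - x := sub_pos.2 hx.2
  have hw := weight_pos (a := -a) (b := -b) hx
  have e1 : x ^ (2 * γ + 1 - b - 1) = x ^ (-b) * (x ^ γ) ^ 2 := by
    rw [sq, ← Real.rpow_add hx.1, ← Real.rpow_add hx.1]; ring_nf
  have e2 : (1 - x) ^ (2 * γ + 1 - a - 1) = (1 - x) ^ (-a) * ((1 - x) ^ γ) ^ 2 := by
    rw [sq, ← Real.rpow_add hx1, ← Real.rpow_add hx1]; ring_nf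
  rw [Real.norm_of_nonneg (mul_nonneg hw.le (sq_nonneg _)), e1, e2, ← sq_abs]
  refine (mul_le_mul_of_nonneg_left
    (pow_le_pow_left₀ (abs_nonneg _) (hle x hx) 2) hw.le).trans_eq ?_
  rw [weight]; ring

end FracDiff

open FracDiff

theorem mainTheorem2 (α β r : ℝ) (hα1 : 1 < α) (hα2 : α < 2) (hr0 : 0 ≤ r) (hr1 : r ≤ 1)
    (hβ0 : α - 1 ≤ β) (hβ1 : β ≤ 1)
    (hβ : r = Real.sin (Real.pi * β) /
      (Real.sin (Real.pi * (α - β)) + Real.sin (Real.pi * β)))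
    (K : ℝ → ℝ) (hKmeas : AEMeasurable K (volume.restrict (Ioo (0 : ℝ) 1)))
    (Km KM : ℝ) (hKm : 0 < Km) (hK : ∀ x ∈ Ioo (0 : ℝ) 1, Km ≤ K x ∧ K x ≤ KM)
    (f : ℝ → ℝ) (hf : MemLp f 2 (FracDiff.weightMeasure β (α - β))) :
    ∃! u : Lp ℝ 2 (FracDiff.weightMeasure (-(α - β)) (-β)),
      FracDiff.IsSolution α r K f u := by
  obtain ⟨lam, h⟩ := admissible_of_order hα1 hα2 hβ0 hβ1 hβ
  have hα : 1 - β + (1 - (α - β)) = 2 - α := by ring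
  have hpos := h.pos
  have hlt := h.lt_one
  -- Any positive exponent is available for the primitive of `f`; this one is the growth rate
  -- allowed by `Admissible.exists_of_flux`.
  set e := (1 - (1 - β + (1 - (α - β)))) / 8 with he
  have he0 : 0 < e := by linarith
  obtain ⟨q, M, hM, hqm, hqle, hq0, hqd⟩ := h.exists_flux hKm hKmeas hK he0 (by linarith)
    (integrable_mul_rpow_of_memLp hβ1 (by linarith) he0 hf)
  obtain ⟨u, C, γ, hγ, -, hum, hule, hufl⟩ := h.exists_of_flux hqm hM hqle hq0
  rw [hα] at hufl
  have hqi : IntegrableOn q (Ioo 0 1) := by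
    have := (integrableOn_beta (p := 1 - e) (q := 1 - e) (by linarith) (by linarith)).const_mul M
    refine Integrable.mono' this hqm ?_
    filter_upwards [ae_unitVol_mem] with s hs
    rw [sub_right_comm, sub_self, zero_sub]
    exact hqle s hs
  have hlim := tendsto_zero_of_abs_le hγ hule
  have hsol : IsSolution α r K f u :=
    ⟨⟨q, ⟨hqi.locallyIntegrableOn, hufl⟩, hqd⟩, hlim.1.mono_left inf_le_left,
      hlim.2.mono_left inf_le_left⟩
  have hmem : MemLp u 2 (weightMeasure (-(α - β)) (-β)) :=
    memLp_weightMeasure_of_abs_le (by linarith) hβ1 hγ hum hule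
  have hsol' : IsSolution α r K f (hmem.toLp u) :=
    hsol.congr_ae ((unitVol_absolutelyContinuous _ _).ae_eq hmem.coeFn_toLp.symm)
  refine ⟨hmem.toLp u, hsol', fun v hv => Lp.ext ?_⟩
  have hint : ∀ v : Lp ℝ 2 (weightMeasure (-(α - β)) (-β)), Integrable v unitVol := fun v =>
    integrable_of_memLp_weightMeasure (by linarith) (by linarith) (Lp.memLp v)
  exact (weightMeasure_absolutelyContinuous _ _).ae_eq
    (h.ae_eq_of_isSolution hα hKm hKmeas hK (hint _) (hint _) hv hsol')
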